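/- Let $N\ge 0$ be an integer, $k\ge 0$ and $k_1$ real numbers. The group $S_N$ acts on real polynomials in $x=(x_1,\dots,x_N)$ by $wx_i=x_{w(i)}$ and on compositions $\alpha\in\mathbb{Z}_{\ge 0}^N$ by $(w\alpha)_i=\alpha_{w^{-1}(i)}$; $(ij)$ denotes a transposition, $|\alpha|=\sum_i\alpha_i$, and $\alpha^+$ is the non-increasing rearrangement of $\alpha$. Write $\alpha\succ\beta$ if $\alpha\ne\beta$ and $\sum_{i\le j}\alpha_i\ge\sum_{i\le j}\beta_i$ for $1\le j\le N$. *Type A.* Let $T_if=\frac{\partial f}{\partial x_i}+k\sum_{j\ne i}\frac{f-(ij)f}{x_i-x_j}$. Define polynomials $p_\alpha$ by $\sum_\alpha p_\alpha(x)y^\alpha=\prod_{i=1}^N\bigl\{(1-x_iy_i)^{-1}\prod_{j=1}^N(1-x_iy_j)^{-k}\bigr\}$; they form a basis of the polynomials. Let $\rho_i$ be the linear operator with $\rho_ip_\alpha=p_{\alpha+e_i}$ for all $\alpha$ (where $e_i$ is the $i$-th unit vector), let $U_i=T_i\rho_i-k\sum_{j<i}(ij)$, and let $$\kappa_i(\alpha)=Nk-k\bigl(\#\{s:\alpha_s>\alpha_i\}+\#\{s:s<i,\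 \alpha_s=\alpha_i\}\bigr)+\alpha_i+1 .$$ For a partition $\lambda$ let $E_\lambda(x;1/k)$ be the simultaneous eigenfunction of $U_1,\dots,U_N$ of the form $x^\lambda+\sum_\beta A'_\beta x^\beta$, the sum over $|\beta|=|\lambda|$ with $\beta^+\prec\lambda$, or $\beta^+=\lambda$ and $\beta\prec\lambda$. Let $\omega_\lambda$ be the scalar multiple of $E_\lambda(x;1/k)$ of the form $p_\lambda+\sum_\beta B_\beta p_\beta$, the sum over $|\beta|=|\lambda|$, $\beta^+\succ\lambda$, and put $\omega_{w\lambda}=w\omega_\lambda$ for $w\in S_N$ (this is well defined). The non-symmetric Jack polynomial $\zeta_\alpha$ is the unique polynomial with $U_i\zeta_\alpha=\kappa_i(\alpha)\zeta_\alpha$ for $1\le i\le N$ that is of the form $\omega_\alpha+\sum_\beta b_\beta\omega_\beta$, the sum over $\beta^+=\alpha^+$, $\beta\succ\alpha$. *Type B.* Let $\sigma_i$ be the substitution $x_i\mapsto-x_i$, let $\sigma_{ij}=(ij)$ be the exchange of $x_i$ and $x_j$, and let $\tau_{ij}$ be the substitution $x_i\mapsto-x_j,\ x_j\mapsto-x_i$.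 Let $$T^B_if=\frac{\partial f}{\partial x_i}+k_1\frac{f-\sigma_if}{x_i}+k\sum_{j\ne i}\Bigl\{\frac{f-\sigma_{ij}f}{x_i-x_j}+\frac{f-\tau_{ij}f}{x_i+x_j}\Bigr\}.$$ Put $h(\alpha)=(\lfloor\alpha_1/2\rfloor,\dots,\lfloor\alpha_N/2\rfloor)$ and $x^2=(x_1^2,\dots,x_N^2)$. Let $\hat p_\alpha(x)=\bigl(\prod_{i:\,\alpha_i\text{ odd}}x_i\bigr)\,p_{h(\alpha)}(x^2)$ (again a basis), let $\hat\rho_i$ be the linear operator with $\hat\rho_i\hat p_\alpha=\hat p_{\alpha+e_i}$ for all $\alpha$, and let $U^B_i=T^B_i\hat\rho_i-k\sum_{j<i}(\sigma_{ij}+\tau_{ij})$. **Proposition 5.6.** Let $0\le\ell\le N$ and let $\alpha$ be a standard $B$-partition with $\ell$ odd parts, that is, $\alpha_i$ is odd exactly when $i\le\ell$, $\alpha_1\ge\dots\ge\alpha_\ell$, and $\alpha_{\ell+1}\ge\dots\ge\alpha_N$. Let $G_\ell\subset S_N$ be the subgroup of the permutations that preserve $\{1,\dots,\ell\}$ and $\{\ell+1,\dots,N\}$,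 so $G_\ell\cong S_\ell\times S_{N-\ell}$, and let $$E^B_\alpha=\operatorname{span}\{x_1\cdots x_\ell\,\zeta_\gamma(x^2):\gamma=w\,h(\alpha),\ w\in G_\ell\}.$$ Then $E^B_\alpha$ is invariant under $G_\ell$. For each $\gamma=w\,h(\alpha)$ with $w\in G_\ell$, the polynomial $x_1\cdots x_\ell\,\zeta_\gamma(x^2)$ is non-zero and $$U^B_i\bigl(x_1\cdots x_\ell\,\zeta_\gamma(x^2)\bigr)=c_i\,x_1\cdots x_\ell\,\zeta_\gamma(x^2)\qquad(1\le i\le N),$$ where $c_i=2\kappa_i(\gamma)$ for $i\le\ell$ and $c_i=2\bigl(\kappa_i(\gamma)+k_1-k-\tfrac12\bigr)$ for $i>\ell$. -/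

import Mathlib

/-! Type `A` and type `B` Dunkl operators on real polynomials in `N` variables, the non-symmetric
Jack polynomials `ζ_α`, and the commuting operators `U_i`, `U^B_i`.

The variables are indexed by `Fin N`, so the interval `[1, ℓ]` is `{i | i < ℓ}`.  Compositions are
functions `Fin N → ℕ`.  Objects given by a characterising property ("the polynomial such that …",
"the linear map such that …") are written with `Classical.epsilon`: nothing can be proved about
them before an object with that property has been shown to exist. -/

namespace DunklJack

/-- Real polynomials in `N` variables. -/
abbrev Poly (N : ℕ) : Type := MvPolynomial (Fin N) ℝ

/-! ### Compositions -/

/-- The action of permutations on compositions, `(w α)_i = α_{w⁻¹(i)}`. -/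
def permComp {N : ℕ} (w : Equiv.Perm (Fin N)) (α : Fin N → ℕ) : Fin N → ℕ :=
  fun i => α (w⁻¹ i)

/-- The (stable) permutation that sorts `α` into non-increasing order:
`α = permComp (sortPerm α) (α⁺)`. -/
def sortPerm {N : ℕ} (α : Fin N → ℕ) : Equiv.Perm (Fin N) :=
  Tuple.sort (fun i => OrderDual.toDual (α i))

/-- `α⁺`, the partition obtained by sorting `α`. -/
def plus {N : ℕ} (α : Fin N → ℕ) : Fin N → ℕ := fun i => α (sortPerm α i)

theorem plus_antitone {N : ℕ} (α : Fin N → ℕ) : Antitone (plus α) := by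
  intro i j hij
  exact Tuple.monotone_sort (fun i => OrderDual.toDual (α i)) hij

theorem permComp_sortPerm_plus {N : ℕ} (α : Fin N → ℕ) :
    permComp (sortPerm α) (plus α) = α := by
  funext i
  simp [permComp, plus]

/-- `|α|`. -/
def size {N : ℕ} (α : Fin N → ℕ) : ℕ := ∑ i, α i

/-- Strict dominance order `α ≻ β`: all partial sums of `α` are at least those of `β`, and
`α ≠ β`. -/
def StrictDom {N : ℕ} (α β : Fin N → ℕ) : Prop :=
  (∀ j : Fin N, ∑ i ∈ Finset.Iic j, β i ≤ ∑ i ∈ Finset.Iic j, α i) ∧ α ≠ β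

/-- `κ_i(α) = Nk - k(#{s : α_s > α_i} + #{s : s < i, α_s = α_i}) + α_i + 1`. -/
noncomputable def kappa {N : ℕ} (k : ℝ) (α : Fin N → ℕ) (i : Fin N) : ℝ :=
  N * k
    - k * (((Finset.univ.filter fun s => α i < α s).card : ℝ)
        + ((Finset.univ.filter fun s => s < i ∧ α s = α i).card : ℝ))
    + α i + 1

/-! ### Reflections acting on polynomials -/

/-- `(w f)(x) = f(x w)` with `(x w)_i = x_{w(i)}`, for a permutation `w`. -/
noncomputable def permAct {N : ℕ} (w : Equiv.Perm (Fin N)) : Poly N →ₐ[ℝ] Poly N :=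
  MvPolynomial.rename w

/-- `f(x) ↦ f(x τ_{ij})`: replace `x_i` by `-x_j` and `x_j` by `-x_i`. -/
noncomputable def tauAct {N : ℕ} (i j : Fin N) : Poly N →ₐ[ℝ] Poly N :=
  MvPolynomial.aeval fun m =>
    if m = i then -MvPolynomial.X j else if m = j then -MvPolynomial.X i else MvPolynomial.X m

/-- `f(x) ↦ f(x σ_i)`: replace `x_i` by `-x_i`. -/
noncomputable def signAct {N : ℕ} (i : Fin N) : Poly N →ₐ[ℝ] Poly N :=
  MvPolynomial.aeval fun m => if m = i then -MvPolynomial.X i else MvPolynomial.X m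

/-- The exact quotient `g / d` of polynomials, used only when `d ≠ 0` divides `g`. -/
noncomputable def exactQuot {N : ℕ} (g d : Poly N) : Poly N :=
  Classical.epsilon fun q => d * q = g

theorem mul_exactQuot {N : ℕ} {g d : Poly N} (h : d ∣ g) : d * exactQuot g d = g := by
  obtain ⟨q, hq⟩ := h
  exact Classical.epsilon_spec (p := fun q => d * q = g) ⟨q, hq.symm⟩

theorem dvd_sub_of_forall {N : ℕ} (s : Poly N →ₐ[ℝ] Poly N) (d : Poly N)
    (h : ∀ m, d ∣ MvPolynomial.X m - s (MvPolynomial.X m)) (f : Poly N) : d ∣ f - s f := by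
  have key : (Ideal.Quotient.mkₐ ℝ (Ideal.span {d}))
      = (Ideal.Quotient.mkₐ ℝ (Ideal.span {d})).comp s := by
    apply MvPolynomial.algHom_ext
    intro m
    simp only [AlgHom.comp_apply, Ideal.Quotient.mkₐ_eq_mk]
    rw [Ideal.Quotient.eq, Ideal.mem_span_singleton]
    exact h m
  have := congrArg (fun φ => φ f) key
  simp only [AlgHom.comp_apply, Ideal.Quotient.mkₐ_eq_mk] at this
  rwa [Ideal.Quotient.eq, Ideal.mem_span_singleton] at this

/-! The quotients that occur in the Dunkl operators below are exact. -/

theorem dvd_swap {N : ℕ} (i j : Fin N) (f : Poly N) :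
    (MvPolynomial.X i - MvPolynomial.X j : Poly N) ∣ f - permAct (Equiv.swap i j) f := by
  apply dvd_sub_of_forall
  intro m
  simp only [permAct, MvPolynomial.rename_X]
  rcases eq_or_ne m i with rfl | hi
  · simp
  · rcases eq_or_ne m j with rfl | hj
    · rw [Equiv.swap_apply_right]
      exact ⟨-1, by ring⟩
    · rw [Equiv.swap_apply_of_ne_of_ne hi hj]
      simp

theorem dvd_tau {N : ℕ} (i j : Fin N) (f : Poly N) :
    (MvPolynomial.X i + MvPolynomial.X j : Poly N) ∣ f - tauAct i j f := by
  apply dvd_sub_of_forall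
  intro m
  simp only [tauAct, MvPolynomial.aeval_X]
  split_ifs with hi hj
  · subst hi; exact ⟨1, by ring⟩
  · subst hj; exact ⟨1, by ring⟩
  · simp

theorem dvd_sign {N : ℕ} (i : Fin N) (f : Poly N) :
    (MvPolynomial.X i : Poly N) ∣ f - signAct i f := by
  apply dvd_sub_of_forall
  intro m
  simp only [signAct, MvPolynomial.aeval_X]
  split_ifs with hi
  · subst hi; exact ⟨2, by ring⟩
  · simp

/-! ### The type A operators -/

/-- The type A Dunkl operator
`T_i f = ∂f/∂x_i + k ∑_{j ≠ i} (f - (ij) f) / (x_i - x_j)`. -/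
noncomputable def dunklA {N : ℕ} (k : ℝ) (i : Fin N) (f : Poly N) : Poly N :=
  MvPolynomial.pderiv i f
    + k • ∑ j ∈ Finset.univ.erase i,
        exactQuot (f - permAct (Equiv.swap i j) f) (MvPolynomial.X i - MvPolynomial.X j)

/-- `(1 - x_i y_j)^{-s} = ∑_m ((s)_m / m!) x_i^m y_j^m`, a formal power series in `y` with
coefficients in the polynomials in `x`. -/
noncomputable def invPow {N : ℕ} (s : ℝ) (i j : Fin N) : MvPowerSeries (Fin N) (Poly N) :=
  fun n =>
    if ∀ m, m ≠ j → n m = 0 then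
      MvPolynomial.C ((ascPochhammer ℝ (n j)).eval s / ((n j).factorial : ℝ))
        * MvPolynomial.X i ^ n j
    else 0

/-- The generating function
`F_k(x, y) = ∏_i ((1 - x_i y_i)^{-1} ∏_j (1 - x_i y_j)^{-k})`. -/
noncomputable def genFun (N : ℕ) (k : ℝ) : MvPowerSeries (Fin N) (Poly N) :=
  ∏ i, (invPow 1 i i * ∏ j, invPow k i j)

/-- `p_α(x)`, the coefficient of `y^α` in `F_k(x, y)`. -/
noncomputable def pPoly {N : ℕ} (k : ℝ) (α : Fin N → ℕ) : Poly N :=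
  MvPowerSeries.coeff (Finsupp.equivFunOnFinite.symm α) (genFun N k)

/-- The raising operator `ρ_i`: the linear map with `ρ_i p_α = p_{α + e_i}` for all `α`
(for `k ≥ 0` the `p_α` form a basis of the polynomials). -/
noncomputable def raise {N : ℕ} (k : ℝ) (i : Fin N) : Module.End ℝ (Poly N) :=
  Classical.epsilon fun R => ∀ α : Fin N → ℕ, R (pPoly k α) = pPoly k (α + Pi.single i 1)

/-- `U_i = T_i ρ_i - k ∑_{j < i} (ij)`. -/
noncomputable def opU {N : ℕ} (k : ℝ) (i : Fin N) (f : Poly N) : Poly N :=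
  dunklA k i (raise k i f) - k • ∑ j ∈ Finset.Iio i, permAct (Equiv.swap i j) f

/-! ### Non-symmetric Jack polynomials -/

/-- The monomial `x^α`. -/
noncomputable def mono {N : ℕ} (α : Fin N → ℕ) : Poly N := ∏ i, MvPolynomial.X i ^ α i

/-- `f` is the monic non-symmetric Jack polynomial of index `α`: a simultaneous eigenfunction of
all `U_i` of the form `x^α + ∑ A'(β, α) x^β`, the sum over `|β| = |α|` with `β⁺ ≺ α⁺`, or
`β⁺ = α⁺` and `β ≺ α`. -/
def IsMonicJack {N : ℕ} (k : ℝ) (α : Fin N → ℕ) (f : Poly N) : Prop :=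
  (∀ i, ∃ c : ℝ, opU k i f = c • f) ∧
  f - mono α ∈ Submodule.span ℝ
    {q : Poly N | ∃ β : Fin N → ℕ, size β = size α ∧
      (StrictDom (plus α) (plus β) ∨ (plus β = plus α ∧ StrictDom α β)) ∧ q = mono β}

/-- The monic non-symmetric Jack polynomial `E_α(x; 1/k)`. -/
noncomputable def monicJack {N : ℕ} (k : ℝ) (α : Fin N → ℕ) : Poly N :=
  Classical.epsilon (IsMonicJack k α)

/-- For a partition `λ`, `ω_λ` is the scalar multiple of `E_λ(x; 1/k)` of the form
`p_λ + ∑ B(β, λ) p_β`, the sum over `|β| = |λ|` with `β⁺ ≻ λ`. -/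
noncomputable def omegaPart {N : ℕ} (k : ℝ) (lam : Fin N → ℕ) : Poly N :=
  Classical.epsilon fun f =>
    (∃ c : ℝ, f = c • monicJack k lam) ∧
    f - pPoly k lam ∈ Submodule.span ℝ
      {q : Poly N | ∃ β : Fin N → ℕ, size β = size lam ∧ StrictDom (plus β) lam ∧ q = pPoly k β}

/-- `ω_{wλ} = w ω_λ` for a partition `λ` and `w ∈ S_N`.  Here `α = w α⁺` with `w = sortPerm α`;
the result does not depend on which such `w` is taken. -/
noncomputable def omega {N : ℕ} (k : ℝ) (α : Fin N → ℕ) : Poly N :=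
  permAct (sortPerm α) (omegaPart k (plus α))

/-- The properties that single out `ζ_α`: `U_i ζ_α = κ_i(α) ζ_α` for all `i`, and
`ζ_α = ω_α + ∑ B(β, α) ω_β`, the sum over `β⁺ = α⁺`, `β ≻ α`. -/
def IsZeta {N : ℕ} (k : ℝ) (α : Fin N → ℕ) (f : Poly N) : Prop :=
  (∀ i, opU k i f = kappa k α i • f) ∧
  f - omega k α ∈ Submodule.span ℝ
    {q : Poly N | ∃ β : Fin N → ℕ, plus β = plus α ∧ StrictDom β α ∧ q = omega k β}

/-- The non-symmetric Jack polynomial `ζ_α`. -/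
noncomputable def zeta {N : ℕ} (k : ℝ) (α : Fin N → ℕ) : Poly N :=
  Classical.epsilon (IsZeta k α)

/-! ### The type B operators -/

/-- The type B Dunkl operator
`T^B_i f = ∂f/∂x_i + k₁ (f - f(x σ_i)) / x_i
  + k ∑_{j ≠ i} ((f - f(x σ_{ij})) / (x_i - x_j) + (f - f(x τ_{ij})) / (x_i + x_j))`. -/
noncomputable def dunklB {N : ℕ} (k k₁ : ℝ) (i : Fin N) (f : Poly N) : Poly N :=
  MvPolynomial.pderiv i f
    + k₁ • exactQuot (f - signAct i f) (MvPolynomial.X i)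
    + k • ∑ j ∈ Finset.univ.erase i,
        (exactQuot (f - permAct (Equiv.swap i j) f) (MvPolynomial.X i - MvPolynomial.X j)
          + exactQuot (f - tauAct i j f) (MvPolynomial.X i + MvPolynomial.X j))

/-- `h(α) = (⌊α_1/2⌋, …, ⌊α_N/2⌋)`. -/
def half {N : ℕ} (α : Fin N → ℕ) : Fin N → ℕ := fun i => α i / 2

/-- `g(x) ↦ g(x_1², …, x_N²)`. -/
noncomputable def sqSubst {N : ℕ} (g : Poly N) : Poly N := MvPolynomial.expand 2 g

/-- `p̂_α(x) = x_A p_{h(α)}(x_1², …, x_N²)`, where `A = {i : α_i is odd}` and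
`x_A = ∏_{i ∈ A} x_i`. -/
noncomputable def pHat {N : ℕ} (k : ℝ) (α : Fin N → ℕ) : Poly N :=
  (∏ i ∈ Finset.univ.filter (fun i => Odd (α i)), MvPolynomial.X i) * sqSubst (pPoly k (half α))

/-- The raising operator `ρ̂_i`: the linear map with `ρ̂_i p̂_α = p̂_{α + e_i}` for all `α`
(for `k ≥ 0` the `p̂_α` form a basis of the polynomials). -/
noncomputable def raiseHat {N : ℕ} (k : ℝ) (i : Fin N) : Module.End ℝ (Poly N) :=
  Classical.epsilon fun R => ∀ α : Fin N → ℕ, R (pHat k α) = pHat k (α + Pi.single i 1)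

/-- `U^B_i = T^B_i ρ̂_i - k ∑_{j < i} (σ_{ij} + τ_{ij})`. -/
noncomputable def opUB {N : ℕ} (k k₁ : ℝ) (i : Fin N) (f : Poly N) : Poly N :=
  dunklB k k₁ i (raiseHat k i f)
    - k • ∑ j ∈ Finset.Iio i, (permAct (Equiv.swap i j) f + tauAct i j f)

/-- `α` is a standard `B`-partition with exactly `ℓ` odd parts: the odd parts are
`α_1, …, α_ℓ`, and the odd parts and the even parts are each non-increasing. -/
structure IsStandardBPartition {N : ℕ} (ℓ : ℕ) (α : Fin N → ℕ) : Prop where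
  le : ℓ ≤ N
  odd_iff : ∀ i : Fin N, Odd (α i) ↔ (i : ℕ) < ℓ
  antitone : ∀ i j : Fin N, i < j → α i ≡ α j [MOD 2] → α j ≤ α i

/-- `G_ℓ = S_{[1, ℓ]} × S_{[ℓ+1, N]}`, as the subgroup of those permutations of the `N` indices
that map `[1, ℓ]` to itself and `[ℓ+1, N]` to itself. -/
def youngSubgroup (N ℓ : ℕ) : Subgroup (Equiv.Perm (Fin N)) where
  carrier := {w | ∀ i : Fin N, (w i : ℕ) < ℓ ↔ (i : ℕ) < ℓ}
  one_mem' := fun _ => Iff.rfl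
  mul_mem' := fun {a b} ha hb i => (ha (b i)).trans (hb i)
  inv_mem' := fun {a} ha i => by
    have h := ha (a⁻¹ i)
    rw [show a (a⁻¹ i) = i from a.apply_symm_apply i] at h
    exact h.symm

/-- `x_1 ⋯ x_ℓ ζ_γ(x_1², …, x_N²)`. -/
noncomputable def zetaB {N : ℕ} (k : ℝ) (ℓ : ℕ) (γ : Fin N → ℕ) : Poly N :=
  (∏ i ∈ Finset.univ.filter (fun i : Fin N => (i : ℕ) < ℓ), MvPolynomial.X i)
    * sqSubst (zeta k γ)

/-- `E^B_α = span {x_1 ⋯ x_ℓ ζ_γ(x²) : γ ∈ G_ℓ h(α)}`, for a standard `B`-partition `α` with `ℓ`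
odd parts. -/
noncomputable def spaceEB {N : ℕ} (k : ℝ) (ℓ : ℕ) (α : Fin N → ℕ) : Submodule ℝ (Poly N) :=
  Submodule.span ℝ
    {q : Poly N | ∃ w ∈ youngSubgroup N ℓ, q = zetaB k ℓ (permComp w (half α))}

end DunklJack

namespace DunklJack

open MvPolynomial

variable {N : ℕ}

/-! ### Divided differences and the type A Dunkl operators -/

/-! The first aim is to eliminate the raising operators. The generating function has one factor for
each `y_j`, so `p_α` is a product of one-index polynomials `pCoeff`. Comparing `p_{α+e_i}` with `x_i
p_α` gives `T_i ρ_i = T_i x_i + k` (`dunklA_raise`), and `U_i` becomes the operator `cherednik`,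
whose commutation with adjacent transpositions and with the rotation `affineRaise` is elementary.
That the `p_α` form a basis for `k ≥ 0` follows from positivity of the Cauchy kernel
(`sum_sq_le_sum_pPoly`).

The `U_i` are triangular for the order `JackLT`, downwards on monomials and upwards on the `p_α`,
with the same diagonal entries `κ_i(α)`. For `k ≥ 0` the vector `κ(α)` determines `α`. Hence joint
eigenspaces are at most one-dimensional, and the eigenvalues fix the leading index in either basis
(`exists_leading_of_eigen`). Starting from the constant `1`, the map `affineRaise` and the
intertwiners `(i, i+1) - a` produce an eigenfunction for every composition. This shows that the
chosen `E_λ`, `ω_λ` and `ζ_α` have their defining properties (`isMonicJack_monicJack`,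
`omegaPart_spec`, `isZeta_zeta`).

For type B, consider `x_A g(x²)` with `A = [1, ℓ]`. The contributions of `σ_ij` and `τ_ij` either
add up to twice a type A term in the squared variables or cancel, according to parity. So `U^B_i`
acts on `g` as `2 U_i` for `i ∈ A` and as `2 (U_i + k₁ - k - 1/2)` otherwise (`opUB_of_mem`,
`opUB_of_notMem`), and `g = ζ_γ` gives the eigenvalues. The polynomial is non-zero because `ζ_γ` has
coefficient `1` at `p_γ`. Invariance holds because `G_ℓ` is generated by adjacent transpositions `s`
inside the two blocks: each fixes `x_A` and maps `ζ_γ` into the span of `ζ_γ` and `ζ_{sγ}`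
(`exists_permAct_swap_zeta`). -/

theorem exactQuot_eq {g d q : Poly N} (hd : d ≠ 0) (h : d * q = g) : exactQuot g d = q :=
  mul_left_cancel₀ hd ((mul_exactQuot ⟨q, h.symm⟩).trans h.symm)

theorem X_sub_X_ne_zero {i j : Fin N} (h : i ≠ j) : (X i - X j : Poly N) ≠ 0 :=
  sub_ne_zero.2 fun e => h (X_injective e)

theorem permAct_X (w : Equiv.Perm (Fin N)) (i : Fin N) :
    permAct w (X i : Poly N) = X (w i) := by
  simp [permAct]

theorem permAct_mul (v w : Equiv.Perm (Fin N)) (f : Poly N) :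
    permAct (v * w) f = permAct v (permAct w f) := by
  simp [permAct, rename_rename, Equiv.Perm.coe_mul]

theorem permAct_one (f : Poly N) : permAct 1 f = f := by
  simp only [permAct, Equiv.Perm.coe_one]
  exact rename_id_apply f

theorem permAct_swap_swap (i j : Fin N) (f : Poly N) :
    permAct (Equiv.swap i j) (permAct (Equiv.swap i j) f) = f := by
  rw [← permAct_mul, Equiv.swap_mul_self, permAct_one]

theorem permAct_conj_swap (w : Equiv.Perm (Fin N)) (i j : Fin N) (f : Poly N) :
    permAct w (permAct (Equiv.swap i j) f)
      = permAct (Equiv.swap (w i) (w j)) (permAct w f) := by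
  rw [← permAct_mul, ← permAct_mul, Equiv.mul_swap_eq_swap_mul]

/-- The divided difference `(f - (ij) f) / (x_i - x_j)` as a linear map. -/
noncomputable def divDiff (i j : Fin N) : Poly N →ₗ[ℝ] Poly N :=
  -- With the value zero at `i = j`, the product formula and the equivariance under permutations
  -- need no side condition.
  if h : i = j then 0 else
  { toFun := fun f => exactQuot (f - permAct (Equiv.swap i j) f) (X i - X j)
    map_add' := fun f g => by
      apply exactQuot_eq (X_sub_X_ne_zero h)
      rw [mul_add, mul_exactQuot (dvd_swap i j f), mul_exactQuot (dvd_swap i j g), map_add]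
      ring
    map_smul' := fun c f => by
      apply exactQuot_eq (X_sub_X_ne_zero h)
      rw [mul_smul_comm, RingHom.id_apply, mul_exactQuot (dvd_swap i j f), map_smul, smul_sub] }

theorem divDiff_apply {i j : Fin N} (h : i ≠ j) (f : Poly N) :
    divDiff i j f = exactQuot (f - permAct (Equiv.swap i j) f) (X i - X j) := by
  simp [divDiff, h]

theorem sub_mul_divDiff (i j : Fin N) (f : Poly N) :
    (X i - X j) * divDiff i j f = f - permAct (Equiv.swap i j) f := by
  rcases eq_or_ne i j with rfl | h
  · rw [sub_self, zero_mul, Equiv.swap_self]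
    exact (sub_eq_zero.2 (permAct_one f).symm).symm
  · rw [divDiff_apply h, mul_exactQuot (dvd_swap i j f)]

theorem divDiff_eq {i j : Fin N} (h : i ≠ j) {f q : Poly N}
    (hq : (X i - X j) * q = f - permAct (Equiv.swap i j) f) : divDiff i j f = q :=
  mul_left_cancel₀ (X_sub_X_ne_zero h) ((sub_mul_divDiff i j f).trans hq.symm)

theorem divDiff_mul_of_fixed {i j : Fin N} (h : i ≠ j) {g : Poly N}
    (hg : permAct (Equiv.swap i j) g = g) (f : Poly N) :
    divDiff i j (g * f) = g * divDiff i j f := by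
  apply divDiff_eq h
  rw [mul_left_comm, sub_mul_divDiff, map_mul, hg, mul_sub]

theorem divDiff_X_left_mul {i j : Fin N} (h : i ≠ j) (f : Poly N) :
    divDiff i j (X i * f) = X i * divDiff i j f + permAct (Equiv.swap i j) f := by
  apply divDiff_eq h
  rw [mul_add, mul_left_comm, sub_mul_divDiff, map_mul, permAct_X, Equiv.swap_apply_left]
  ring

theorem divDiff_X_right_mul {i j : Fin N} (h : i ≠ j) (f : Poly N) :
    divDiff i j (X j * f) = X j * divDiff i j f - permAct (Equiv.swap i j) f := by
  apply divDiff_eq h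
  rw [mul_sub, mul_left_comm, sub_mul_divDiff, map_mul, permAct_X, Equiv.swap_apply_right]
  ring

theorem permAct_divDiff (w : Equiv.Perm (Fin N)) (i j : Fin N) (f : Poly N) :
    permAct w (divDiff i j f) = divDiff (w i) (w j) (permAct w f) := by
  rcases eq_or_ne i j with rfl | h
  · simp [divDiff]
  · refine (divDiff_eq (w.injective.ne h) ?_).symm
    have := congrArg (permAct w) (sub_mul_divDiff i j f)
    rwa [map_mul, map_sub, map_sub, permAct_X, permAct_X, permAct_conj_swap] at this

/-- The type A Dunkl operator as a linear map. -/
noncomputable def dunklLin (k : ℝ) (i : Fin N) : Poly N →ₗ[ℝ] Poly N :=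
  (pderiv i).toLinearMap + k • ∑ j ∈ Finset.univ.erase i, divDiff i j

theorem dunklLin_apply (k : ℝ) (i : Fin N) (f : Poly N) :
    dunklLin k i f = pderiv i f + k • ∑ j ∈ Finset.univ.erase i, divDiff i j f := by
  simp [dunklLin, LinearMap.sum_apply]

theorem dunklA_eq (k : ℝ) (i : Fin N) (f : Poly N) : dunklA k i f = dunklLin k i f := by
  rw [dunklLin_apply, dunklA]
  congr 2
  refine Finset.sum_congr rfl fun j hj => ?_
  rw [divDiff_apply (Finset.ne_of_mem_erase hj).symm]

theorem permAct_dunklLin (k : ℝ) (w : Equiv.Perm (Fin N)) (i : Fin N) (f : Poly N) :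
    permAct w (dunklLin k i f) = dunklLin k (w i) (permAct w f) := by
  rw [dunklLin_apply, dunklLin_apply, map_add, map_smul, map_sum]
  congr 1
  · exact (pderiv_rename w.injective i f).symm
  · congr 1
    refine Finset.sum_nbij' w w.symm ?_ ?_ ?_ ?_ ?_
    · intro j hj
      simpa using hj
    · intro j hj
      simp only [Finset.mem_erase, Finset.mem_univ, and_true] at hj ⊢
      exact fun e => hj (by rw [← e, Equiv.apply_symm_apply])
    · simp
    · simp
    · intro j _
      exact permAct_divDiff w i j f

theorem dunklLin_X_self_mul (k : ℝ) (i : Fin N) (f : Poly N) :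
    dunklLin k i (X i * f) = X i * dunklLin k i f + f
      + k • ∑ j ∈ Finset.univ.erase i, permAct (Equiv.swap i j) f := by
  have h : ∑ j ∈ Finset.univ.erase i, divDiff i j (X i * f)
      = X i * (∑ j ∈ Finset.univ.erase i, divDiff i j f)
        + ∑ j ∈ Finset.univ.erase i, permAct (Equiv.swap i j) f := by
    rw [Finset.mul_sum, ← Finset.sum_add_distrib]
    exact Finset.sum_congr rfl fun j hj =>
      divDiff_X_left_mul (Finset.ne_of_mem_erase hj).symm f
  rw [dunklLin_apply, dunklLin_apply, h, Derivation.leibniz, pderiv_X_self, smul_add, mul_add,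
    mul_smul_comm, smul_eq_mul, smul_eq_mul]
  ring

theorem dunklLin_X_mul (k : ℝ) {i j : Fin N} (hij : i ≠ j) (f : Poly N) :
    dunklLin k i (X j * f) = X j * dunklLin k i f - k • permAct (Equiv.swap i j) f := by
  have h : ∑ l ∈ Finset.univ.erase i, divDiff i l (X j * f)
      = X j * (∑ l ∈ Finset.univ.erase i, divDiff i l f) - permAct (Equiv.swap i j) f := by
    have hj : j ∈ Finset.univ.erase i := by simp [hij.symm]
    rw [← Finset.add_sum_erase _ _ hj, ← Finset.add_sum_erase _ _ hj,
      divDiff_X_right_mul hij, mul_add, Finset.mul_sum, sub_add_eq_add_sub]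
    congr 2
    refine Finset.sum_congr rfl fun l hl => ?_
    simp only [Finset.mem_erase, Finset.mem_univ, and_true] at hl
    apply divDiff_mul_of_fixed (Ne.symm hl.2)
    rw [permAct_X, Equiv.swap_apply_of_ne_of_ne hij.symm hl.1.symm]
  rw [dunklLin_apply, dunklLin_apply, h, Derivation.leibniz, pderiv_X_of_ne hij.symm, mul_add,
    mul_smul_comm, smul_sub, smul_zero, smul_eq_mul, add_zero]
  ring

end DunklJack

namespace DunklJack

open MvPolynomial

variable {N : ℕ}

/-! ### The generating function in terms of one-variable series -/

/-- `∑_n ((s)_n / n!) x_i^n y^n`, the expansion of `(1 - x_i y)^{-s}`. -/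
noncomputable def varSeries (s : ℝ) (i : Fin N) : PowerSeries (Poly N) :=
  PowerSeries.mk fun n => C ((ascPochhammer ℝ n).eval s / (n.factorial : ℝ)) * X i ^ n

/-- `∏_i (1 - x_i y)^{-k}`. -/
noncomputable def gSeries (N : ℕ) (k : ℝ) : PowerSeries (Poly N) := ∏ i, varSeries k i

/-- `(1 - x_j y)^{-1} ∏_i (1 - x_i y)^{-k}`. -/
noncomputable def pSeries (k : ℝ) (j : Fin N) : PowerSeries (Poly N) :=
  varSeries 1 j * gSeries N k

/-- `(1 - x_i y)^{-1} (1 - x_j y)^{-1} ∏_i (1 - x_i y)^{-k}`. -/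
noncomputable def eSeries (k : ℝ) (i j : Fin N) : PowerSeries (Poly N) :=
  varSeries 1 i * pSeries k j

/-- The coefficient of `y^n` in `gSeries`. -/
noncomputable def gCoeff (N : ℕ) (k : ℝ) (n : ℕ) : Poly N := PowerSeries.coeff n (gSeries N k)

/-- The coefficient of `y^n` in `pSeries`. -/
noncomputable def pCoeff (k : ℝ) (j : Fin N) (n : ℕ) : Poly N :=
  PowerSeries.coeff n (pSeries k j)

/-- The coefficient of `y^n` in `y * eSeries`. -/
noncomputable def eCoeff (k : ℝ) (i j : Fin N) (n : ℕ) : Poly N :=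
  PowerSeries.coeff n (PowerSeries.X * eSeries k i j)

/-- Substitution of the variable `y_j` into a one-variable power series. -/
noncomputable def inVar {R : Type*} [CommRing R] (j : Fin N) :
    PowerSeries R →ₐ[R] MvPowerSeries (Fin N) R :=
  MvPowerSeries.rename (⟨fun _ => j, fun _ _ _ => rfl⟩ : Unit ↪ Fin N)

theorem coeff_inVar {R : Type*} [CommRing R] (j : Fin N) (a : PowerSeries R) (n : Fin N →₀ ℕ) :
    MvPowerSeries.coeff n (inVar j a)
      = if ∀ m, m ≠ j → n m = 0 then PowerSeries.coeff (n j) a else 0 := by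
  split_ifs with h
  · have hn : n = Finsupp.embDomain (⟨fun _ => j, fun _ _ _ => rfl⟩ : Unit ↪ Fin N)
        (Finsupp.single () (n j)) := by
      rw [Finsupp.embDomain_single]
      ext m
      change n m = Finsupp.single j (n j) m
      rcases eq_or_ne m j with rfl | hm
      · simp
      · rw [h m hm, Finsupp.single_eq_of_ne hm]
    conv_lhs => rw [hn]
    exact MvPowerSeries.coeff_embDomain_rename _ a _
  · apply MvPowerSeries.coeff_rename_eq_zero
    rintro ⟨u, rfl⟩
    apply h
    intro m hm
    apply Finsupp.mapDomain_of_notMem_range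
    rintro ⟨_, rfl⟩
    exact hm rfl

theorem coeff_prod_inVar {R : Type*} [CommRing R] (a : Fin N → PowerSeries R) (n : Fin N →₀ ℕ) :
    MvPowerSeries.coeff n (∏ j, inVar j (a j)) = ∏ j, PowerSeries.coeff (n j) (a j) := by
  classical
  -- The `j`-th factor involves `y_j` alone, so the only decomposition of `n` that contributes is
  -- the one into coordinates.
  rw [MvPowerSeries.coeff_prod,
    Finset.sum_eq_single (Finsupp.equivFunOnFinite.symm fun j => Finsupp.single j (n j))]
  · refine Finset.prod_congr rfl fun j _ => ?_
    rw [coeff_inVar, if_pos]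
    · simp
    · intro m hm
      simp [hm.symm]
  · intro l hl hne
    rw [Finset.mem_finsuppAntidiag] at hl
    by_contra hprod
    apply hne
    have hsupp : ∀ j m, m ≠ j → l j m = 0 := by
      intro j
      by_contra hj
      apply hprod
      apply Finset.prod_eq_zero (Finset.mem_univ j)
      rw [coeff_inVar, if_neg hj]
    ext j m
    simp only [Finsupp.equivFunOnFinite_symm_apply_apply, Finsupp.single_apply]
    split_ifs with hjm
    · subst hjm
      rw [← hl.1, Finsupp.finsetSum_apply, Finset.sum_eq_single j]
      · intro b _ hb
        exact hsupp b j hb.symm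
      · simp
    · exact hsupp j m (Ne.symm hjm)
  · intro hl
    exfalso
    apply hl
    rw [Finset.mem_finsuppAntidiag]
    refine ⟨?_, fun _ _ => Finset.mem_univ _⟩
    ext m
    simp

theorem invPow_eq_inVar (s : ℝ) (i j : Fin N) : invPow s i j = inVar j (varSeries s i) := by
  ext1 n
  rw [coeff_inVar, varSeries, PowerSeries.coeff_mk]
  rfl

/-- Collecting the factors with the same `y_j` separates the variables of the generating function.
-/
theorem pPoly_eq_prod (k : ℝ) (α : Fin N → ℕ) : pPoly k α = ∏ j, pCoeff k j (α j) := by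
  have h : genFun N k = ∏ j, inVar j (pSeries k j) := by
    simp only [genFun, invPow_eq_inVar, pSeries, gSeries, map_mul, map_prod,
      Finset.prod_mul_distrib]
    rw [Finset.prod_comm]
  rw [pPoly, h, coeff_prod_inVar]
  rfl

/-! ### Relations between the coefficients -/

theorem varSeries_one_mul (i : Fin N) :
    (1 - PowerSeries.X * PowerSeries.C (X i)) * varSeries 1 i = 1 := by
  ext1 n
  rw [sub_mul, one_mul, mul_assoc, map_sub]
  rcases n with _ | n
  · simp [varSeries]
  · have h1 : ∀ m : ℕ, (m.factorial : ℝ) / (m.factorial : ℝ) = 1 := fun m =>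
      div_self (Nat.cast_ne_zero.2 m.factorial_ne_zero)
    rw [PowerSeries.coeff_succ_X_mul, PowerSeries.coeff_C_mul, varSeries, PowerSeries.coeff_mk,
      PowerSeries.coeff_mk, ascPochhammer_eval_one, ascPochhammer_eval_one, h1, h1,
      PowerSeries.coeff_one, if_neg (Nat.succ_ne_zero n)]
    simp only [map_one, one_mul]
    ring

theorem coeff_varSeries_one (i : Fin N) (n : ℕ) :
    PowerSeries.coeff n (varSeries 1 i) = (X i : Poly N) ^ n := by
  rw [varSeries, PowerSeries.coeff_mk, ascPochhammer_eval_one,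
    div_self (Nat.cast_ne_zero.2 n.factorial_ne_zero), C_1, one_mul]

theorem pCoeff_succ (k : ℝ) (j : Fin N) (n : ℕ) :
    pCoeff k j (n + 1) = X j * pCoeff k j n + gCoeff N k (n + 1) := by
  have h : pSeries k j = PowerSeries.X * (PowerSeries.C (X j) * pSeries k j) + gSeries N k := by
    rw [pSeries]
    linear_combination gSeries N k * varSeries_one_mul j
  rw [pCoeff, h, map_add, PowerSeries.coeff_succ_X_mul, PowerSeries.coeff_C_mul]
  rfl

theorem eCoeff_symm (k : ℝ) (i j : Fin N) (n : ℕ) : eCoeff k i j n = eCoeff k j i n := by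
  have h : eSeries k i j = eSeries k j i := by
    rw [eSeries, eSeries, pSeries, pSeries, mul_left_comm]
  rw [eCoeff, eCoeff, h]

theorem eCoeff_zero (k : ℝ) (i j : Fin N) : eCoeff k i j 0 = 0 := by
  simp [eCoeff]

/-- Obtained by clearing the factor `(1 - x_i y)⁻¹`. By `eCoeff_symm` it also holds with `i` and `j`
exchanged, and the two recursions together yield the bilinear identities behind the action of `T_i`
on `p_α`. -/
theorem eCoeff_succ (k : ℝ) (i j : Fin N) (n : ℕ) :
    eCoeff k i j (n + 1) = X i * eCoeff k i j n + pCoeff k j n := by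
  have h : eSeries k i j = PowerSeries.C (X i) * (PowerSeries.X * eSeries k i j)
      + pSeries k j := by
    have h1 := varSeries_one_mul i
    rw [eSeries]
    linear_combination pSeries k j * h1
  rw [eCoeff, PowerSeries.coeff_succ_X_mul, h, map_add, PowerSeries.coeff_C_mul]
  rfl

/-! ### Symmetry -/

theorem map_varSeries (w : Equiv.Perm (Fin N)) (s : ℝ) (i : Fin N) :
    PowerSeries.map (permAct w : Poly N →+* Poly N) (varSeries s i) = varSeries s (w i) := by
  ext1 n
  rw [PowerSeries.coeff_map, varSeries, varSeries, PowerSeries.coeff_mk, PowerSeries.coeff_mk]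
  simp [permAct]

theorem map_gSeries (w : Equiv.Perm (Fin N)) (k : ℝ) :
    PowerSeries.map (permAct w : Poly N →+* Poly N) (gSeries N k) = gSeries N k := by
  rw [gSeries, map_prod]
  simp only [map_varSeries]
  exact Equiv.prod_comp w (varSeries k)

theorem permAct_gCoeff (w : Equiv.Perm (Fin N)) (k : ℝ) (n : ℕ) :
    permAct w (gCoeff N k n) = gCoeff N k n := by
  have h := congrArg (PowerSeries.coeff n) (map_gSeries w k)
  rwa [PowerSeries.coeff_map] at h

theorem permAct_pCoeff (w : Equiv.Perm (Fin N)) (k : ℝ) (j : Fin N) (n : ℕ) :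
    permAct w (pCoeff k j n) = pCoeff k (w j) n := by
  have h : PowerSeries.map (permAct w : Poly N →+* Poly N) (pSeries k j) = pSeries k (w j) := by
    rw [pSeries, map_mul, map_gSeries, map_varSeries, pSeries]
  have h := congrArg (PowerSeries.coeff n) h
  rwa [PowerSeries.coeff_map] at h

theorem permAct_pPoly (w : Equiv.Perm (Fin N)) (k : ℝ) (α : Fin N → ℕ) :
    permAct w (pPoly k α) = pPoly k (permComp w α) := by
  rw [pPoly_eq_prod, pPoly_eq_prod, map_prod,
    ← Equiv.prod_comp w fun j => pCoeff k j (permComp w α j)]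
  refine Finset.prod_congr rfl fun j _ => ?_
  rw [permAct_pCoeff]
  simp [permComp]

/-! ### Homogeneity -/

/-- The coefficient of `y^n` is homogeneous of degree `n`. -/
def HomogSeries (a : PowerSeries (Poly N)) : Prop :=
  ∀ n, (PowerSeries.coeff n a).IsHomogeneous n

theorem HomogSeries.mul {a b : PowerSeries (Poly N)} (ha : HomogSeries a) (hb : HomogSeries b) :
    HomogSeries (a * b) := by
  intro n
  rw [PowerSeries.coeff_mul]
  apply IsHomogeneous.sum
  intro p hp
  rw [← Finset.HasAntidiagonal.mem_antidiagonal.1 hp]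
  exact (ha _).mul (hb _)

theorem homogSeries_one : HomogSeries (1 : PowerSeries (Poly N)) := by
  intro n
  rw [PowerSeries.coeff_one]
  split_ifs with h
  · subst h
    exact isHomogeneous_one _ _
  · exact isHomogeneous_zero _ _ _

theorem homogSeries_varSeries (s : ℝ) (i : Fin N) : HomogSeries (varSeries s i) := by
  intro n
  rw [varSeries, PowerSeries.coeff_mk]
  simpa using ((isHomogeneous_C (Fin N) _).mul ((isHomogeneous_X ℝ i).pow n))

theorem homogSeries_pSeries (k : ℝ) (j : Fin N) : HomogSeries (pSeries k j) :=
  (homogSeries_varSeries 1 j).mul <|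
    Finset.prod_induction _ _ (fun _ _ => HomogSeries.mul) homogSeries_one
      fun i _ => homogSeries_varSeries k i

/-! ### Partial derivatives -/

/-- A derivation of the coefficient ring, acting on the coefficients of power series. -/
noncomputable def coeffDeriv {R : Type*} [CommRing R] [Algebra ℝ R] (D : Derivation ℝ R R) :
    Derivation ℝ (PowerSeries R) (PowerSeries R) :=
  Derivation.mk'
    { toFun := fun a => PowerSeries.mk fun n => D (PowerSeries.coeff n a)
      map_add' := fun a b => by ext; simp
      map_smul' := fun c a => by ext; simp }
    fun a b => by
      ext n
      simp only [LinearMap.coe_mk, AddHom.coe_mk, PowerSeries.coeff_mk, PowerSeries.coeff_mul,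
        map_sum, Derivation.leibniz, smul_eq_mul, map_add, Finset.sum_add_distrib]
      congr 1
      exact (Finset.Nat.sum_antidiagonal_swap (n := n) (f := fun x =>
        PowerSeries.coeff x.1 b * D (PowerSeries.coeff x.2 a)))

theorem coeff_coeffDeriv {R : Type*} [CommRing R] [Algebra ℝ R] (D : Derivation ℝ R R)
    (a : PowerSeries R) (n : ℕ) :
    PowerSeries.coeff n (coeffDeriv D a) = D (PowerSeries.coeff n a) := by
  simp [coeffDeriv]

theorem coeffDeriv_varSeries_of_ne (s : ℝ) {i l : Fin N} (h : l ≠ i) :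
    coeffDeriv (pderiv i) (varSeries s l) = 0 := by
  ext1 n
  rw [coeff_coeffDeriv, varSeries, PowerSeries.coeff_mk]
  simp [Derivation.leibniz, Derivation.leibniz_pow, pderiv_X_of_ne h]

/-- Compare coefficients in `y d/dy (1-y)^{-s} = s y (1-y)⁻¹ (1-y)^{-s}`. -/
theorem sum_ascPochhammer_div (s : ℝ) (n : ℕ) :
    s * ∑ m ∈ Finset.range n, (ascPochhammer ℝ m).eval s / (m.factorial : ℝ)
      = n * ((ascPochhammer ℝ n).eval s / (n.factorial : ℝ)) := by
  induction n with
  | zero => simp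
  | succ n ih =>
    have hn : ((n : ℝ) + 1) ≠ 0 := by positivity
    have hf : (n.factorial : ℝ) ≠ 0 := Nat.cast_ne_zero.2 n.factorial_ne_zero
    rw [Finset.sum_range_succ, mul_add, ih, ascPochhammer_succ_eval, Nat.factorial_succ]
    push_cast
    field_simp
    ring

theorem coeffDeriv_varSeries_self (s : ℝ) (i : Fin N) :
    coeffDeriv (pderiv i) (varSeries s i)
      = s • (PowerSeries.X * (varSeries s i * varSeries 1 i)) := by
  ext1 n
  rw [coeff_coeffDeriv, varSeries, PowerSeries.coeff_mk, PowerSeries.coeff_smul, Derivation.leibniz,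
    pderiv_C, smul_zero, add_zero, Derivation.leibniz_pow, pderiv_X_self]
  rcases n with _ | n
  · simp
  · rw [PowerSeries.coeff_succ_X_mul, PowerSeries.coeff_mul, Finset.Nat.sum_antidiagonal_eq_sum_range_succ_mk]
    have h : ∀ m ∈ Finset.range n.succ,
        PowerSeries.coeff m (PowerSeries.mk fun n : ℕ =>
            C ((ascPochhammer ℝ n).eval s / (n.factorial : ℝ)) * X i ^ n)
          * PowerSeries.coeff (n - m) (varSeries 1 i)
        = C ((ascPochhammer ℝ m).eval s / (m.factorial : ℝ)) * X i ^ n := by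
      intro m hm
      rw [PowerSeries.coeff_mk, coeff_varSeries_one, mul_assoc, ← pow_add,
        Nat.add_sub_cancel' (Nat.lt_succ_iff.1 (Finset.mem_range.1 hm))]
    rw [Finset.sum_congr rfl h, ← Finset.sum_mul, ← map_sum, smul_eq_C_mul, ← mul_assoc,
      ← map_mul, sum_ascPochhammer_div]
    simp only [Nat.add_sub_cancel, smul_eq_mul, mul_one, map_mul, map_natCast, nsmul_eq_mul]
    ring

theorem coeffDeriv_gSeries (k : ℝ) (i : Fin N) :
    coeffDeriv (pderiv i) (gSeries N k) = k • (PowerSeries.X * pSeries k i) := by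
  have h0 : coeffDeriv (pderiv i) (∏ l ∈ Finset.univ.erase i, varSeries k l) = 0 := by
    refine Finset.prod_induction _ (fun a => coeffDeriv (pderiv i) a = 0) ?_ ?_ ?_
    · intro a b ha hb
      rw [Derivation.leibniz, ha, hb, smul_zero, smul_zero, add_zero]
    · exact Derivation.map_one_eq_zero _
    · exact fun l hl => coeffDeriv_varSeries_of_ne k (Finset.ne_of_mem_erase hl)
  have h1 : gSeries N k = varSeries k i * ∏ l ∈ Finset.univ.erase i, varSeries k l :=
    (Finset.mul_prod_erase _ _ (Finset.mem_univ i)).symm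
  have h2 : coeffDeriv (pderiv i) (gSeries N k)
      = (∏ l ∈ Finset.univ.erase i, varSeries k l) *
        k • (PowerSeries.X * (varSeries k i * varSeries 1 i)) := by
    rw [h1, Derivation.leibniz, h0, coeffDeriv_varSeries_self, smul_zero, zero_add, smul_eq_mul]
  have h3 : ∀ a b c d : PowerSeries (Poly N), d * (c * (a * b)) = c * (b * (a * d)) := by
    intros
    ring
  rw [h2, pSeries, h1, mul_smul_comm, h3]

theorem pderiv_gCoeff (k : ℝ) (i : Fin N) (n : ℕ) :
    pderiv i (gCoeff N k (n + 1)) = k • pCoeff k i n := by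
  have h := congrArg (PowerSeries.coeff (n + 1)) (coeffDeriv_gSeries (N := N) k i)
  rwa [coeff_coeffDeriv, PowerSeries.coeff_smul, PowerSeries.coeff_succ_X_mul] at h

theorem pderiv_pCoeff (k : ℝ) {i j : Fin N} (h : j ≠ i) (n : ℕ) :
    pderiv i (pCoeff k j n) = k • eCoeff k i j n := by
  have h2 : coeffDeriv (pderiv i) (pSeries k j) = k • (PowerSeries.X * eSeries k j i) := by
    rw [pSeries, Derivation.leibniz, coeffDeriv_varSeries_of_ne 1 h,
      coeffDeriv_gSeries, smul_zero, add_zero, smul_eq_mul, mul_smul_comm, eSeries, mul_left_comm]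
  rw [pCoeff, ← coeff_coeffDeriv, h2, PowerSeries.coeff_smul, eCoeff_symm, eCoeff]

/-- Direct differentiation would introduce a double pole `(1 - x_i y)⁻²`. Euler's identity for
homogeneous polynomials expresses this derivative through the others instead. -/
theorem X_mul_pderiv_pCoeff (k : ℝ) (i : Fin N) (n : ℕ) :
    X i * pderiv i (pCoeff k i n) = (n : ℝ) • pCoeff k i n
      - k • ∑ j ∈ Finset.univ.erase i, X j * eCoeff k i j n := by
  have h := (homogSeries_pSeries k i n).sum_X_mul_pderiv
  rw [← Finset.add_sum_erase _ _ (Finset.mem_univ i)] at h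
  rw [eq_sub_iff_add_eq, Nat.cast_smul_eq_nsmul]
  refine Eq.trans ?_ h
  rw [Finset.smul_sum]
  congr 1
  refine Finset.sum_congr rfl fun j hj => ?_
  rw [← pCoeff, pderiv_pCoeff k (Finset.ne_of_mem_erase hj).symm, mul_smul_comm, eCoeff_symm]

end DunklJack

namespace DunklJack

open MvPolynomial

variable {N : ℕ}

/-! ### Dunkl operators on the polynomials `p_α` -/

theorem derivation_prod {ι S R : Type*} [DecidableEq ι] [CommRing S] [CommRing R] [Algebra S R]
    (D : Derivation S R R) (s : Finset ι) (f : ι → R) :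
    D (∏ i ∈ s, f i) = ∑ i ∈ s, D (f i) * ∏ j ∈ s.erase i, f j := by
  induction s using Finset.induction_on with
  | empty => simp
  | insert a s ha ih =>
    rw [Finset.prod_insert ha, Derivation.leibniz, ih, Finset.sum_insert ha,
      Finset.erase_insert ha, smul_eq_mul, smul_eq_mul, add_comm, mul_comm (∏ i ∈ s, f i),
      Finset.mul_sum]
    congr 1
    refine Finset.sum_congr rfl fun j hj => ?_
    have hja : a ≠ j := fun e => ha (e ▸ hj)
    rw [Finset.erase_insert_of_ne hja, Finset.prod_insert (fun h => ha (Finset.mem_of_mem_erase h)),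
      mul_left_comm]

/-- `p_α` without the factors that belong to the positions `i` and `j`. -/
noncomputable def pRest (k : ℝ) (α : Fin N → ℕ) (i j : Fin N) : Poly N :=
  ∏ l ∈ (Finset.univ.erase i).erase j, pCoeff k l (α l)

theorem prod_erase_eq (k : ℝ) (α : Fin N → ℕ) {i j : Fin N} (h : j ≠ i) :
    ∏ l ∈ Finset.univ.erase i, pCoeff k l (α l) = pCoeff k j (α j) * pRest k α i j :=
  (Finset.mul_prod_erase _ _ (by simp [h])).symm

theorem pPoly_eq_mul (k : ℝ) (α : Fin N → ℕ) (i : Fin N) :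
    pPoly k α = pCoeff k i (α i) * ∏ l ∈ Finset.univ.erase i, pCoeff k l (α l) := by
  rw [pPoly_eq_prod]
  exact (Finset.mul_prod_erase _ _ (Finset.mem_univ i)).symm

theorem pPoly_update_update (k : ℝ) (α : Fin N → ℕ) {i j : Fin N} (h : j ≠ i) (c d : ℕ) :
    pPoly k (Function.update (Function.update α i c) j d)
      = pCoeff k i c * pCoeff k j d * pRest k α i j := by
  rw [pPoly_eq_mul k _ i, prod_erase_eq k _ h, Function.update_self, Function.update_of_ne h.symm,
    Function.update_self, mul_assoc]
  congr 2
  refine Finset.prod_congr rfl fun l hl => ?_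
  simp only [Finset.mem_erase, Finset.mem_univ, and_true] at hl
  rw [Function.update_of_ne hl.1, Function.update_of_ne hl.2]

theorem permAct_swap_pRest (k : ℝ) (α : Fin N → ℕ) (i j : Fin N) :
    permAct (Equiv.swap i j) (pRest k α i j) = pRest k α i j := by
  rw [pRest, map_prod]
  refine Finset.prod_congr rfl fun l hl => ?_
  simp only [Finset.mem_erase, Finset.mem_univ, and_true] at hl
  rw [permAct_pCoeff, Equiv.swap_apply_of_ne_of_ne hl.2 hl.1]

theorem pCoeff_sub (k : ℝ) (i j : Fin N) (n : ℕ) :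
    pCoeff k i n - pCoeff k j n = (X i - X j) * eCoeff k i j n := by
  have h1 := eCoeff_succ k i j n
  have h2 := eCoeff_succ k j i n
  rw [eCoeff_symm k j i, eCoeff_symm k j i] at h2
  linear_combination h1 - h2

theorem divDiff_pCoeff (k : ℝ) {i j : Fin N} (h : j ≠ i) (n : ℕ) :
    divDiff i j (pCoeff k j n) = -eCoeff k i j n := by
  apply divDiff_eq h.symm
  rw [permAct_pCoeff, Equiv.swap_apply_right]
  linear_combination pCoeff_sub k i j n

theorem pderiv_prod_erase (k : ℝ) (α : Fin N → ℕ) (i : Fin N) :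
    pderiv i (∏ l ∈ Finset.univ.erase i, pCoeff k l (α l))
      = k • ∑ j ∈ Finset.univ.erase i, eCoeff k i j (α j) * pRest k α i j := by
  rw [derivation_prod, Finset.smul_sum]
  refine Finset.sum_congr rfl fun j hj => ?_
  rw [pderiv_pCoeff k (Finset.ne_of_mem_erase hj), smul_mul_assoc, pRest]

/-- For each `j ≠ i` the derivative of the `j`-th factor contributes `k e_{ij}` and its divided
difference contributes `-k e_{ij}`. -/
theorem dunklLin_prod_erase (k : ℝ) (α : Fin N → ℕ) (i : Fin N) :
    dunklLin k i (∏ l ∈ Finset.univ.erase i, pCoeff k l (α l)) = 0 := by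
  rw [dunklLin_apply, pderiv_prod_erase, ← smul_add, ← Finset.sum_add_distrib]
  rw [Finset.sum_eq_zero, smul_zero]
  intro j hj
  have hji := Finset.ne_of_mem_erase hj
  rw [prod_erase_eq k α hji, mul_comm (pCoeff k j (α j)),
    divDiff_mul_of_fixed hji.symm (permAct_swap_pRest k α i j), divDiff_pCoeff k hji]
  ring

/-- The symmetric factor passes through all divided differences and `T_i` kills the product over `l
≠ i`, so only the partial derivative of the symmetric factor survives. -/
theorem dunklLin_gCoeff_mul (k : ℝ) (α : Fin N → ℕ) (i : Fin N) :
    dunklLin k i (gCoeff N k (α i + 1) * ∏ l ∈ Finset.univ.erase i, pCoeff k l (α l))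
      = k • pPoly k α := by
  have h0 := dunklLin_prod_erase k α i
  rw [dunklLin_apply] at h0
  have h1 : ∑ j ∈ Finset.univ.erase i, divDiff i j
        (gCoeff N k (α i + 1) * ∏ l ∈ Finset.univ.erase i, pCoeff k l (α l))
      = gCoeff N k (α i + 1) * ∑ j ∈ Finset.univ.erase i, divDiff i j
        (∏ l ∈ Finset.univ.erase i, pCoeff k l (α l)) := by
    rw [Finset.mul_sum]
    exact Finset.sum_congr rfl fun j hj => divDiff_mul_of_fixed (Finset.ne_of_mem_erase hj).symm
      (permAct_gCoeff _ k _) _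
  rw [dunklLin_apply, h1, Derivation.leibniz, pderiv_gCoeff, ← mul_smul_comm, smul_eq_mul,
    add_right_comm, ← mul_add, h0, mul_zero, zero_add, smul_eq_mul, mul_smul_comm, mul_comm,
    ← pPoly_eq_mul]

theorem pPoly_add_single (k : ℝ) (α : Fin N → ℕ) (i : Fin N) :
    pPoly k (α + Pi.single i 1)
      = X i * pPoly k α
        + gCoeff N k (α i + 1) * ∏ l ∈ Finset.univ.erase i, pCoeff k l (α l) := by
  have h : ∏ l ∈ Finset.univ.erase i, pCoeff k l ((α + Pi.single i 1 : Fin N → ℕ) l)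
      = ∏ l ∈ Finset.univ.erase i, pCoeff k l (α l) := by
    refine Finset.prod_congr rfl fun l hl => ?_
    rw [Pi.add_apply, Pi.single_eq_of_ne (Finset.ne_of_mem_erase hl), add_zero]
  rw [pPoly_eq_mul k _ i, pPoly_eq_mul k α i, h, Pi.add_apply, Pi.single_eq_same, pCoeff_succ]
  ring

theorem dunklLin_pPoly_add_single (k : ℝ) (α : Fin N → ℕ) (i : Fin N) :
    dunklLin k i (pPoly k (α + Pi.single i 1))
      = dunklLin k i (X i * pPoly k α) + k • pPoly k α := by
  rw [pPoly_add_single, map_add, dunklLin_gCoeff_mul]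

/-- The contribution of the index `j` to `k⁻¹ (x_i T_i p_α - α_i p_α)`. -/
noncomputable def pairTerm (k : ℝ) (α : Fin N → ℕ) (i j : Fin N) : Poly N :=
  (X i - X j) * (eCoeff k i j (α i) * eCoeff k i j (α j + 1)) * pRest k α i j

theorem X_mul_dunklLin_pPoly (k : ℝ) (α : Fin N → ℕ) (i : Fin N) :
    X i * dunklLin k i (pPoly k α)
      = (α i : ℝ) • pPoly k α + k • ∑ j ∈ Finset.univ.erase i, pairTerm k α i j := by
  have h1 : X i * pderiv i (pPoly k α) = (α i : ℝ) • pPoly k α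
      + k • ∑ j ∈ Finset.univ.erase i, (X i * eCoeff k i j (α j) * pCoeff k i (α i)
        - X j * eCoeff k i j (α i) * pCoeff k j (α j)) * pRest k α i j := by
    have h2 : (∑ j ∈ Finset.univ.erase i, X j * eCoeff k i j (α i)) *
          ∏ l ∈ Finset.univ.erase i, pCoeff k l (α l)
        = ∑ j ∈ Finset.univ.erase i, X j * eCoeff k i j (α i) * pCoeff k j (α j)
          * pRest k α i j := by
      rw [Finset.sum_mul]
      refine Finset.sum_congr rfl fun j hj => ?_
      rw [prod_erase_eq k α (Finset.ne_of_mem_erase hj)]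
      ring
    have h3 : pCoeff k i (α i) * (X i * ∑ j ∈ Finset.univ.erase i,
          eCoeff k i j (α j) * pRest k α i j)
        = ∑ j ∈ Finset.univ.erase i, X i * eCoeff k i j (α j) * pCoeff k i (α i)
          * pRest k α i j := by
      rw [Finset.mul_sum, Finset.mul_sum]
      refine Finset.sum_congr rfl fun j _ => ?_
      ring
    have h4 : X i * pderiv i (pPoly k α)
        = pCoeff k i (α i) * (X i * pderiv i (∏ l ∈ Finset.univ.erase i, pCoeff k l (α l)))
          + (X i * pderiv i (pCoeff k i (α i)))
            * ∏ l ∈ Finset.univ.erase i, pCoeff k l (α l) := by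
      rw [pPoly_eq_mul k α i, Derivation.leibniz, smul_eq_mul, smul_eq_mul]
      ring
    rw [h4, pderiv_prod_erase, X_mul_pderiv_pCoeff, mul_smul_comm, mul_smul_comm, h3, sub_mul,
      smul_mul_assoc, smul_mul_assoc, h2, ← pPoly_eq_mul]
    simp only [sub_mul, Finset.sum_sub_distrib, smul_sub]
    ring
  rw [dunklLin_apply, mul_add, h1, mul_smul_comm, Finset.mul_sum, add_assoc, ← smul_add,
    ← Finset.sum_add_distrib]
  congr 2
  refine Finset.sum_congr rfl fun j hj => ?_
  have hji := Finset.ne_of_mem_erase hj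
  -- The recursions for `eCoeff` express every `pCoeff` factor through `eCoeff`; after this the
  -- identity is polynomial.
  have h5 : divDiff i j (pCoeff k i (α i) * pCoeff k j (α j))
      = eCoeff k i j (α i) * eCoeff k i j (α j + 1)
        - eCoeff k i j (α i + 1) * eCoeff k i j (α j) := by
    apply divDiff_eq hji.symm
    rw [map_mul, permAct_pCoeff, permAct_pCoeff, Equiv.swap_apply_left, Equiv.swap_apply_right]
    have ha := eCoeff_succ k i j (α i)
    have ha' := eCoeff_succ k j i (α i)
    have hb := eCoeff_succ k i j (α j)
    have hb' := eCoeff_succ k j i (α j)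
    rw [eCoeff_symm k j i, eCoeff_symm k j i] at ha' hb'
    linear_combination (eCoeff k i j (α j + 1) - X i * eCoeff k i j (α j)) * ha'
      + (pCoeff k i (α i)) * hb - (eCoeff k i j (α j + 1) - X j * eCoeff k i j (α j)) * ha
      - pCoeff k j (α i) * hb'
  have ha' := eCoeff_succ k j i (α i)
  have hb := eCoeff_succ k i j (α j)
  rw [eCoeff_symm k j i, eCoeff_symm k j i] at ha'
  rw [pPoly_eq_mul k α i, prod_erase_eq k α hji, ← mul_assoc, mul_comm _ (pRest k α i j),
    mul_comm _ (pRest k α i j), divDiff_mul_of_fixed hji.symm (permAct_swap_pRest k α i j), h5,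
    pairTerm]
  linear_combination -pRest k α i j * X i * eCoeff k i j (α j) * ha'
      + X j * eCoeff k i j (α i) * pRest k α i j * hb

/-- The sum telescopes: `(x_i - x_j)(e_c e_{d+1} - e_{c+1} e_d)` equals its term at `t = 0`. Hence
the induction on `d` with `c` free. -/
theorem sum_pCoeff_mul_sub (k : ℝ) (i j : Fin N) (c d : ℕ) :
    ∑ t ∈ Finset.range d, (pCoeff k i (c + t) * pCoeff k j (d - 1 - t)
        - pCoeff k i (d - 1 - t) * pCoeff k j (c + t))
      = (X i - X j) * (eCoeff k i j c * eCoeff k i j d) := by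
  induction d generalizing c with
  | zero => simp [eCoeff_zero]
  | succ d ih =>
    have h : ∀ t ∈ Finset.range d, (pCoeff k i (c + (t + 1)) * pCoeff k j (d + 1 - 1 - (t + 1))
          - pCoeff k i (d + 1 - 1 - (t + 1)) * pCoeff k j (c + (t + 1)))
        = pCoeff k i (c + 1 + t) * pCoeff k j (d - 1 - t)
          - pCoeff k i (d - 1 - t) * pCoeff k j (c + 1 + t) := by
      intro t _
      rw [show c + (t + 1) = c + 1 + t by omega, show d + 1 - 1 - (t + 1) = d - 1 - t by omega]
    rw [Finset.sum_range_succ', Finset.sum_congr rfl h, ih, add_zero, Nat.sub_zero,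
      Nat.add_sub_cancel]
    have ha := eCoeff_succ k i j c
    have ha' := eCoeff_succ k j i c
    have hb := eCoeff_succ k i j d
    have hb' := eCoeff_succ k j i d
    rw [eCoeff_symm k j i, eCoeff_symm k j i] at ha' hb'
    linear_combination -(eCoeff k i j (d + 1) - X i * eCoeff k i j d) * ha'
      - (pCoeff k i c) * hb + (eCoeff k i j (d + 1) - X j * eCoeff k i j d) * ha
      + pCoeff k j c * hb'

/-- Of the two expansions of the pair term, this one serves `α j < α i`: the summand `t = 0` is
`p_α` minus its transpose, and all others have more widely spread indices. For `α i ≤ α j` every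
index in `pairTerm_eq_sum'` is more spread than `α`. -/
theorem pairTerm_eq_sum (k : ℝ) (α : Fin N → ℕ) {i j : Fin N} (hji : j ≠ i) :
    pairTerm k α i j = ∑ t ∈ Finset.range (α j + 1),
      (pPoly k (Function.update (Function.update α i (α i + t)) j (α j - t))
        - pPoly k (Function.update (Function.update α i (α j - t)) j (α i + t))) := by
  rw [pairTerm, ← sum_pCoeff_mul_sub, Finset.sum_mul]
  refine Finset.sum_congr rfl fun t _ => ?_
  rw [pPoly_update_update k α hji, pPoly_update_update k α hji, sub_mul, Nat.add_sub_cancel]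

theorem pairTerm_eq_sum' (k : ℝ) (α : Fin N → ℕ) {i j : Fin N} (hji : j ≠ i) :
    pairTerm k α i j = ∑ t ∈ Finset.range (α i),
      (pPoly k (Function.update (Function.update α i (α j + 1 + t)) j (α i - 1 - t))
        - pPoly k (Function.update (Function.update α i (α i - 1 - t)) j (α j + 1 + t))) := by
  rw [pairTerm, mul_comm (eCoeff k i j (α i)), ← sum_pCoeff_mul_sub, Finset.sum_mul]
  refine Finset.sum_congr rfl fun t _ => ?_
  rw [pPoly_update_update k α hji, pPoly_update_update k α hji, sub_mul]

end DunklJack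

namespace DunklJack

open MvPolynomial
open scoped TensorProduct

variable {N : ℕ}

/-! ### The polynomials `p_α` form a basis -/

/-- `∑_n ((s)_n / n!) u^n y^n`, the expansion of `(1 - u y)^{-s}`. -/
noncomputable def binomSeries {R : Type*} [CommRing R] [Algebra ℝ R] (s : ℝ) (u : R) :
    PowerSeries R :=
  PowerSeries.mk fun n => ((ascPochhammer ℝ n).eval s / (n.factorial : ℝ)) • u ^ n

theorem coeff_binomSeries_one {R : Type*} [CommRing R] [Algebra ℝ R] (u : R) (n : ℕ) :
    PowerSeries.coeff n (binomSeries 1 u) = u ^ n := by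
  rw [binomSeries, PowerSeries.coeff_mk, ascPochhammer_eval_one,
    div_self (Nat.cast_ne_zero.2 n.factorial_ne_zero), one_smul]

theorem constantCoeff_binomSeries {R : Type*} [CommRing R] [Algebra ℝ R] (s : ℝ) (u : R) :
    PowerSeries.constantCoeff (binomSeries s u) = 1 := by
  rw [← PowerSeries.coeff_zero_eq_constantCoeff_apply, binomSeries, PowerSeries.coeff_mk]
  simp

theorem derivative_binomSeries {R : Type*} [CommRing R] [Algebra ℝ R] (s : ℝ) (u : R) :
    PowerSeries.derivative R (binomSeries s u)
      = s • (PowerSeries.C u * binomSeries 1 u) * binomSeries s u := by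
  ext1 n
  rw [PowerSeries.coeff_derivative, smul_mul_assoc, mul_assoc, PowerSeries.coeff_smul,
    PowerSeries.coeff_C_mul, mul_comm (binomSeries 1 u), PowerSeries.coeff_mul,
    Finset.Nat.sum_antidiagonal_eq_sum_range_succ_mk]
  have h : ∀ m ∈ Finset.range n.succ,
      PowerSeries.coeff m (binomSeries s u) * PowerSeries.coeff (n - m) (binomSeries 1 u)
        = ((ascPochhammer ℝ m).eval s / (m.factorial : ℝ)) • u ^ n := by
    intro m hm
    rw [coeff_binomSeries_one, binomSeries, PowerSeries.coeff_mk, smul_mul_assoc, ← pow_add,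
      Nat.add_sub_cancel' (Nat.lt_succ_iff.1 (Finset.mem_range.1 hm))]
  rw [Finset.sum_congr rfl h, ← Finset.sum_smul, mul_smul_comm, smul_smul, sum_ascPochhammer_div,
    ← pow_succ', binomSeries, PowerSeries.coeff_mk, ← smul_eq_mul (_ • _), smul_assoc,
    mul_smul, smul_eq_mul, Nat.cast_smul_eq_nsmul, nsmul_eq_mul, mul_comm, Nat.succ_eq_add_one]
  push_cast
  rw [mul_smul_comm]

/-! ### Positivity of the Cauchy kernel. -/

/-- The quadratic form `L ⊗ L` attached to a linear functional `L`. -/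
noncomputable def quadForm (L : Poly N →ₗ[ℝ] ℝ) : Poly N ⊗[ℝ] Poly N →ₗ[ℝ] ℝ :=
  LinearMap.mul' ℝ ℝ ∘ₗ TensorProduct.map L L

theorem quadForm_tmul (L : Poly N →ₗ[ℝ] ℝ) (f g : Poly N) :
    quadForm L (f ⊗ₜ g) = L f * L g := by
  simp [quadForm]

theorem quadForm_tmul_mul (L : Poly N →ₗ[ℝ] ℝ) (f : Poly N) (h : Poly N ⊗[ℝ] Poly N) :
    quadForm L (f ⊗ₜ f * h) = quadForm (L ∘ₗ LinearMap.mulLeft ℝ f) h := by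
  induction h using TensorProduct.induction_on with
  | zero => simp
  | tmul a b => simp [quadForm_tmul]
  | add a b ha hb => rw [mul_add, map_add, map_add, ha, hb]

/-- The kernels `h` with `(L ⊗ L) h ≥ 0` for all linear functionals `L`. -/
def PosKernel (h : Poly N ⊗[ℝ] Poly N) : Prop := ∀ L : Poly N →ₗ[ℝ] ℝ, 0 ≤ quadForm L h

/-- Multiplication by `f ⊗ f` replaces `L` by `L(f ·)`, and positivity is required of all
functionals. -/
theorem PosKernel.tmul_mul {h : Poly N ⊗[ℝ] Poly N} (hh : PosKernel h) (f : Poly N) :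
    PosKernel (f ⊗ₜ f * h) := fun L => by
  rw [quadForm_tmul_mul]
  exact hh _

/-- `∏_{i, j} (1 - (x_i ⊗ x_j) t)^{-k}`. -/
noncomputable def cauchySeries (N : ℕ) (k : ℝ) : PowerSeries (Poly N ⊗[ℝ] Poly N) :=
  ∏ j : Fin N, ∏ i : Fin N, binomSeries k ((X i : Poly N) ⊗ₜ[ℝ] (X j : Poly N))

theorem tmul_pow_sum (r : ℕ) :
    ∑ j : Fin N, ∑ i : Fin N, ((X i : Poly N) ⊗ₜ[ℝ] (X j : Poly N)) ^ r
      = (∑ i : Fin N, (X i : Poly N) ^ r) ⊗ₜ[ℝ] (∑ i : Fin N, (X i : Poly N) ^ r) := by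
  rw [TensorProduct.tmul_sum]
  refine Finset.sum_congr rfl fun j _ => ?_
  rw [TensorProduct.sum_tmul]
  refine Finset.sum_congr rfl fun i _ => ?_
  rw [Algebra.TensorProduct.tmul_pow]

theorem derivative_cauchySeries (k : ℝ) :
    PowerSeries.derivative _ (cauchySeries N k)
      = k • ((∑ j : Fin N, ∑ i : Fin N, PowerSeries.C ((X i : Poly N) ⊗ₜ[ℝ] (X j : Poly N))
          * binomSeries 1 ((X i : Poly N) ⊗ₜ[ℝ] (X j : Poly N))) * cauchySeries N k) := by
  rw [cauchySeries, ← Finset.prod_product', derivation_prod, ← Finset.sum_product',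
    Finset.sum_mul, Finset.smul_sum]
  refine Finset.sum_congr rfl fun p hp => ?_
  rw [derivative_binomSeries, mul_assoc, Finset.mul_prod_erase _
    (fun p : Fin N × Fin N => binomSeries k ((X p.2 : Poly N) ⊗ₜ[ℝ] (X p.1 : Poly N))) hp,
    smul_mul_assoc]

/-- The logarithmic derivative gives `(m+1) c_{m+1} = k ∑ (P_{r+1} ⊗ P_{r+1}) c_{m-r}` with power
sums `P_r`. Since `k ≥ 0`, positivity passes from lower coefficients to higher ones. -/
theorem posKernel_coeff_cauchySeries {k : ℝ} (hk : 0 ≤ k) (m : ℕ) :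
    PosKernel (PowerSeries.coeff m (cauchySeries N k)) := by
  induction m using Nat.strong_induction_on with
  | _ m ih =>
    rcases m with _ | m
    · intro L
      have h : PowerSeries.coeff 0 (cauchySeries N k) = (1 : Poly N) ⊗ₜ[ℝ] (1 : Poly N) := by
        rw [PowerSeries.coeff_zero_eq_constantCoeff_apply, cauchySeries, map_prod]
        simp [constantCoeff_binomSeries, map_prod, Algebra.TensorProduct.one_def]
      rw [h, quadForm_tmul]
      exact mul_self_nonneg _
    · intro L
      have h := congrArg (PowerSeries.coeff m) (derivative_cauchySeries (N := N) k)
      rw [PowerSeries.coeff_derivative, PowerSeries.coeff_smul, PowerSeries.coeff_mul] at h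
      have h2 := congrArg (quadForm L) h
      rw [map_smul, map_sum, mul_comm] at h2
      have h3 : quadForm L (((m : Poly N ⊗[ℝ] Poly N) + 1)
            * PowerSeries.coeff (m + 1) (cauchySeries N k))
          = ((m : ℝ) + 1) * quadForm L (PowerSeries.coeff (m + 1) (cauchySeries N k)) := by
        rw [add_mul, one_mul, ← nsmul_eq_mul, map_add, map_nsmul, nsmul_eq_mul, add_mul, one_mul]
      rw [h3] at h2
      have h4 : 0 ≤ k • ∑ p ∈ Finset.HasAntidiagonal.antidiagonal m, quadForm L
          (PowerSeries.coeff p.1 (∑ j : Fin N, ∑ i : Fin N,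
              PowerSeries.C ((X i : Poly N) ⊗ₜ[ℝ] (X j : Poly N))
                * binomSeries 1 ((X i : Poly N) ⊗ₜ[ℝ] (X j : Poly N)))
            * PowerSeries.coeff p.2 (cauchySeries N k)) := by
        refine smul_nonneg hk (Finset.sum_nonneg fun p hp => ?_)
        have h5 : PowerSeries.coeff p.1 (∑ j : Fin N, ∑ i : Fin N,
              PowerSeries.C ((X i : Poly N) ⊗ₜ[ℝ] (X j : Poly N))
                * binomSeries 1 ((X i : Poly N) ⊗ₜ[ℝ] (X j : Poly N)))
            = (∑ i : Fin N, (X i : Poly N) ^ (p.1 + 1))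
              ⊗ₜ[ℝ] (∑ i : Fin N, (X i : Poly N) ^ (p.1 + 1)) := by
          rw [← tmul_pow_sum]
          simp only [map_sum, PowerSeries.coeff_C_mul, coeff_binomSeries_one, ← pow_succ']
        rw [h5]
        exact (ih p.2 (by have := Finset.HasAntidiagonal.mem_antidiagonal.1 hp; omega)).tmul_mul _ L
      rw [← h2] at h4
      exact nonneg_of_mul_nonneg_right h4 (by positivity)

/-- Rescaling by `1 ⊗ x_j` puts a second copy of `x_j` in place of `y_j`, so that the generating
function becomes a kernel with terms `p_α ⊗ x^α`. -/
theorem coeff_rescale_pSeries (k : ℝ) (j : Fin N) (n : ℕ) :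
    PowerSeries.coeff n (binomSeries 1 ((X j : Poly N) ⊗ₜ[ℝ] (X j : Poly N))
        * ∏ i : Fin N, binomSeries k ((X i : Poly N) ⊗ₜ[ℝ] (X j : Poly N)))
      = pCoeff k j n ⊗ₜ[ℝ] ((X j : Poly N) ^ n) := by
  have h : ∀ (s : ℝ) (i : Fin N), binomSeries s ((X i : Poly N) ⊗ₜ[ℝ] (X j : Poly N))
      = PowerSeries.rescale ((1 : Poly N) ⊗ₜ[ℝ] (X j : Poly N))
        (PowerSeries.map (Algebra.TensorProduct.includeLeft (R := ℝ) (S := ℝ) (A := Poly N)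
          (B := Poly N) : Poly N →+* Poly N ⊗[ℝ] Poly N) (varSeries s i)) := by
    intro s i
    ext1 m
    rw [PowerSeries.coeff_rescale, PowerSeries.coeff_map, binomSeries, PowerSeries.coeff_mk,
      varSeries, PowerSeries.coeff_mk, ← smul_eq_C_mul]
    simp [TensorProduct.smul_tmul', Algebra.TensorProduct.tmul_pow]
  simp only [h]
  rw [← map_prod, ← map_prod, ← map_mul, ← map_mul, PowerSeries.coeff_rescale,
    PowerSeries.coeff_map]
  rw [Algebra.TensorProduct.tmul_pow, one_pow]
  simp only [pCoeff, pSeries, gSeries, RingHom.coe_coe, Algebra.TensorProduct.includeLeft_apply,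
    Algebra.TensorProduct.tmul_mul_tmul, one_mul, mul_one]

theorem prod_tmul (f g : Fin N → Poly N) :
    ∏ j, (f j ⊗ₜ[ℝ] g j) = (∏ j, f j) ⊗ₜ[ℝ] (∏ j, g j) := by
  have h : ∀ s : Finset (Fin N), ∏ j ∈ s, (f j ⊗ₜ[ℝ] g j)
      = (∏ j ∈ s, f j) ⊗ₜ[ℝ] (∏ j ∈ s, g j) := by
    intro s
    induction s using Finset.induction_on with
    | empty => rfl
    | insert a s ha ih =>
      rw [Finset.prod_insert ha, Finset.prod_insert ha, Finset.prod_insert ha, ih,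
        Algebra.TensorProduct.tmul_mul_tmul]
  exact h _

/-- The kernel `∑ p_α ⊗ x^α` is `∑ x^α ⊗ x^α` times the Cauchy series. The constant term `1` of that
series gives the sum of squares, and its other coefficients add non-negative amounts. -/
theorem sum_sq_le_sum_pPoly {k : ℝ} (hk : 0 ≤ k) (L : Poly N →ₗ[ℝ] ℝ) (d : ℕ) :
    ∑ l ∈ Finset.finsuppAntidiag Finset.univ d, L (mono l) ^ 2
      ≤ ∑ l ∈ Finset.finsuppAntidiag Finset.univ d, L (pPoly k l) * L (mono l) := by
  classical
  set K : PowerSeries (Poly N ⊗[ℝ] Poly N) :=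
    ∏ j : Fin N, binomSeries 1 ((X j : Poly N) ⊗ₜ[ℝ] (X j : Poly N)) with hK
  have hKc : ∀ m, PowerSeries.coeff m K
      = ∑ l ∈ Finset.finsuppAntidiag Finset.univ m, (mono l : Poly N) ⊗ₜ[ℝ] (mono l : Poly N) := by
    intro m
    rw [hK, PowerSeries.coeff_prod]
    refine Finset.sum_congr rfl fun l _ => ?_
    simp only [coeff_binomSeries_one, Algebra.TensorProduct.tmul_pow]
    rw [prod_tmul, mono]
  have hF : PowerSeries.coeff d (K * cauchySeries N k)
      = ∑ l ∈ Finset.finsuppAntidiag Finset.univ d, pPoly k l ⊗ₜ[ℝ] (mono l : Poly N) := by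
    rw [hK, cauchySeries, ← Finset.prod_mul_distrib, PowerSeries.coeff_prod]
    refine Finset.sum_congr rfl fun l _ => ?_
    simp only [coeff_rescale_pSeries]
    rw [mono, pPoly_eq_prod]
    exact prod_tmul _ _
  have h0 : PowerSeries.coeff 0 (cauchySeries N k) = 1 := by
    rw [PowerSeries.coeff_zero_eq_constantCoeff_apply, cauchySeries, map_prod]
    simp [constantCoeff_binomSeries, map_prod]
  have h1 := congrArg (quadForm L) hF
  rw [PowerSeries.coeff_mul, map_sum, map_sum] at h1
  simp only [quadForm_tmul] at h1
  rw [← h1]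
  refine le_trans (le_of_eq ?_) (Finset.single_le_sum (f := fun p : ℕ × ℕ => quadForm L
    (PowerSeries.coeff p.1 K * PowerSeries.coeff p.2 (cauchySeries N k))) ?_
    (a := (d, 0)) (by simp))
  · simp only [h0, mul_one, hKc, map_sum, quadForm_tmul, sq]
  · intro p _
    simp only [hKc, Finset.sum_mul, map_sum]
    exact Finset.sum_nonneg fun l _ => (posKernel_coeff_cauchySeries hk p.2).tmul_mul _ L

theorem mono_eq_monomial (l : Fin N →₀ ℕ) : (mono l : Poly N) = monomial l 1 := by
  rw [monomial_eq, C_1, one_mul, Finsupp.prod_fintype _ _ (by simp), mono]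

theorem mem_finsuppAntidiag_univ (l : Fin N →₀ ℕ) :
    l ∈ Finset.finsuppAntidiag Finset.univ (size l) := by
  simp [size]

/-- A functional that vanishes on all `p_α` makes the right side of `sum_sq_le_sum_pPoly` zero, so
it vanishes on all monomials. -/
theorem span_range_pPoly {k : ℝ} (hk : 0 ≤ k) :
    Submodule.span ℝ (Set.range (pPoly k : (Fin N → ℕ) → Poly N)) = ⊤ := by
  by_contra h
  obtain ⟨L, hL, hle⟩ := Submodule.exists_le_ker_of_lt_top _ (lt_top_iff_ne_top.2 h)
  apply hL
  have hp : ∀ α : Fin N → ℕ, L (pPoly k α) = 0 := fun α =>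
    hle (Submodule.subset_span ⟨α, rfl⟩)
  refine (basisMonomials (Fin N) ℝ).ext fun l => ?_
  have h1 := sum_sq_le_sum_pPoly hk L (size l)
  simp only [hp, zero_mul, Finset.sum_const_zero] at h1
  have h2 := (Finset.sum_eq_zero_iff_of_nonneg fun (m : Fin N →₀ ℕ) _ => sq_nonneg (L (mono m))).1
    (le_antisymm h1 (Finset.sum_nonneg fun (m : Fin N →₀ ℕ) _ => sq_nonneg (L (mono m)))) l
    (mem_finsuppAntidiag_univ l)
  rw [coe_basisMonomials]
  change L (monomial l 1) = 0
  rw [← mono_eq_monomial, (pow_eq_zero_iff two_ne_zero).1 h2]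

theorem linearIndependent_pPoly {k : ℝ} (hk : 0 ≤ k) :
    LinearIndependent ℝ (pPoly k : (Fin N → ℕ) → Poly N) := by
  classical
  have key : LinearIndependent ℝ fun l : Fin N →₀ ℕ => (pPoly k l : Poly N) := by
    rw [linearIndependent_iff']
    intro s c hc
    by_contra hne
    push Not at hne
    obtain ⟨l₀, hl₀, hne⟩ := hne
    -- The functional reproduces the relation: its value at `x^l` is `c l` on `s` and zero
    -- elsewhere. The relation makes `∑ L(p_l) c_l` vanish, while the kernel inequality bounds it
    -- below by `∑ c_l²`.
    set L : Poly N →ₗ[ℝ] ℝ := ∑ l ∈ s, c l • MvPolynomial.lcoeff ℝ l with hL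
    have hLm : ∀ m : Fin N →₀ ℕ, L (mono m) = if m ∈ s then c m else 0 := by
      intro m
      rw [hL, LinearMap.sum_apply, mono_eq_monomial]
      simp [coeff_monomial]
    have hsum : ∑ l ∈ s, L (pPoly k l) * c l = 0 := by
      have := congrArg L hc
      rw [map_sum, map_zero] at this
      rw [← this]
      refine Finset.sum_congr rfl fun l _ => ?_
      rw [map_smul, smul_eq_mul, mul_comm]
    have hd : ∀ d : ℕ, ∑ l ∈ s.filter (fun l : Fin N →₀ ℕ => size l = d), c l ^ 2
        ≤ ∑ l ∈ s.filter (fun l : Fin N →₀ ℕ => size l = d), L (pPoly k l) * c l := by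
      intro d
      have h1 := sum_sq_le_sum_pPoly hk L d
      have hf : s.filter (fun l : Fin N →₀ ℕ => size l = d)
          = (Finset.finsuppAntidiag Finset.univ d).filter (fun l => l ∈ s) := by
        ext l
        rw [Finset.mem_filter, Finset.mem_filter, Finset.mem_finsuppAntidiag]
        exact ⟨fun h => ⟨⟨h.2, Finset.subset_univ _⟩, h.1⟩, fun h => ⟨h.2, h.1.1⟩⟩
      rw [hf, Finset.sum_filter, Finset.sum_filter]
      refine le_trans (le_of_eq ?_) (h1.trans (le_of_eq ?_))
      · refine Finset.sum_congr rfl fun l _ => ?_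
        rw [hLm]
        split_ifs <;> simp
      · refine Finset.sum_congr rfl fun l _ => ?_
        rw [hLm]
        split_ifs <;> simp
    have htot : ∑ l ∈ s, c l ^ 2 ≤ 0 := by
      rw [← hsum, ← Finset.sum_fiberwise_of_maps_to
          (g := fun l : Fin N →₀ ℕ => size l) (t := s.image fun l : Fin N →₀ ℕ => size l)
          (fun l hl => Finset.mem_image_of_mem _ hl) (fun l => c l ^ 2),
        ← Finset.sum_fiberwise_of_maps_to
          (g := fun l : Fin N →₀ ℕ => size l) (t := s.image fun l : Fin N →₀ ℕ => size l)
          (fun l hl => Finset.mem_image_of_mem _ hl) (fun l => L (pPoly k l) * c l)]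
      exact Finset.sum_le_sum fun d _ => hd d
    have hpos : 0 < c l₀ ^ 2 := by positivity
    have := Finset.single_le_sum (f := fun l => c l ^ 2) (fun l _ => sq_nonneg (c l)) hl₀
    exact absurd (lt_of_lt_of_le hpos (this.trans htot)) (lt_irrefl _)
  exact (linearIndependent_equiv' Finsupp.equivFunOnFinite rfl).1 key

/-- The basis `p_α`. -/
noncomputable def pBasis {k : ℝ} (hk : 0 ≤ k) : Module.Basis (Fin N → ℕ) ℝ (Poly N) :=
  Module.Basis.mk (linearIndependent_pPoly hk) (span_range_pPoly hk).ge

theorem pBasis_apply {k : ℝ} (hk : 0 ≤ k) (α : Fin N → ℕ) :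
    pBasis hk α = pPoly k α := Module.Basis.mk_apply _ _ _

theorem raise_pPoly {k : ℝ} (hk : 0 ≤ k) (i : Fin N) (α : Fin N → ℕ) :
    raise k i (pPoly k α) = pPoly k (α + Pi.single i 1) := by
  have h : ∃ R : Module.End ℝ (Poly N),
      ∀ α : Fin N → ℕ, R (pPoly k α) = pPoly k (α + Pi.single i 1) := by
    refine ⟨(pBasis hk).constr ℝ fun α => pPoly k (α + Pi.single i 1), fun α => ?_⟩
    rw [← pBasis_apply hk α, Module.Basis.constr_basis]
  exact Classical.epsilon_spec h α

theorem dunklA_raise {k : ℝ} (hk : 0 ≤ k) (i : Fin N) (f : Poly N) :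
    dunklA k i (raise k i f) = dunklLin k i (X i * f) + k • f := by
  have h : dunklLin k i ∘ₗ raise k i
      = dunklLin k i ∘ₗ LinearMap.mulLeft ℝ (X i) + k • LinearMap.id := by
    refine (pBasis hk).ext fun α => ?_
    rw [pBasis_apply]
    simp only [LinearMap.comp_apply, LinearMap.add_apply, LinearMap.smul_apply,
      LinearMap.mulLeft_apply, LinearMap.id_apply]
    rw [raise_pPoly hk, dunklLin_pPoly_add_single]
  rw [dunklA_eq]
  exact LinearMap.congr_fun h f

end DunklJack

namespace DunklJack

variable {N : ℕ}

/-! ### Compositions, dominance order and the eigenvalues `κ` -/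

theorem permComp_apply (w : Equiv.Perm (Fin N)) (α : Fin N → ℕ) (i : Fin N) :
    permComp w α (w i) = α i := by
  simp [permComp]

theorem permComp_mul (v w : Equiv.Perm (Fin N)) (α : Fin N → ℕ) :
    permComp (v * w) α = permComp v (permComp w α) := by
  funext i
  simp [permComp]

theorem permComp_one (α : Fin N → ℕ) : permComp 1 α = α := by
  funext i
  simp [permComp]

theorem permComp_swap (i j : Fin N) (α : Fin N → ℕ) (l : Fin N) :
    permComp (Equiv.swap i j) α l = α (Equiv.swap i j l) := by
  simp [permComp]

theorem permComp_swap_of_eq {i j : Fin N} {α : Fin N → ℕ} (h : α i = α j) :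
    permComp (Equiv.swap i j) α = α := by
  funext l
  rw [permComp_swap]
  rcases eq_or_ne l i with rfl | hi
  · rw [Equiv.swap_apply_left, h]
  · rcases eq_or_ne l j with rfl | hj
    · rw [Equiv.swap_apply_right, h]
    · rw [Equiv.swap_apply_of_ne_of_ne hi hj]

theorem size_permComp (w : Equiv.Perm (Fin N)) (α : Fin N → ℕ) :
    size (permComp w α) = size α := by
  rw [size, ← Equiv.sum_comp w]
  simp only [permComp_apply]
  rfl

theorem sum_comp_plus (g : ℕ → ℕ) (α : Fin N → ℕ) : ∑ i, g (plus α i) = ∑ i, g (α i) :=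
  Equiv.sum_comp (sortPerm α) fun i => g (α i)

theorem plus_permComp (w : Equiv.Perm (Fin N)) (α : Fin N → ℕ) :
    plus (permComp w α) = plus α := by
  have h := Tuple.comp_perm_comp_sort_eq_comp_sort (f := fun i => OrderDual.toDual (α i))
    (σ := w⁻¹)
  funext i
  exact OrderDual.toDual.injective (congrFun h i)

theorem plus_of_antitone {α : Fin N → ℕ} (h : Antitone α) : plus α = α := by
  have h2 := Tuple.unique_monotone (f := fun i => OrderDual.toDual (α i))
    (σ := sortPerm α) (τ := 1) (Tuple.monotone_sort _) (fun i j hij => h hij)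
  funext i
  exact OrderDual.toDual.injective (congrFun h2 i)

theorem plus_plus (α : Fin N → ℕ) : plus (plus α) = plus α := plus_of_antitone (plus_antitone α)

theorem sum_Iic_of_forall_eq {α β : Fin N → ℕ}
    (h : ∀ j : Fin N, ∑ i ∈ Finset.Iic j, α i = ∑ i ∈ Finset.Iic j, β i) : α = β := by
  funext ⟨j, hj⟩
  induction j with
  | zero =>
    have h0 : Finset.Iic (⟨0, hj⟩ : Fin N) = {⟨0, hj⟩} := by
      ext x
      simp only [Finset.mem_Iic, Finset.mem_singleton, Fin.le_def, Fin.ext_iff]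
      omega
    simpa [h0] using h ⟨0, hj⟩
  | succ j _ =>
    have hs : Finset.Iic (⟨j + 1, hj⟩ : Fin N)
        = insert ⟨j + 1, hj⟩ (Finset.Iic ⟨j, by omega⟩) := by
      ext x
      simp only [Finset.mem_Iic, Finset.mem_insert, Fin.le_def, Fin.ext_iff]
      omega
    have hn : (⟨j + 1, hj⟩ : Fin N) ∉ Finset.Iic (⟨j, by omega⟩ : Fin N) := by
      simp [Fin.le_def]
    have h1 := h ⟨j + 1, hj⟩
    rw [hs, Finset.sum_insert hn, Finset.sum_insert hn, h ⟨j, by omega⟩] at h1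
    exact Nat.add_right_cancel h1

theorem StrictDom.trans {α β γ : Fin N → ℕ} (h1 : StrictDom α β) (h2 : StrictDom β γ) :
    StrictDom α γ := by
  refine ⟨fun j => (h2.1 j).trans (h1.1 j), ?_⟩
  rintro rfl
  exact h1.2 (sum_Iic_of_forall_eq fun j => le_antisymm (h2.1 j) (h1.1 j))

/-- The order in which the non-symmetric Jack polynomials are triangular. -/
def JackLT (β α : Fin N → ℕ) : Prop :=
  size β = size α ∧ (StrictDom (plus α) (plus β) ∨ (plus β = plus α ∧ StrictDom α β))

theorem JackLT.trans {α β γ : Fin N → ℕ} (h1 : JackLT α β) (h2 : JackLT β γ) : JackLT α γ := by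
  obtain ⟨s1, h1⟩ := h1
  obtain ⟨s2, h2⟩ := h2
  refine ⟨s1.trans s2, ?_⟩
  rcases h1 with h1 | ⟨e1, h1⟩ <;> rcases h2 with h2 | ⟨e2, h2⟩
  · exact Or.inl (h2.trans h1)
  · exact Or.inl (e2 ▸ h1)
  · exact Or.inl (e1 ▸ h2)
  · exact Or.inr ⟨e1.trans e2, h2.trans h1⟩

theorem JackLT.irrefl (α : Fin N → ℕ) : ¬JackLT α α := by
  rintro ⟨_, h | ⟨_, h⟩⟩ <;> exact h.2 rfl

/-! ### Dominance of sorted compositions. -/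

theorem sum_le_sum_Iic_of_antitone {f : Fin N → ℕ} (hf : Antitone f) (j : Fin N)
    {T : Finset (Fin N)} (hT : T.card = (Finset.Iic j).card) :
    ∑ i ∈ T, f i ≤ ∑ i ∈ Finset.Iic j, f i := by
  rw [← Finset.sum_inter_add_sum_sdiff T (Finset.Iic j),
    ← Finset.sum_inter_add_sum_sdiff (Finset.Iic j) T, Finset.inter_comm]
  apply Nat.add_le_add_left
  have h1 : ∑ i ∈ T \ Finset.Iic j, f i ≤ (T \ Finset.Iic j).card • f j := by
    apply Finset.sum_le_card_nsmul
    intro x hx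
    rw [Finset.mem_sdiff, Finset.mem_Iic, not_le] at hx
    exact hf hx.2.le
  have h2 : (Finset.Iic j \ T).card • f j ≤ ∑ i ∈ Finset.Iic j \ T, f i := by
    apply Finset.card_nsmul_le_sum
    intro x hx
    rw [Finset.mem_sdiff, Finset.mem_Iic] at hx
    exact hf hx.1
  rw [Finset.card_sdiff_comm hT] at h1
  exact h1.trans h2

/-- Partial sums of `α⁺` are maxima over index sets of fixed size, so dominance can be tested on
arbitrary sets without following the sorting. -/
theorem sum_le_sum_Iic_plus (α : Fin N → ℕ) (j : Fin N) {S : Finset (Fin N)}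
    (hS : S.card = (Finset.Iic j).card) : ∑ i ∈ S, α i ≤ ∑ i ∈ Finset.Iic j, plus α i := by
  have h : ∑ i ∈ S, α i = ∑ i ∈ S.map (sortPerm α).symm.toEmbedding, plus α i := by
    rw [Finset.sum_map]
    simp [plus]
  rw [h]
  exact sum_le_sum_Iic_of_antitone (plus_antitone α) j (by rw [Finset.card_map, hS])

theorem exists_sum_eq_sum_Iic_plus (α : Fin N → ℕ) (j : Fin N) :
    ∃ S : Finset (Fin N), S.card = (Finset.Iic j).card ∧
      ∑ i ∈ S, α i = ∑ i ∈ Finset.Iic j, plus α i :=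
  ⟨(Finset.Iic j).map (sortPerm α).toEmbedding, Finset.card_map _, by
    rw [Finset.sum_map]
    rfl⟩

/-- Take a set that attains a partial sum of `α⁺`. The same set does at least as well for `β`,
unless it contains `j` but not `i`; then exchange `j` for `i`. -/
theorem strictDom_plus_of_spread_aux {α β : Fin N → ℕ} {i j : Fin N} (hij : i ≠ j)
    (hoff : ∀ l, l ≠ i → l ≠ j → β l = α l) (hsum : β i + β j = α i + α j)
    (hi : α i < β i) (hj : α j < β i) : StrictDom (plus β) (plus α) := by
  constructor
  · intro m
    obtain ⟨S, hS, hsS⟩ := exists_sum_eq_sum_Iic_plus α m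
    rw [← hsS]
    by_cases hiS : i ∈ S
    · refine le_trans ?_ (sum_le_sum_Iic_plus β m hS)
      by_cases hjS : j ∈ S
      · have hj' : j ∈ S.erase i := Finset.mem_erase.2 ⟨hij.symm, hjS⟩
        rw [← Finset.add_sum_erase S _ hiS, ← Finset.add_sum_erase S _ hiS,
          ← Finset.add_sum_erase _ _ hj', ← Finset.add_sum_erase _ _ hj', ← add_assoc,
          ← add_assoc, hsum]
        refine Nat.add_le_add_left (Finset.sum_le_sum fun l hl => (hoff l ?_ ?_).ge) _
        · exact Finset.ne_of_mem_erase (Finset.mem_of_mem_erase hl)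
        · exact Finset.ne_of_mem_erase hl
      · refine Finset.sum_le_sum fun l hl => ?_
        rcases eq_or_ne l i with rfl | hli
        · exact hi.le
        · exact (hoff l hli fun e => hjS (e ▸ hl)).ge
    · by_cases hjS : j ∈ S
      · have hn : i ∉ S.erase j := fun h => hiS (Finset.mem_of_mem_erase h)
        refine le_trans ?_ (sum_le_sum_Iic_plus β m (S := insert i (S.erase j)) ?_)
        · rw [Finset.sum_insert hn, ← Finset.add_sum_erase S _ hjS]
          refine Nat.add_le_add hj.le (Finset.sum_le_sum fun l hl => (hoff l ?_ ?_).ge)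
          · exact fun e => hn (e ▸ hl)
          · exact Finset.ne_of_mem_erase hl
        · rw [Finset.card_insert_of_notMem hn, Finset.card_erase_add_one hjS, hS]
      · refine le_trans ?_ (sum_le_sum_Iic_plus β m hS)
        refine Finset.sum_le_sum fun l hl => (hoff l ?_ ?_).ge
        · exact fun e => hiS (e ▸ hl)
        · exact fun e => hjS (e ▸ hl)
  · intro h
    -- Sums of squares separate the two rearrangements: they differ by `2 (β_i - α_i)(β_i - α_j) >
    -- 0`.
    have h1 := sum_comp_plus (fun x => x ^ 2) β
    rw [h, sum_comp_plus (fun x => x ^ 2) α] at h1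
    have hj' : j ∈ Finset.univ.erase i := by simp [hij.symm]
    rw [← Finset.add_sum_erase _ _ (Finset.mem_univ i),
      ← Finset.add_sum_erase _ _ (Finset.mem_univ i),
      ← Finset.add_sum_erase _ _ hj', ← Finset.add_sum_erase _ _ hj'] at h1
    have h2 : ∑ x ∈ (Finset.univ.erase i).erase j, β x ^ 2
        = ∑ x ∈ (Finset.univ.erase i).erase j, α x ^ 2 := by
      refine Finset.sum_congr rfl fun l hl => ?_
      simp only [Finset.mem_erase, Finset.mem_univ, and_true] at hl
      rw [hoff l hl.2 hl.1]
    rw [h2, ← add_assoc, ← add_assoc] at h1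
    have h3 := Nat.add_right_cancel h1
    zify at h3 hsum hi hj
    nlinarith [mul_pos (sub_pos.2 hi) (sub_pos.2 hj)]

theorem strictDom_plus_of_spread {α β : Fin N → ℕ} {i j : Fin N} (hij : i ≠ j)
    (hoff : ∀ l, l ≠ i → l ≠ j → β l = α l) (hsum : β i + β j = α i + α j)
    (hmax : max (α i) (α j) < max (β i) (β j)) : StrictDom (plus β) (plus α) := by
  rw [max_lt_iff, lt_max_iff, lt_max_iff] at hmax
  rcases le_total (β j) (β i) with h | h
  · exact strictDom_plus_of_spread_aux hij hoff hsum (by omega) (by omega)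
  · exact strictDom_plus_of_spread_aux hij.symm (fun l h1 h2 => hoff l h2 h1) (by omega)
      (by omega) (by omega)

theorem strictDom_swap {α : Fin N → ℕ} {i j : Fin N} (hij : i < j) (h : α i < α j) :
    StrictDom (permComp (Equiv.swap i j) α) α := by
  constructor
  · intro m
    by_cases hj : j ≤ m
    · apply le_of_eq
      refine Finset.sum_nbij' (Equiv.swap i j) (Equiv.swap i j) ?_ ?_ ?_ ?_ ?_
      · intro l hl
        rw [Finset.mem_Iic] at hl ⊢
        rw [Equiv.swap_apply_def]
        split_ifs
        exacts [hj, (hij.le.trans hj), hl]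
      · intro l hl
        rw [Finset.mem_Iic] at hl ⊢
        rw [Equiv.swap_apply_def]
        split_ifs
        exacts [hj, (hij.le.trans hj), hl]
      · simp
      · simp
      · intro l _
        rw [permComp_apply]
    · refine Finset.sum_le_sum fun l hl => ?_
      rw [Finset.mem_Iic] at hl
      rw [permComp_swap]
      rcases eq_or_ne l i with rfl | hli
      · rw [Equiv.swap_apply_left]
        exact h.le
      · rw [Equiv.swap_apply_of_ne_of_ne hli]
        rintro rfl
        exact hj hl
  · intro e
    have := congrFun e i
    rw [permComp_swap, Equiv.swap_apply_left] at this
    omega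

theorem jackLT_of_spread {α β : Fin N → ℕ} {i j : Fin N} (hij : i ≠ j)
    (hoff : ∀ l, l ≠ i → l ≠ j → β l = α l) (hsum : β i + β j = α i + α j)
    (hmax : max (α i) (α j) < max (β i) (β j)) : JackLT α β := by
  refine ⟨?_, Or.inl (strictDom_plus_of_spread hij hoff hsum hmax)⟩
  have hj' : j ∈ Finset.univ.erase i := by simp [hij.symm]
  rw [size, size, ← Finset.add_sum_erase _ _ (Finset.mem_univ i),
    ← Finset.add_sum_erase _ _ (Finset.mem_univ i),
    ← Finset.add_sum_erase _ _ hj', ← Finset.add_sum_erase _ _ hj', ← add_assoc, ← add_assoc, hsum]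
  congr 1
  refine Finset.sum_congr rfl fun l hl => ?_
  simp only [Finset.mem_erase, Finset.mem_univ, and_true] at hl
  rw [hoff l hl.2 hl.1]

theorem jackLT_swap {α : Fin N → ℕ} {i j : Fin N} (hij : i < j) (h : α i < α j) :
    JackLT α (permComp (Equiv.swap i j) α) :=
  ⟨(size_permComp _ _).symm, Or.inr ⟨(plus_permComp _ _).symm, strictDom_swap hij h⟩⟩

theorem swap_jackLT {α : Fin N → ℕ} {i j : Fin N} (hij : i < j) (h : α j < α i) :
    JackLT (permComp (Equiv.swap i j) α) α := by
  have h2 := jackLT_swap (α := permComp (Equiv.swap i j) α) hij (by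
    rwa [permComp_swap, permComp_swap, Equiv.swap_apply_left, Equiv.swap_apply_right])
  rwa [← permComp_mul, Equiv.swap_mul_self, permComp_one] at h2

/-! ### Ranks and eigenvalues -/

/-- The total order of the positions given by the decreasing order of the entries of `α`. -/
def Before (α : Fin N → ℕ) (s t : Fin N) : Prop := α t < α s ∨ (α s = α t ∧ s < t)

/-- The number of positions before `i`. -/
noncomputable def rankOf (α : Fin N → ℕ) (i : Fin N) : ℕ :=
  open Classical in (Finset.univ.filter fun s => Before α s i).card

theorem Before.trans {α : Fin N → ℕ} {s t u : Fin N} (h1 : Before α s t) (h2 : Before α t u) :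
    Before α s u := by
  unfold Before at *
  omega

theorem Before.irrefl (α : Fin N → ℕ) (s : Fin N) : ¬Before α s s := by
  unfold Before
  omega

theorem before_or_before (α : Fin N → ℕ) {s t : Fin N} (h : s ≠ t) :
    Before α s t ∨ Before α t s := by
  unfold Before
  omega

theorem Before.le {α : Fin N → ℕ} {s t : Fin N} (h : Before α s t) : α t ≤ α s := by
  unfold Before at h
  omega

theorem Before.rankOf_lt {α : Fin N → ℕ} {s t : Fin N} (h : Before α s t) :
    rankOf α s < rankOf α t := by
  classical
  apply Finset.card_lt_card
  rw [Finset.ssubset_iff_of_subset]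
  · exact ⟨s, by simpa using h, by simpa using Before.irrefl α s⟩
  · intro u hu
    simp only [Finset.mem_filter, Finset.mem_univ, true_and] at hu ⊢
    exact hu.trans h

theorem kappa_eq (k : ℝ) (α : Fin N → ℕ) (i : Fin N) :
    kappa k α i = N * k - k * rankOf α i + α i + 1 := by
  classical
  have h : rankOf α i = (Finset.univ.filter fun s => α i < α s).card
      + (Finset.univ.filter fun s => s < i ∧ α s = α i).card := by
    rw [rankOf, ← Finset.card_union_of_disjoint]
    · congr 1
      ext s
      rw [Finset.mem_filter, Finset.mem_union, Finset.mem_filter, Finset.mem_filter, Before,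
        and_comm (a := s < i)]
      simp only [Finset.mem_univ, true_and]
    · rw [Finset.disjoint_left]
      intro s hs hs'
      simp only [Finset.mem_filter, Finset.mem_univ, true_and] at hs hs'
      omega
  rw [kappa, h]
  push_cast
  ring

theorem Before.kappa_le {k : ℝ} (hk : 0 ≤ k) {α : Fin N → ℕ} {s t : Fin N} (h : Before α s t) :
    kappa k α t + k + (α s - α t) ≤ kappa k α s := by
  rw [kappa_eq, kappa_eq]
  have h1 : (rankOf α s : ℝ) + 1 ≤ rankOf α t := by exact_mod_cast h.rankOf_lt
  nlinarith

/-- For `k > 0` the value `κ` strictly decreases along `Before`, so the eigenvalues alone recover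
the ranks. -/
theorem rankOf_eq_card_kappa {k : ℝ} (hk : 0 < k) (α : Fin N → ℕ) (i : Fin N) :
    rankOf α i = (Finset.univ.filter fun s => kappa k α i < kappa k α s).card := by
  classical
  have hlt : ∀ {s t : Fin N}, Before α s t → kappa k α t < kappa k α s := by
    intro s t h
    have h1 := h.kappa_le hk.le
    have h2 : (α t : ℝ) ≤ α s := by exact_mod_cast h.le
    linarith
  rw [rankOf]
  congr 1
  ext s
  simp only [Finset.mem_filter, Finset.mem_univ, true_and]
  refine ⟨hlt, fun h => ?_⟩
  rcases eq_or_ne s i with rfl | hne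
  · exact absurd h (lt_irrefl _)
  · exact (before_or_before α hne).resolve_right fun h' => absurd (hlt h') (not_lt.2 h.le)

/-- Ranks count larger eigenvalues, hence are transported by `w`; subtracting the rank term leaves
the entries. For `k = 0` the rank term is absent. -/
theorem eq_of_kappa_eq {k : ℝ} (hk : 0 ≤ k) {α β : Fin N → ℕ} {w : Equiv.Perm (Fin N)}
    (h : ∀ i, kappa k β i = kappa k α (w i)) (i : Fin N) : β i = α (w i) := by
  have h1 := h i
  rw [kappa_eq, kappa_eq] at h1
  have h2 : k * (rankOf β i : ℝ) = k * (rankOf α (w i) : ℝ) := by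
    rcases hk.eq_or_lt with rfl | hk
    · simp
    · rw [rankOf_eq_card_kappa hk, rankOf_eq_card_kappa hk]
      congr 2
      refine Finset.card_bij (fun s _ => w s) ?_ ?_ ?_
      · intro s hs
        simp only [Finset.mem_filter, Finset.mem_univ, true_and] at hs ⊢
        rwa [← h, ← h]
      · intro s _ t _ e
        exact w.injective e
      · intro t ht
        simp only [Finset.mem_filter, Finset.mem_univ, true_and] at ht
        refine ⟨w.symm t, ?_, w.apply_symm_apply t⟩
        simp only [Finset.mem_filter, Finset.mem_univ, true_and]
        rwa [h, h, w.apply_symm_apply]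
  have h3 : (β i : ℝ) = α (w i) := by linarith
  exact_mod_cast h3

theorem kappa_injective {k : ℝ} (hk : 0 ≤ k) {α β : Fin N → ℕ}
    (h : kappa k β = kappa k α) : β = α :=
  funext (eq_of_kappa_eq hk (w := 1) fun i => congrFun h i)

/-- With this gap the coefficient `a = 1` is admissible in `IsEigen.swap`. -/
theorem kappa_of_adjacent_eq (k : ℝ) {α : Fin N → ℕ} {i j : Fin N} (hij : (j : ℕ) = i + 1)
    (h : α i = α j) : kappa k α i = kappa k α j + k := by
  classical
  have h1 : rankOf α j = rankOf α i + 1 := by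
    rw [rankOf, rankOf, ← Finset.card_insert_of_notMem (a := i)]
    · congr 1
      ext s
      simp only [Finset.mem_filter, Finset.mem_univ, true_and, Finset.mem_insert, Before,
        Fin.lt_def, Fin.ext_iff]
      have : (s : ℕ) = i → α s = α i := fun e => congrArg α (Fin.ext e)
      omega
    · simpa using Before.irrefl α i
  rw [kappa_eq, kappa_eq, h1, h]
  push_cast
  ring

theorem rankOf_swap {α : Fin N → ℕ} {i j : Fin N} (hij : (j : ℕ) = i + 1) (h : α i ≠ α j)
    (l : Fin N) :
    rankOf (permComp (Equiv.swap i j) α) l = rankOf α (Equiv.swap i j l) := by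
  classical
  have hb : ∀ s t : Fin N, Before (permComp (Equiv.swap i j) α) s t ↔
      Before α (Equiv.swap i j s) (Equiv.swap i j t) := by
    intro s t
    simp only [Before, permComp_swap]
    -- An adjacent transposition reverses only the order of `i` and `j`, whose entries differ; tied
    -- positions keep their order.
    have hlt : α (Equiv.swap i j s) = α (Equiv.swap i j t) →
        (s < t ↔ Equiv.swap i j s < Equiv.swap i j t) := by
      intro e
      rw [Equiv.swap_apply_def, Equiv.swap_apply_def] at e ⊢
      split_ifs at e ⊢ with h1 h2 h3 h4 h5 h6 h7 h8
      all_goals simp only [Fin.ext_iff, Fin.lt_def] at *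
      all_goals omega
    constructor
    · rintro (h1 | ⟨h1, h2⟩)
      · exact Or.inl h1
      · exact Or.inr ⟨h1, (hlt h1).1 h2⟩
    · rintro (h1 | ⟨h1, h2⟩)
      · exact Or.inl h1
      · exact Or.inr ⟨h1, (hlt h1).2 h2⟩
  refine Finset.card_bij (fun s _ => Equiv.swap i j s) ?_ ?_ ?_
  · intro s hs
    simp only [Finset.mem_filter, Finset.mem_univ, true_and] at hs ⊢
    exact (hb _ _).1 hs
  · intro s _ t _ e
    exact (Equiv.swap i j).injective e
  · intro t ht
    simp only [Finset.mem_filter, Finset.mem_univ, true_and] at ht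
    refine ⟨Equiv.swap i j t, ?_, Equiv.swap_apply_self i j t⟩
    simp only [Finset.mem_filter, Finset.mem_univ, true_and]
    rwa [hb, Equiv.swap_apply_self]

theorem kappa_swap (k : ℝ) {α : Fin N → ℕ} {i j : Fin N} (hij : (j : ℕ) = i + 1) (h : α i ≠ α j)
    (l : Fin N) :
    kappa k (permComp (Equiv.swap i j) α) l = kappa k α (Equiv.swap i j l) := by
  rw [kappa_eq, kappa_eq, rankOf_swap hij h, permComp_swap]

/-- The strict bound makes `|k / (κ_i - κ_j)| < 1`, which keeps the intertwiner from annihilating an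
eigenfunction. -/
theorem abs_kappa_sub_gt {k : ℝ} (hk : 0 ≤ k) {α : Fin N → ℕ} {i j : Fin N} (h : α i ≠ α j) :
    k < |kappa k α i - kappa k α j| := by
  rcases lt_or_gt_of_ne h with h | h
  · have h1 := Before.kappa_le hk (show Before α j i from Or.inl h)
    have h2 : (α i : ℝ) + 1 ≤ α j := by exact_mod_cast h
    rw [abs_sub_comm]
    exact lt_of_lt_of_le (by linarith) (le_abs_self _)
  · have h1 := Before.kappa_le hk (show Before α i j from Or.inl h)
    have h2 : (α j : ℝ) + 1 ≤ α i := by exact_mod_cast h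
    exact lt_of_lt_of_le (by linarith) (le_abs_self _)

-- Counting the positions after `i`, not before it, gives one term for each `j ≠ i`, to be matched
-- with the terms of `U_i`.
open Classical in
theorem kappa_eq_sum (k : ℝ) (α : Fin N → ℕ) (i : Fin N) :
    kappa k α i = α i + 1 + k + k * ∑ j ∈ Finset.univ.erase i, if Before α i j then 1 else 0 := by
  have h1 : (∑ j ∈ Finset.univ.erase i, if Before α i j then (1 : ℝ) else 0)
      + rankOf α i + 1 = N := by
    have h2 : (rankOf α i : ℝ) = ∑ j ∈ Finset.univ.erase i, if Before α i j then (0 : ℝ) else 1 := by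
      rw [rankOf, Finset.card_filter, ← Finset.add_sum_erase _ _ (Finset.mem_univ i),
        if_neg (Before.irrefl α i), zero_add, Nat.cast_sum]
      refine Finset.sum_congr rfl fun j hj => ?_
      have hne := Finset.ne_of_mem_erase hj
      have h3 : Before α j i ↔ ¬Before α i j :=
        ⟨fun a b => Before.irrefl α _ (a.trans b), (before_or_before α hne).resolve_right⟩
      by_cases h4 : Before α i j
      · simp [h4, h3]
      · simp [h4, h3]
    rw [h2, ← Finset.sum_add_distrib]
    have h3 : ∀ j ∈ Finset.univ.erase i, ((if Before α i j then (1 : ℝ) else 0)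
        + if Before α i j then (0 : ℝ) else 1) = 1 := by
      intro j _
      split_ifs <;> simp
    rw [Finset.sum_congr rfl h3, Finset.sum_const, Finset.card_erase_of_mem (Finset.mem_univ i),
      Finset.card_univ, Fintype.card_fin, nsmul_one]
    have hN : 1 ≤ N := Nat.one_le_of_lt i.2
    push_cast [hN]
    ring
  rw [kappa_eq, ← h1]
  ring

/-! ### Generation by adjacent transpositions -/

/-- The fibres of an antitone function are intervals, so adjacent transpositions inside the fibres
act transitively on each fibre and generate every permutation that preserves them. The choices of
`f` below give all of `S_N`, the stabilizer of a partition, and `G_ℓ`. -/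
theorem perm_induction_of_antitone {ι : Type*} [PartialOrder ι] {f : Fin N → ι} (hf : Antitone f)
    {P : Equiv.Perm (Fin N) → Prop} (h1 : P 1)
    (hs : ∀ (i j : Fin N) (w : Equiv.Perm (Fin N)), (j : ℕ) = i + 1 → f i = f j →
      (∀ x, f (w x) = f x) → P w → P (Equiv.swap i j * w))
    (w : Equiv.Perm (Fin N)) (hw : ∀ x, f (w x) = f x) : P w := by
  set S : Set (Equiv.Perm (Fin N)) :=
    {g | ∃ i j : Fin N, (j : ℕ) = i + 1 ∧ f i = f j ∧ g = Equiv.swap i j} with hS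
  have hinv : ∀ i j : Fin N, f i = f j → ∀ x, f (Equiv.swap i j x) = f x := by
    intro i j h x
    rw [Equiv.swap_apply_def]
    split_ifs with h2 h3
    · rw [h2, h]
    · rw [h3, h]
    · rfl
  have hswap : ∀ g ∈ S, g.IsSwap := by
    rintro g ⟨i, j, hij, -, rfl⟩
    exact ⟨i, j, fun e => by rw [e] at hij; omega, rfl⟩
  have horb : ∀ (d : ℕ) (x y : Fin N), (y : ℕ) = x + d → f x = f y →
      y ∈ MulAction.orbit (Subgroup.closure S) x := by
    intro d
    induction d with
    | zero =>
      intro x y hxy _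
      rw [show y = x from Fin.ext hxy]
      exact MulAction.mem_orbit_self x
    | succ d ih =>
      intro x y hxy e
      have hz : (x : ℕ) + d < N := by omega
      set z : Fin N := ⟨x + d, hz⟩ with hzdef
      have hxz : x ≤ z := by simp [Fin.le_def, hzdef]
      have hzy : z ≤ y := by simp only [Fin.le_def, hzdef]; omega
      have hfz : f z = f y := le_antisymm ((hf hxz).trans e.le) (hf hzy)
      obtain ⟨g, hg⟩ := ih x z rfl (e.trans hfz.symm)
      have hyz : (y : ℕ) = z + 1 := by
        simp only [hzdef]
        omega
      refine ⟨⟨Equiv.swap z y, Subgroup.subset_closure ⟨z, y, hyz, hfz, rfl⟩⟩ * g, ?_⟩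
      dsimp only at hg ⊢
      rw [mul_smul, hg]
      exact Equiv.swap_apply_left z y
  have hmem : w ∈ Subgroup.closure S := by
    rw [mem_closure_isSwap hswap]
    refine ⟨Set.toFinite _, fun x => ?_⟩
    rcases le_total (x : ℕ) (w x : ℕ) with h | h
    · exact horb (w x - x) x (w x) (by omega) (hw x).symm
    · exact MulAction.mem_orbit_symm.1 (horb (x - w x) (w x) x (by omega) (hw x))
  have hgen : (∀ x, f (w x) = f x) ∧ P w := by
    refine Subgroup.closure_induction_left (p := fun w _ => (∀ x, f (w x) = f x) ∧ P w)
      ⟨fun _ => rfl, h1⟩ ?_ ?_ hmem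
    · rintro g ⟨i, j, hij, e, rfl⟩ v _ ⟨hv, hP⟩
      exact ⟨fun x => (hinv i j e _).trans (hv x), hs i j v hij e hv hP⟩
    · rintro g ⟨i, j, hij, e, rfl⟩ v _ ⟨hv, hP⟩
      rw [Equiv.swap_inv]
      exact ⟨fun x => (hinv i j e _).trans (hv x), hs i j v hij e hv hP⟩
  exact hgen.2

end DunklJack

namespace DunklJack

open MvPolynomial

variable {N : ℕ}

/-! ### The operators `U_i` -/

/-- `U_i` in terms of multiplication by `x_i`, as a linear map. -/
noncomputable def cherednik (k : ℝ) (i : Fin N) : Poly N →ₗ[ℝ] Poly N :=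
  dunklLin k i ∘ₗ LinearMap.mulLeft ℝ (X i) + k • LinearMap.id
    - k • ∑ j ∈ Finset.Iio i, (permAct (Equiv.swap i j)).toLinearMap

theorem cherednik_apply (k : ℝ) (i : Fin N) (f : Poly N) :
    cherednik k i f = dunklLin k i (X i * f) + k • f
      - k • ∑ j ∈ Finset.Iio i, permAct (Equiv.swap i j) f := by
  simp [cherednik, LinearMap.sum_apply]

theorem opU_eq {k : ℝ} (hk : 0 ≤ k) (i : Fin N) (f : Poly N) : opU k i f = cherednik k i f := by
  rw [opU, dunklA_raise hk, cherednik_apply]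

theorem permAct_dunklLin_X_mul (k : ℝ) (w : Equiv.Perm (Fin N)) (i : Fin N) (f : Poly N) :
    permAct w (dunklLin k i (X i * f)) = dunklLin k (w i) (X (w i) * permAct w f) := by
  rw [permAct_dunklLin, map_mul, permAct_X]

theorem permAct_cherednik (k : ℝ) (w : Equiv.Perm (Fin N)) (i : Fin N) (f : Poly N) :
    permAct w (cherednik k i f) = dunklLin k (w i) (X (w i) * permAct w f) + k • permAct w f
      - k • ∑ j ∈ Finset.Iio i, permAct (Equiv.swap (w i) (w j)) (permAct w f) := by
  rw [cherednik_apply, map_sub, map_add, permAct_dunklLin_X_mul, map_smul, map_smul, map_sum]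
  simp only [permAct_conj_swap]

theorem swap_cherednik_left (k : ℝ) {i j : Fin N} (hij : (j : ℕ) = i + 1) (f : Poly N) :
    permAct (Equiv.swap i j) (cherednik k i f)
      = cherednik k j (permAct (Equiv.swap i j) f) + k • f := by
  have hj : Finset.Iio j = insert i (Finset.Iio i) := by
    ext x
    simp only [Finset.mem_Iio, Finset.mem_insert, Fin.lt_def, Fin.ext_iff]
    omega
  have hs : ∑ m ∈ Finset.Iio i, permAct (Equiv.swap j (Equiv.swap i j m))
        (permAct (Equiv.swap i j) f)
      = ∑ m ∈ Finset.Iio i, permAct (Equiv.swap j m) (permAct (Equiv.swap i j) f) := by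
    refine Finset.sum_congr rfl fun m hm => ?_
    rw [Finset.mem_Iio, Fin.lt_def] at hm
    rw [Equiv.swap_apply_of_ne_of_ne]
    · rintro rfl; omega
    · rintro rfl; omega
  rw [permAct_cherednik, Equiv.swap_apply_left, hs, cherednik_apply, hj,
    Finset.sum_insert (by simp), Equiv.swap_comm j i, permAct_swap_swap, smul_add]
  abel

theorem swap_cherednik_right (k : ℝ) {i j : Fin N} (hij : (j : ℕ) = i + 1) (f : Poly N) :
    cherednik k i (permAct (Equiv.swap i j) f)
      = permAct (Equiv.swap i j) (cherednik k j f) + k • f := by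
  have h := swap_cherednik_left k hij (permAct (Equiv.swap i j) f)
  rw [permAct_swap_swap] at h
  have h2 := congrArg (permAct (Equiv.swap i j)) h
  rwa [permAct_swap_swap, map_add, map_smul, permAct_swap_swap] at h2

theorem swap_cherednik_of_ne (k : ℝ) {i j l : Fin N} (hij : (j : ℕ) = i + 1) (hi : l ≠ i)
    (hj : l ≠ j) (f : Poly N) :
    permAct (Equiv.swap i j) (cherednik k l f)
      = cherednik k l (permAct (Equiv.swap i j) f) := by
  have hiff : ∀ m ∈ Finset.Iio l, Equiv.swap i j m ∈ Finset.Iio l := by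
    intro m hm
    rw [Finset.mem_Iio, Fin.lt_def] at hm ⊢
    rw [Ne, Fin.ext_iff] at hi hj
    rw [Equiv.swap_apply_def]
    split_ifs with h1 h2
    · rw [Fin.ext_iff] at h1; omega
    · rw [Fin.ext_iff] at h2; omega
    · exact hm
  rw [permAct_cherednik, Equiv.swap_apply_of_ne_of_ne hi hj, cherednik_apply]
  congr 2
  exact Finset.sum_nbij' (Equiv.swap i j) (Equiv.swap i j) hiff hiff (by simp) (by simp)
    fun _ _ => rfl

/-- `f` is a simultaneous eigenfunction of the `U_i`, with eigenvalues `c`. -/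
def IsEigen (k : ℝ) (c : Fin N → ℝ) (f : Poly N) : Prop := ∀ i, cherednik k i f = c i • f

theorem IsEigen.smul {k : ℝ} {c : Fin N → ℝ} {f : Poly N} (h : IsEigen k c f) (a : ℝ) :
    IsEigen k c (a • f) := fun i => by
  rw [map_smul, h i, smul_comm]

theorem IsEigen.sub {k : ℝ} {c : Fin N → ℝ} {f g : Poly N} (hf : IsEigen k c f)
    (hg : IsEigen k c g) : IsEigen k c (f - g) := fun i => by
  rw [map_sub, hf i, hg i, smul_sub]

/-- The transposition exchanges `U_i` and `U_j` up to an error `± k`; subtracting `a • f`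
compensates this error exactly when `(c i - c j) a = k`. -/
theorem IsEigen.swap {k : ℝ} {c : Fin N → ℝ} {f : Poly N} (h : IsEigen k c f) {i j : Fin N}
    (hij : (j : ℕ) = i + 1) {a : ℝ} (ha : (c i - c j) * a = k) :
    IsEigen k (fun l => c (Equiv.swap i j l)) (permAct (Equiv.swap i j) f - a • f) := by
  intro l
  rcases eq_or_ne l i with rfl | hi
  · beta_reduce
    rw [map_sub, map_smul, swap_cherednik_right k hij, h, h, map_smul, Equiv.swap_apply_left, ← ha]
    module
  · rcases eq_or_ne l j with rfl | hj
    · have h2 := swap_cherednik_left k hij f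
      rw [← sub_eq_iff_eq_add] at h2
      beta_reduce
      rw [map_sub, map_smul, ← h2, h, h, map_smul, Equiv.swap_apply_right]
      rw [← ha]
      module
    · beta_reduce
      rw [map_sub, map_smul, ← swap_cherednik_of_ne k hij hi hj, h, map_smul,
        Equiv.swap_apply_of_ne_of_ne hi hj]
      module

/-! ### The affine raising operator -/

section Raising

variable {n : ℕ}

/-- `Φ f (x) = x_N f(x_N, x_1, …, x_{N - 1})`. -/
noncomputable def affineRaise (f : Poly (n + 1)) : Poly (n + 1) :=
  X (Fin.last n) * permAct (finRotate (n + 1))⁻¹ f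

theorem finRotate_inv_apply (i : Fin (n + 1)) :
    (finRotate (n + 1))⁻¹ (finRotate (n + 1) i) = i := Equiv.symm_apply_apply _ _

theorem Iio_finRotate {l : Fin (n + 1)} (hl : l ≠ Fin.last n) :
    Finset.Iio (finRotate (n + 1) l)
      = insert 0 ((Finset.Iio l).map (finRotate (n + 1)).toEmbedding) := by
  ext x
  simp only [Finset.mem_Iio, Finset.mem_insert, Finset.mem_map_equiv]
  obtain ⟨y, rfl⟩ := (finRotate (n + 1)).surjective x
  rw [Equiv.symm_apply_apply]
  rcases eq_or_ne y (Fin.last n) with rfl | hy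
  · have h1 : (finRotate (n + 1)) (Fin.last n) = 0 := finRotate_last
    simp only [h1, true_or, iff_true]
    rw [Fin.lt_def, coe_finRotate_of_ne_last hl]
    simp
  · rw [Fin.lt_def, coe_finRotate_of_ne_last hl, coe_finRotate_of_ne_last hy, Fin.ext_iff,
      coe_finRotate_of_ne_last hy, Fin.lt_def]
    simp

/-- Moving `x_N` past `T_l` leaves one extra transposition `(l N)`. It is the rotated image of the
transposition with the first index, the one that `U_{l+1}` has beyond the shifted ones of `U_l`. -/
theorem cherednik_affineRaise_of_ne (k : ℝ) {l : Fin (n + 1)} (hl : l ≠ Fin.last n)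
    (f : Poly (n + 1)) :
    cherednik k l (affineRaise f) = affineRaise (cherednik k (finRotate (n + 1) l) f) := by
  have h0 : (finRotate (n + 1))⁻¹ 0 = Fin.last n := by
    rw [← finRotate_last, finRotate_inv_apply]
  have hs : ∑ m ∈ Finset.Iio l, permAct (Equiv.swap l m)
        (X (Fin.last n) * permAct (finRotate (n + 1))⁻¹ f)
      = X (Fin.last n) * ∑ m ∈ Finset.Iio l, permAct (Equiv.swap l m)
        (permAct (finRotate (n + 1))⁻¹ f) := by
    rw [Finset.mul_sum]
    refine Finset.sum_congr rfl fun m hm => ?_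
    rw [map_mul, permAct_X, Equiv.swap_apply_of_ne_of_ne hl.symm]
    exact (lt_of_lt_of_le (Finset.mem_Iio.1 hm) (Fin.le_last l)).ne'
  have hn : (0 : Fin (n + 1)) ∉ (Finset.Iio l).map (finRotate (n + 1)).toEmbedding := by
    rw [Finset.mem_map_equiv]
    intro h
    have h1 : (finRotate (n + 1)).symm 0 = Fin.last n := h0
    rw [h1, Finset.mem_Iio] at h
    exact absurd h (not_lt.2 (Fin.le_last l))
  have hm : permAct (Equiv.swap l (Fin.last n)) (X l * permAct (finRotate (n + 1))⁻¹ f)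
      = X (Fin.last n) * permAct (Equiv.swap l (Fin.last n))
        (permAct (finRotate (n + 1))⁻¹ f) := by
    rw [map_mul, permAct_X, Equiv.swap_apply_left]
  rw [affineRaise, affineRaise, permAct_cherednik, finRotate_inv_apply, Iio_finRotate hl,
    Finset.sum_insert hn, Finset.sum_map, h0, cherednik_apply, mul_left_comm, dunklLin_X_mul k hl,
    hs, hm]
  simp only [Equiv.coe_toEmbedding, finRotate_inv_apply, smul_add, mul_add, mul_sub, mul_smul_comm]
  abel

/-- For the last index the transpositions subtracted in `U_N` cancel those in the commutator of
`T_N` with `x_N`, and only a shift by one remains. -/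
theorem cherednik_affineRaise_last (k : ℝ) (f : Poly (n + 1)) :
    cherednik k (Fin.last n) (affineRaise f)
      = affineRaise (cherednik k 0 f) + affineRaise f := by
  have h0 : (finRotate (n + 1))⁻¹ 0 = Fin.last n := by
    rw [← finRotate_last, finRotate_inv_apply]
  have hI : Finset.Iio (Fin.last n) = Finset.univ.erase (Fin.last n) := by
    ext x
    rw [Finset.mem_Iio, Finset.mem_erase, Fin.lt_last_iff_ne_last]
    simp
  have hI0 : Finset.Iio (0 : Fin (n + 1)) = ∅ := by
    ext x
    simp
  rw [cherednik_apply, dunklLin_X_self_mul, hI, affineRaise, affineRaise, permAct_cherednik, h0,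
    hI0, Finset.sum_empty, smul_zero, sub_zero, mul_add, mul_smul_comm]
  abel

/-- The effect of `affineRaise` on the index of an eigenfunction. -/
def rotComp (α : Fin (n + 1) → ℕ) : Fin (n + 1) → ℕ := fun i =>
  α (finRotate (n + 1) i) + if i = Fin.last n then 1 else 0

/-- The first position wins all ties. Moved to the end it would lose them, but the added unit makes
it strictly larger than its former equals; it now ties with entries one larger than it was, which
still precede it. -/
theorem rankOf_rotComp (α : Fin (n + 1) → ℕ) (i : Fin (n + 1)) :
    rankOf (rotComp α) i = rankOf α (finRotate (n + 1) i) := by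
  classical
  have hb : ∀ s t, Before (rotComp α) s t ↔
      Before α (finRotate (n + 1) s) (finRotate (n + 1) t) := by
    intro s t
    have h1 : (finRotate (n + 1)) (Fin.last n) = 0 := finRotate_last
    unfold Before rotComp
    by_cases hs : s = Fin.last n <;> by_cases ht : t = Fin.last n
    · simp [hs, ht]
    · have h2 := coe_finRotate_of_ne_last ht
      have h3 : (t : ℕ) < n := lt_of_le_of_ne (Nat.lt_succ_iff.1 t.2) fun e => ht (Fin.ext e)
      subst hs
      rw [if_pos rfl, if_neg ht, Fin.lt_def, Fin.lt_def, h2, h1]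
      simp only [Fin.val_last, Fin.val_zero]
      omega
    · have h2 := coe_finRotate_of_ne_last hs
      have h3 : (s : ℕ) < n := lt_of_le_of_ne (Nat.lt_succ_iff.1 s.2) fun e => hs (Fin.ext e)
      subst ht
      rw [if_pos rfl, if_neg hs, Fin.lt_def, Fin.lt_def, h2, h1]
      simp only [Fin.val_last, Fin.val_zero]
      omega
    · rw [if_neg hs, if_neg ht, Fin.lt_def, Fin.lt_def, coe_finRotate_of_ne_last hs,
        coe_finRotate_of_ne_last ht]
      omega
  refine Finset.card_bij (fun s _ => finRotate (n + 1) s) ?_ ?_ ?_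
  · intro s hs
    simp only [Finset.mem_filter, Finset.mem_univ, true_and] at hs ⊢
    exact (hb _ _).1 hs
  · intro s _ t _ e
    exact (finRotate (n + 1)).injective e
  · intro t ht
    simp only [Finset.mem_filter, Finset.mem_univ, true_and] at ht
    refine ⟨(finRotate (n + 1)).symm t, ?_, Equiv.apply_symm_apply _ _⟩
    simp only [Finset.mem_filter, Finset.mem_univ, true_and]
    rwa [hb, Equiv.apply_symm_apply]

theorem IsEigen.affineRaise {k : ℝ} {α : Fin (n + 1) → ℕ} {f : Poly (n + 1)}
    (h : IsEigen k (kappa k α) f) : IsEigen k (kappa k (rotComp α)) (affineRaise f) := by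
  have hlin : ∀ a : ℝ, DunklJack.affineRaise (a • f) = a • DunklJack.affineRaise f := by
    intro a
    rw [DunklJack.affineRaise, DunklJack.affineRaise, map_smul, mul_smul_comm]
  intro l
  rw [kappa_eq, rankOf_rotComp]
  by_cases hl : l = Fin.last n
  · subst hl
    have h1 : (finRotate (n + 1)) (Fin.last n) = 0 := finRotate_last
    rw [cherednik_affineRaise_last, h, hlin, kappa_eq, h1, rotComp, if_pos rfl, h1]
    push_cast
    module
  · rw [cherednik_affineRaise_of_ne k hl, h, hlin, kappa_eq, rotComp, if_neg hl, add_zero]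

end Raising

end DunklJack

namespace DunklJack

open MvPolynomial

variable {N : ℕ}

/-! ### Triangularity of the `U_i` -/

theorem update_update_self (α : Fin N → ℕ) (i j : Fin N) :
    Function.update (Function.update α i (α i)) j (α j) = α := by
  rw [Function.update_eq_self, Function.update_eq_self]

theorem update_update_swap (α : Fin N → ℕ) {i j : Fin N} (hij : j ≠ i) :
    Function.update (Function.update α i (α j)) j (α i) = permComp (Equiv.swap i j) α := by
  funext l
  rw [permComp_swap]
  rcases eq_or_ne l j with rfl | hj
  · rw [Function.update_self, Equiv.swap_apply_right]
  · rw [Function.update_of_ne hj]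
    rcases eq_or_ne l i with rfl | hi
    · rw [Function.update_self, Equiv.swap_apply_left]
    · rw [Function.update_of_ne hi, Equiv.swap_apply_of_ne_of_ne hi hj]

theorem jackLT_update_update (α : Fin N → ℕ) {i j : Fin N} (hij : j ≠ i) {c d : ℕ}
    (hsum : c + d = α i + α j) (hmax : max (α i) (α j) < max c d) :
    JackLT α (Function.update (Function.update α i c) j d) := by
  apply jackLT_of_spread hij.symm
  · intro l hi hj
    rw [Function.update_of_ne hj, Function.update_of_ne hi]
  · rwa [Function.update_self, Function.update_of_ne hij.symm, Function.update_self]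
  · rwa [Function.update_self, Function.update_of_ne hij.symm, Function.update_self]

theorem update_update_jackLT (α : Fin N → ℕ) {i j : Fin N} (hij : j ≠ i) {c d : ℕ}
    (hsum : c + d = α i + α j) (hmax : max c d < max (α i) (α j)) :
    JackLT (Function.update (Function.update α i c) j d) α := by
  apply jackLT_of_spread hij.symm
  · intro l hi hj
    rw [Function.update_of_ne hj, Function.update_of_ne hi]
  · rw [Function.update_self, Function.update_of_ne hij.symm, Function.update_self, hsum]
  · rwa [Function.update_self, Function.update_of_ne hij.symm, Function.update_self]

/-- The span of the `p_β` with `β` above `α`. -/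
noncomputable def pAbove (k : ℝ) (α : Fin N → ℕ) : Submodule ℝ (Poly N) :=
  Submodule.span ℝ {q | ∃ β, JackLT α β ∧ q = pPoly k β}

/-- The span of the `x^β` with `β` below `α`. -/
noncomputable def monoBelow (α : Fin N → ℕ) : Submodule ℝ (Poly N) :=
  Submodule.span ℝ {q | ∃ β, JackLT β α ∧ q = mono β}

theorem pPoly_mem_pAbove (k : ℝ) {α β : Fin N → ℕ} (h : JackLT α β) :
    pPoly k β ∈ pAbove k α := Submodule.subset_span ⟨β, h, rfl⟩

theorem mono_mem_monoBelow {α β : Fin N → ℕ} (h : JackLT β α) :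
    (mono β : Poly N) ∈ monoBelow α := Submodule.subset_span ⟨β, h, rfl⟩

theorem cherednik_eq (k : ℝ) (i : Fin N) (f : Poly N) :
    cherednik k i f = X i * dunklLin k i f + (1 + k) • f
      + k • ∑ j ∈ Finset.univ.erase i, if i < j then permAct (Equiv.swap i j) f else 0 := by
  have h1 : ∑ j ∈ Finset.Iio i, permAct (Equiv.swap i j) f
      = ∑ j ∈ Finset.univ.erase i, if j < i then permAct (Equiv.swap i j) f else 0 := by
    rw [← Finset.sum_filter]
    refine Finset.sum_congr ?_ fun _ _ => rfl
    ext x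
    simp only [Finset.mem_Iio, Finset.mem_filter, Finset.mem_erase, Finset.mem_univ, and_true]
    exact ⟨fun h => ⟨h.ne, h⟩, fun h => h.2⟩
  have h2 : ∑ j ∈ Finset.univ.erase i, permAct (Equiv.swap i j) f
      = (∑ j ∈ Finset.univ.erase i, if i < j then permAct (Equiv.swap i j) f else 0)
        + ∑ j ∈ Finset.univ.erase i, if j < i then permAct (Equiv.swap i j) f else 0 := by
    rw [← Finset.sum_add_distrib]
    refine Finset.sum_congr rfl fun j hj => ?_
    rcases lt_or_gt_of_ne (Finset.ne_of_mem_erase hj) with h | h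
    · rw [if_neg (not_lt.2 h.le), if_pos h, zero_add]
    · rw [if_neg (not_lt.2 h.le), if_pos h, add_zero]
  rw [cherednik_apply, dunklLin_X_self_mul, h1, h2]
  module

-- Splits `U_i - κ_i(α)` into contributions of single indices `j`, so that triangularity can be
-- checked pair by pair.
open Classical in
theorem cherednik_sub_mem {k : ℝ} {i : Fin N} {α : Fin N → ℕ} {f : Poly N} {D : Fin N → Poly N}
    {W : Submodule ℝ (Poly N)}
    (hD : X i * dunklLin k i f = (α i : ℝ) • f + k • ∑ j ∈ Finset.univ.erase i, D j)
    (hW : ∀ j, j ≠ i → D j + (if i < j then permAct (Equiv.swap i j) f else 0)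
      - (if Before α i j then f else 0) ∈ W) :
    cherednik k i f - kappa k α i • f ∈ W := by
  have h : cherednik k i f - kappa k α i • f
      = k • ∑ j ∈ Finset.univ.erase i, (D j + (if i < j then permAct (Equiv.swap i j) f else 0)
        - (if Before α i j then f else 0)) := by
    have h1 : ∑ j ∈ Finset.univ.erase i, (if Before α i j then f else 0)
        = (∑ j ∈ Finset.univ.erase i, if Before α i j then (1 : ℝ) else 0) • f := by
      rw [Finset.sum_smul]
      refine Finset.sum_congr rfl fun j _ => ?_
      split_ifs <;> simp
    rw [Finset.sum_sub_distrib, Finset.sum_add_distrib, h1, cherednik_eq, hD, kappa_eq_sum]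
    module
  rw [h]
  exact W.smul_mem _ (W.sum_mem fun j hj => hW j (Finset.ne_of_mem_erase hj))

/-- If `α j < α i`, the pair term supplies `p_α` minus its transpose; for `i < j` the transposition
in `U_i` cancels the transpose, and for `j < i` the transpose lies above `α`. If `α i ≤ α j`, the
pair term lies above `α`, and the transposition, present for `i < j`, gives `p_α` in a tie and a
higher index otherwise. -/
theorem cherednik_pPoly_sub_mem (k : ℝ) (i : Fin N) (α : Fin N → ℕ) :
    cherednik k i (pPoly k α) - kappa k α i • pPoly k α ∈ pAbove k α := by
  classical
  apply cherednik_sub_mem (X_mul_dunklLin_pPoly k α i)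
  intro j hj
  rw [permAct_pPoly]
  rcases lt_or_ge (α j) (α i) with h | h
  · have hB : Before α i j := Or.inl h
    have hT : pairTerm k α i j - (pPoly k α - pPoly k (permComp (Equiv.swap i j) α))
        ∈ pAbove k α := by
      rw [pairTerm_eq_sum k α hj, Finset.sum_range_succ', add_zero, Nat.sub_zero,
        update_update_self α i j, update_update_swap α hj, add_sub_cancel_right]
      refine Submodule.sum_mem _ fun t ht => ?_
      rw [Finset.mem_range] at ht
      exact Submodule.sub_mem _
        (pPoly_mem_pAbove k (jackLT_update_update α hj (by omega) (by omega)))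
        (pPoly_mem_pAbove k (jackLT_update_update α hj (by omega) (by omega)))
    rw [if_pos hB]
    split_ifs with hij
    · convert hT using 1
      ring
    · have hji : j < i := lt_of_le_of_ne (not_lt.1 hij) hj
      have hs : pPoly k (permComp (Equiv.swap i j) α) ∈ pAbove k α := by
        rw [Equiv.swap_comm]
        exact pPoly_mem_pAbove k (jackLT_swap hji h)
      convert Submodule.sub_mem _ hT hs using 1
      ring
  · have hT : pairTerm k α i j ∈ pAbove k α := by
      rw [pairTerm_eq_sum' k α hj]
      refine Submodule.sum_mem _ fun t ht => ?_
      rw [Finset.mem_range] at ht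
      exact Submodule.sub_mem _
        (pPoly_mem_pAbove k (jackLT_update_update α hj (by omega) (by omega)))
        (pPoly_mem_pAbove k (jackLT_update_update α hj (by omega) (by omega)))
    rw [add_sub_assoc]
    refine Submodule.add_mem _ hT ?_
    rcases h.eq_or_lt with h | h
    · rw [permComp_swap_of_eq h]
      by_cases hij : i < j
      · rw [if_pos hij, if_pos (show Before α i j from Or.inr ⟨h, hij⟩), sub_self]
        exact Submodule.zero_mem _
      · rw [if_neg hij, if_neg (show ¬Before α i j by unfold Before; omega), sub_self]
        exact Submodule.zero_mem _
    · rw [if_neg (show ¬Before α i j by unfold Before; omega), sub_zero]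
      split_ifs with hij
      · exact pPoly_mem_pAbove k (jackLT_swap hij h)
      · exact Submodule.zero_mem _

/-! ### Triangularity on monomials. -/

/-- `x^α` without the factors that belong to the positions `i` and `j`. -/
noncomputable def monoRest (α : Fin N → ℕ) (i j : Fin N) : Poly N :=
  ∏ l ∈ (Finset.univ.erase i).erase j, X l ^ α l

theorem mono_eq_mul (α : Fin N → ℕ) {i j : Fin N} (h : j ≠ i) :
    (mono α : Poly N) = X i ^ α i * X j ^ α j * monoRest α i j := by
  have h2 : j ∈ Finset.univ.erase i := by simp [h]
  rw [monoRest, mul_assoc, Finset.mul_prod_erase (Finset.univ.erase i) (fun l => X l ^ α l) h2,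
    Finset.mul_prod_erase Finset.univ (fun l => X l ^ α l) (Finset.mem_univ i), mono]

theorem mono_update_update (α : Fin N → ℕ) {i j : Fin N} (h : j ≠ i) (c d : ℕ) :
    (mono (Function.update (Function.update α i c) j d) : Poly N)
      = X i ^ c * X j ^ d * monoRest α i j := by
  rw [mono_eq_mul _ h, Function.update_self, Function.update_of_ne h.symm,
    Function.update_self]
  congr 1
  refine Finset.prod_congr rfl fun l hl => ?_
  simp only [Finset.mem_erase, Finset.mem_univ, and_true] at hl
  rw [Function.update_of_ne hl.1, Function.update_of_ne hl.2]

theorem permAct_mono (w : Equiv.Perm (Fin N)) (α : Fin N → ℕ) :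
    permAct w (mono α) = mono (permComp w α) := by
  rw [mono, mono, map_prod, ← Equiv.prod_comp w fun j => X j ^ permComp w α j]
  refine Finset.prod_congr rfl fun j _ => ?_
  rw [map_pow, permAct_X, permComp_apply]

theorem permAct_swap_monoRest (α : Fin N → ℕ) (i j : Fin N) :
    permAct (Equiv.swap i j) (monoRest α i j) = monoRest α i j := by
  rw [monoRest, map_prod]
  refine Finset.prod_congr rfl fun l hl => ?_
  simp only [Finset.mem_erase, Finset.mem_univ, and_true] at hl
  rw [map_pow, permAct_X, Equiv.swap_apply_of_ne_of_ne hl.2 hl.1]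

theorem divDiff_mono_of_le (α : Fin N → ℕ) {i j : Fin N} (hj : j ≠ i) (h : α j ≤ α i) :
    X i * divDiff i j (mono α) = ∑ t ∈ Finset.range (α i - α j),
      mono (Function.update (Function.update α i (α j + 1 + t)) j (α i - 1 - t)) := by
  have h1 : divDiff i j (X i ^ α i * X j ^ α j)
      = (X i * X j) ^ α j * ∑ t ∈ Finset.range (α i - α j),
        X i ^ t * X j ^ (α i - α j - 1 - t) := by
    apply divDiff_eq hj.symm
    have h2 := (Commute.all (X i : Poly N) (X j)).mul_geom_sum₂ (α i - α j)
    have h3 : α i = α j + (α i - α j) := by omega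
    rw [mul_left_comm, h2, map_mul, map_pow, map_pow, permAct_X, permAct_X, Equiv.swap_apply_left,
      Equiv.swap_apply_right]
    have h4 : ∀ x : Poly N, x ^ α i = x ^ α j * x ^ (α i - α j) := fun x => by
      rw [← pow_add, ← h3]
    rw [h4, h4, mul_pow]
    ring
  rw [mono_eq_mul α hj, mul_comm _ (monoRest α i j),
    divDiff_mul_of_fixed hj.symm (permAct_swap_monoRest α i j), h1, Finset.mul_sum,
    Finset.mul_sum, Finset.mul_sum]
  refine Finset.sum_congr rfl fun t ht => ?_
  rw [Finset.mem_range] at ht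
  rw [mono_update_update α hj, show α i - 1 - t = α j + (α i - α j - 1 - t) by omega]
  ring

theorem divDiff_mono_of_ge (α : Fin N → ℕ) {i j : Fin N} (hj : j ≠ i) (h : α i ≤ α j) :
    X i * divDiff i j (mono α) = -∑ t ∈ Finset.range (α j - α i),
      mono (Function.update (Function.update α i (α i + 1 + t)) j (α j - 1 - t)) := by
  have h0 : ∀ f : Poly N, divDiff i j f = -divDiff i j (permAct (Equiv.swap i j) f) := by
    intro f
    apply divDiff_eq hj.symm
    rw [mul_neg, sub_mul_divDiff, permAct_swap_swap, neg_sub]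
  have hv : permComp (Equiv.swap i j) α i = α j := by
    rw [permComp_swap, Equiv.swap_apply_left]
  have hv' : permComp (Equiv.swap i j) α j = α i := by
    rw [permComp_swap, Equiv.swap_apply_right]
  rw [h0, permAct_mono, mul_neg, divDiff_mono_of_le _ hj (by rw [hv, hv']; exact h), hv, hv']
  congr 1
  refine Finset.sum_congr rfl fun t _ => ?_
  congr 1
  funext l
  rcases eq_or_ne l j with rfl | hlj
  · rw [Function.update_self, Function.update_self]
  · rw [Function.update_of_ne hlj, Function.update_of_ne hlj]
    rcases eq_or_ne l i with rfl | hli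
    · rw [Function.update_self, Function.update_self]
    · rw [Function.update_of_ne hli, Function.update_of_ne hli, permComp_swap,
        Equiv.swap_apply_of_ne_of_ne hli hlj]

theorem X_mul_dunklLin_mono (k : ℝ) (i : Fin N) (α : Fin N → ℕ) :
    X i * dunklLin k i (mono α) = (α i : ℝ) • (mono α : Poly N)
      + k • ∑ j ∈ Finset.univ.erase i, X i * divDiff i j (mono α) := by
  have h : (X i : Poly N) * pderiv i (mono α) = (α i : ℝ) • (mono α : Poly N) := by
    have h2 := mono_eq_monomial (Finsupp.equivFunOnFinite.symm α)
    rw [Finsupp.coe_equivFunOnFinite_symm] at h2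
    rw [h2, X_mul_pderiv_monomial, Nat.cast_smul_eq_nsmul]
    rfl
  rw [dunklLin_apply, mul_add, h, mul_smul_comm, Finset.mul_sum]

/-- Unless `α i = α j`, the divided difference is a signed sum of monomials; all but the last have
less spread exponents and lie below `α`. The last is `x^α` or its transpose and combines with the
transposition in `U_i`. -/
theorem cherednik_mono_sub_mem (k : ℝ) (i : Fin N) (α : Fin N → ℕ) :
    cherednik k i (mono α) - kappa k α i • (mono α : Poly N) ∈ monoBelow α := by
  classical
  apply cherednik_sub_mem (X_mul_dunklLin_mono k i α)
  intro j hj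
  rw [permAct_mono]
  rcases lt_trichotomy (α i) (α j) with h | h | h
  · have hT : X i * divDiff i j (mono α) + mono (permComp (Equiv.swap i j) α)
        ∈ monoBelow α := by
      rw [divDiff_mono_of_ge α hj h.le, show α j - α i = (α j - α i - 1) + 1 by omega,
        Finset.sum_range_succ, show α i + 1 + (α j - α i - 1) = α j by omega,
        show α j - 1 - (α j - α i - 1) = α i by omega, update_update_swap α hj,
        neg_add, neg_add_cancel_right]
      refine Submodule.neg_mem _ (Submodule.sum_mem _ fun t ht => ?_)
      rw [Finset.mem_range] at ht
      exact mono_mem_monoBelow (update_update_jackLT α hj (by omega) (by omega))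
    rw [if_neg (show ¬Before α i j by unfold Before; omega), sub_zero]
    split_ifs with hij
    · exact hT
    · have hji : j < i := lt_of_le_of_ne (not_lt.1 hij) hj
      have hs : (mono (permComp (Equiv.swap i j) α) : Poly N) ∈ monoBelow α := by
        rw [Equiv.swap_comm]
        exact mono_mem_monoBelow (swap_jackLT hji h)
      convert Submodule.sub_mem _ hT hs using 1
      ring
  · rw [divDiff_mono_of_le α hj h.ge, h, Nat.sub_self, Finset.sum_range_zero, zero_add,
      permComp_swap_of_eq h]
    by_cases hij : i < j
    · rw [if_pos hij, if_pos (show Before α i j from Or.inr ⟨h, hij⟩), sub_self]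
      exact Submodule.zero_mem _
    · rw [if_neg hij, if_neg (show ¬Before α i j by unfold Before; omega), sub_self]
      exact Submodule.zero_mem _
  · have hT : X i * divDiff i j (mono α) - mono α ∈ monoBelow α := by
      rw [divDiff_mono_of_le α hj h.le, show α i - α j = (α i - α j - 1) + 1 by omega,
        Finset.sum_range_succ, show α j + 1 + (α i - α j - 1) = α i by omega,
        show α i - 1 - (α i - α j - 1) = α j by omega, update_update_self α i j,
        add_sub_cancel_right]
      refine Submodule.sum_mem _ fun t ht => ?_
      rw [Finset.mem_range] at ht
      exact mono_mem_monoBelow (update_update_jackLT α hj (by omega) (by omega))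
    rw [if_pos (show Before α i j from Or.inl h), add_sub_right_comm]
    refine Submodule.add_mem _ hT ?_
    split_ifs with hij
    · exact mono_mem_monoBelow (swap_jackLT hij h)
    · exact Submodule.zero_mem _

/-- The basis of monomials, indexed by compositions. -/
noncomputable def monoBasis (N : ℕ) : Module.Basis (Fin N → ℕ) ℝ (Poly N) :=
  (basisMonomials (Fin N) ℝ).reindex Finsupp.equivFunOnFinite

theorem monoBasis_apply (α : Fin N → ℕ) : monoBasis N α = mono α := by
  have h := mono_eq_monomial (Finsupp.equivFunOnFinite.symm α)
  rw [Finsupp.coe_equivFunOnFinite_symm] at h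
  rw [monoBasis, Module.Basis.reindex_apply, coe_basisMonomials, h]

/-! ### Eigenfunctions of triangular operators -/

theorem repr_eq_zero_of_mem_span {ι V : Type*} [AddCommGroup V] [Module ℝ V]
    (b : Module.Basis ι ℝ V) {P : ι → Prop} {v : V}
    (hv : v ∈ Submodule.span ℝ {q | ∃ β, P β ∧ q = b β}) {m : ι} (hm : ¬P m) : b.repr v m = 0 := by
  classical
  induction hv using Submodule.span_induction with
  | mem x hx =>
    obtain ⟨β, hβ, rfl⟩ := hx
    rw [Module.Basis.repr_self, Finsupp.single_apply, if_neg]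
    rintro rfl
    exact hm hβ
  | zero => simp
  | add x y _ _ hx hy => rw [map_add, Finsupp.add_apply, hx, hy, add_zero]
  | smul a x _ hx => rw [map_smul, Finsupp.smul_apply, hx, smul_zero]

theorem mem_span_of_repr {ι V : Type*} [AddCommGroup V] [Module ℝ V]
    (b : Module.Basis ι ℝ V) {P : ι → Prop} {v : V} (hv : ∀ m, b.repr v m ≠ 0 → P m) :
    v ∈ Submodule.span ℝ {q | ∃ β, P β ∧ q = b β} := by
  rw [← b.linearCombination_repr v, Finsupp.linearCombination_apply, Finsupp.sum]
  refine Submodule.sum_mem _ fun m hm => Submodule.smul_mem _ _ (Submodule.subset_span ?_)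
  exact ⟨m, hv m (Finsupp.mem_support_iff.1 hm), rfl⟩

/-- Let `U i` act triangularly on the basis `b`, with respect to a strict partial order `r`, and
with diagonal entries `κ β i` that separate the indices. Then a joint eigenvector has eigenvalues
`κ α` for some `α` below all other indices that occur in its expansion. -/
theorem exists_leading_of_eigen {ι I V : Type*} [AddCommGroup V] [Module ℝ V]
    (b : Module.Basis ι ℝ V) {r : ι → ι → Prop} (htrans : ∀ {x y z}, r x y → r y z → r x z)
    (hirr : ∀ x, ¬r x x) {U : I → V →ₗ[ℝ] V} {κ : ι → I → ℝ} (hκ : Function.Injective κ)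
    (hU : ∀ i β, U i (b β) - κ β i • b β ∈ Submodule.span ℝ {q | ∃ γ, r β γ ∧ q = b γ})
    {f : V} (hf : f ≠ 0) {c : I → ℝ} (hc : ∀ i, U i f = c i • f) :
    ∃ α, c = κ α ∧ b.repr f α ≠ 0 ∧ ∀ β, b.repr f β ≠ 0 → β = α ∨ r α β := by
  classical
  -- At a minimal index of the support no other term of `f` contributes, so the coefficient there is
  -- just multiplied by `κ m i`.
  have hmin : ∀ m, b.repr f m ≠ 0 → (∀ β, b.repr f β ≠ 0 → ¬r β m) → c = κ m := by
    intro m hm hmm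
    funext i
    have h1 : b.repr (U i f) m = b.repr f m * κ m i := by
      conv_lhs => rw [← b.linearCombination_repr f]
      rw [Finsupp.linearCombination_apply, Finsupp.sum, map_sum, map_sum, Finsupp.finsetSum_apply,
        Finset.sum_eq_single m]
      · rw [map_smul, map_smul, Finsupp.smul_apply, smul_eq_mul]
        have h2 := repr_eq_zero_of_mem_span b (hU i m) (hirr m)
        rw [map_sub, map_smul, Finsupp.sub_apply, Finsupp.smul_apply, Module.Basis.repr_self,
          Finsupp.single_eq_same, smul_eq_mul, mul_one, sub_eq_zero] at h2
        rw [h2]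
      · intro β hβ hne
        have h2 := repr_eq_zero_of_mem_span b (hU i β) (hmm β (Finsupp.mem_support_iff.1 hβ))
        rw [map_sub, map_smul, Finsupp.sub_apply, Finsupp.smul_apply, Module.Basis.repr_self,
          Finsupp.single_eq_of_ne hne.symm, smul_zero, sub_zero] at h2
        rw [map_smul, map_smul, Finsupp.smul_apply, h2, smul_zero]
      · intro h
        exact absurd (Finsupp.mem_support_iff.2 hm) h
    rw [hc, map_smul, Finsupp.smul_apply, smul_eq_mul, mul_comm] at h1
    exact mul_left_cancel₀ hm h1
  -- The support is finite, so a minimal index lies at or below each of its elements.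
  have hex : ∀ β, b.repr f β ≠ 0 → ∃ m, b.repr f m ≠ 0 ∧ (β = m ∨ r m β) ∧
      ∀ γ, b.repr f γ ≠ 0 → ¬r γ m := by
    by_contra hne
    push Not at hne
    obtain ⟨β, hβ, hne⟩ := hne
    have hwf : ∀ (n : ℕ) (m : ι), b.repr f m ≠ 0 → (β = m ∨ r m β) →
        ((b.repr f).support.filter fun γ => r γ m).card = n → False := by
      intro n
      induction n using Nat.strong_induction_on with
      | _ n ih =>
        intro m hm hmβ hn
        obtain ⟨γ, hγ, hγm⟩ := hne m hm hmβ
        refine ih _ ?_ γ hγ (Or.inr ?_) rfl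
        · rw [← hn]
          apply Finset.card_lt_card
          rw [Finset.ssubset_iff_of_subset]
          · refine ⟨γ, ?_, ?_⟩
            · rw [Finset.mem_filter]
              exact ⟨Finsupp.mem_support_iff.2 hγ, hγm⟩
            · rw [Finset.mem_filter]
              exact fun h => hirr γ h.2
          · intro x hx
            rw [Finset.mem_filter] at hx ⊢
            exact ⟨hx.1, htrans hx.2 hγm⟩
        · rcases hmβ with rfl | h
          · exact hγm
          · exact htrans hγm h
    exact hwf _ β hβ (Or.inl rfl) rfl
  have hne : ∃ β, b.repr f β ≠ 0 := by
    by_contra h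
    push Not at h
    apply hf
    rw [← b.repr.map_eq_zero_iff]
    ext β
    exact h β
  obtain ⟨β, hβ⟩ := hne
  obtain ⟨α, hα, -, hαmin⟩ := hex β hβ
  have hcα := hmin α hα hαmin
  refine ⟨α, hcα, hα, fun γ hγ => ?_⟩
  obtain ⟨m, hm, hγm, hmmin⟩ := hex γ hγ
  -- All minimal indices carry the same eigenvalues, hence coincide.
  have hma : m = α := hκ ((hmin m hm hmmin).symm.trans hcα)
  rwa [hma] at hγm

theorem IsEigen.pBasis_leading {k : ℝ} (hk : 0 ≤ k) {c : Fin N → ℝ} {f : Poly N} (hf : f ≠ 0)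
    (h : IsEigen k c f) : ∃ α, c = kappa k α ∧ (pBasis hk).repr f α ≠ 0 ∧
      ∀ β, (pBasis hk).repr f β ≠ 0 → β = α ∨ JackLT α β := by
  refine exists_leading_of_eigen (r := JackLT) (pBasis hk) JackLT.trans JackLT.irrefl
    (fun _ _ e => kappa_injective hk e) (fun i β => ?_) hf h
  simp only [pBasis_apply]
  exact cherednik_pPoly_sub_mem k i β

theorem IsEigen.monoBasis_leading {k : ℝ} (hk : 0 ≤ k) {c : Fin N → ℝ} {f : Poly N} (hf : f ≠ 0)
    (h : IsEigen k c f) : ∃ α, c = kappa k α ∧ (monoBasis N).repr f α ≠ 0 ∧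
      ∀ β, (monoBasis N).repr f β ≠ 0 → β = α ∨ JackLT β α := by
  refine exists_leading_of_eigen (r := fun x y => JackLT y x) (monoBasis N)
    (fun h1 h2 => h2.trans h1) JackLT.irrefl (fun _ _ e => kappa_injective hk e)
    (fun i β => ?_) hf h
  simp only [monoBasis_apply]
  exact cherednik_mono_sub_mem k i β

end DunklJack

namespace DunklJack

open MvPolynomial

variable {N : ℕ}

/-! ### Existence of eigenfunctions -/

/-- If `a = k / (κ_i - κ_j)` and `s f = a f`, then `s² = 1` would force `a² = 1`, against `|a| < 1`.
-/
theorem IsEigen.exists_swap {k : ℝ} (hk : 0 ≤ k) {α : Fin N → ℕ} {f : Poly N} (hf : f ≠ 0)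
    (h : IsEigen k (kappa k α) f) {i j : Fin N} (hij : (j : ℕ) = i + 1) (hα : α i ≠ α j) :
    ∃ a : ℝ, permAct (Equiv.swap i j) f - a • f ≠ 0 ∧
      IsEigen k (kappa k (permComp (Equiv.swap i j) α))
        (permAct (Equiv.swap i j) f - a • f) := by
  have hgt := abs_kappa_sub_gt hk hα
  have hd : kappa k α i - kappa k α j ≠ 0 := fun e => by
    rw [e, abs_zero] at hgt
    exact absurd hk (not_le.2 hgt)
  have ha : (kappa k α i - kappa k α j) * (k / (kappa k α i - kappa k α j)) = k := by
    field_simp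
  refine ⟨k / (kappa k α i - kappa k α j), fun e => ?_, ?_⟩
  · rw [sub_eq_zero] at e
    have e2 := congrArg (permAct (Equiv.swap i j)) e
    rw [permAct_swap_swap, map_smul, e, smul_smul] at e2
    have e3 : (1 : ℝ) = k / (kappa k α i - kappa k α j) * (k / (kappa k α i - kappa k α j)) := by
      refine smul_left_injective ℝ hf ?_
      change (1 : ℝ) • f = _ • f
      rwa [one_smul]
    have e4 : (kappa k α i - kappa k α j) ^ 2 = k ^ 2 := by
      field_simp at e3
      linarith
    rw [← sq_abs] at e4
    nlinarith [abs_nonneg (kappa k α i - kappa k α j)]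
  · rw [show kappa k (permComp (Equiv.swap i j) α) = fun l => kappa k α (Equiv.swap i j l) from
      funext (kappa_swap k hij hα)]
    exact h.swap hij ha

/-- The invariant submodule `M` is carried along so that the intertwiners can also be run inside the
span of the `ω_β`, where `ζ_α` must lie. -/
theorem exists_eigen_permComp {k : ℝ} (hk : 0 ≤ k) {M : Submodule ℝ (Poly N)}
    (hM : ∀ w : Equiv.Perm (Fin N), ∀ f ∈ M, permAct w f ∈ M) {α : Fin N → ℕ}
    (h : ∃ f ∈ M, f ≠ 0 ∧ IsEigen k (kappa k α) f) (w : Equiv.Perm (Fin N)) :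
    ∃ f ∈ M, f ≠ 0 ∧ IsEigen k (kappa k (permComp w α)) f := by
  refine perm_induction_of_antitone (f := fun _ : Fin N => ()) (fun _ _ _ => le_rfl)
    (P := fun w => ∃ f ∈ M, f ≠ 0 ∧ IsEigen k (kappa k (permComp w α)) f) ?_ ?_ w (fun _ => rfl)
  · rwa [permComp_one]
  · rintro i j v hij - - ⟨f, hfM, hf, hE⟩
    rw [permComp_mul]
    by_cases hv : permComp v α i = permComp v α j
    · rw [permComp_swap_of_eq hv]
      exact ⟨f, hfM, hf, hE⟩
    · obtain ⟨a, ha, hE2⟩ := hE.exists_swap hk hf hij hv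
      exact ⟨_, M.sub_mem (hM _ f hfM) (M.smul_mem a hfM), ha, hE2⟩

theorem eq_zero_of_size_eq_zero {α : Fin N → ℕ} (h : size α = 0) : α = 0 := by
  funext i
  exact (Finset.sum_eq_zero_iff.1 h) i (Finset.mem_univ i)

theorem isEigen_one (k : ℝ) : IsEigen k (kappa k (0 : Fin N → ℕ)) (1 : Poly N) := by
  intro i
  have h := cherednik_mono_sub_mem k i (0 : Fin N → ℕ)
  have h1 : (mono 0 : Poly N) = 1 := by simp [mono]
  have h2 : (monoBelow 0 : Submodule ℝ (Poly N)) = ⊥ := by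
    rw [monoBelow, Submodule.span_eq_bot]
    rintro q ⟨β, hβ, -⟩
    have h3 : β = 0 := eq_zero_of_size_eq_zero (hβ.1.trans (by simp [size]))
    rw [h3] at hβ
    exact absurd hβ (JackLT.irrefl 0)
  rwa [h2, Submodule.mem_bot, h1, sub_eq_zero] at h

/-- Induction on the degree: an intertwiner chain brings a positive part to the last place, where
the index is the image under `rotComp` of one of smaller degree; a second use of the same
transposition restores `α`. -/
theorem exists_eigen {k : ℝ} (hk : 0 ≤ k) (α : Fin N → ℕ) :
    ∃ f : Poly N, f ≠ 0 ∧ IsEigen k (kappa k α) f := by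
  induction hn : size α generalizing α with
  | zero =>
    rw [eq_zero_of_size_eq_zero hn]
    exact ⟨1, one_ne_zero, isEigen_one k⟩
  | succ n ih =>
    rcases N with _ | N
    · simp [size] at hn
    · obtain ⟨i, hi⟩ : ∃ i, 0 < α i := by
        by_contra h
        push Not at h
        rw [size, Finset.sum_eq_zero fun i _ => Nat.le_zero.1 (h i)] at hn
        omega
      set w := Equiv.swap i (Fin.last N) with hw
      set α' := permComp w α with hα'
      have hlast : 0 < α' (Fin.last N) := by
        rw [hα', hw, permComp_swap, Equiv.swap_apply_right]
        exact hi
      -- The preimage under `rotComp`; positivity of the last part of `α'` makes the truncated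
      -- subtraction exact.
      set β : Fin (N + 1) → ℕ := fun l => α' ((finRotate (N + 1)).symm l)
        - if (finRotate (N + 1)).symm l = Fin.last N then 1 else 0 with hβ
      have hrot : rotComp β = α' := by
        funext l
        rw [rotComp, hβ]
        simp only [Equiv.symm_apply_apply]
        split_ifs with h
        · subst h
          omega
        · simp
      have hsize : size β = n := by
        have h1 : size α' = n + 1 := by rw [hα', size_permComp, hn]
        have h2 : size (rotComp β) = size β + 1 := by
          simp only [size, rotComp, Finset.sum_add_distrib, Finset.sum_ite_eq', Finset.mem_univ,
            if_true]
          rw [Equiv.sum_comp (finRotate (N + 1)) β]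
        rw [hrot, h1] at h2
        omega
      obtain ⟨f, hf, hE⟩ := ih β hsize
      have hf2 : affineRaise f ≠ 0 := by
        refine mul_ne_zero (X_ne_zero _) ?_
        intro e
        apply hf
        exact rename_injective _ (Equiv.injective _) (e.trans (map_zero _).symm)
      have hE2 := hE.affineRaise
      rw [hrot] at hE2
      obtain ⟨g, -, hg, hEg⟩ := exists_eigen_permComp hk (M := ⊤) (fun _ _ _ => trivial)
        ⟨_, trivial, hf2, hE2⟩ w
      refine ⟨g, hg, ?_⟩
      rwa [hα', ← permComp_mul, hw, Equiv.swap_mul_self, permComp_one] at hEg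

/-! ### The polynomials `E_λ`, `ω_α` and `ζ_α` -/

theorem isMonicJack_iff {k : ℝ} (hk : 0 ≤ k) (α : Fin N → ℕ) (f : Poly N) :
    IsMonicJack k α f ↔ (∃ c, IsEigen k c f) ∧ f - mono α ∈ monoBelow α := by
  have hset : {q : Poly N | ∃ β : Fin N → ℕ, size β = size α ∧
      (StrictDom (plus α) (plus β) ∨ (plus β = plus α ∧ StrictDom α β)) ∧ q = mono β}
      = {q | ∃ β, JackLT β α ∧ q = mono β} := by
    ext q
    simp only [JackLT, and_assoc]
  unfold IsMonicJack IsEigen monoBelow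
  rw [hset]
  simp only [opU_eq hk]
  exact and_congr_left fun _ => Classical.skolem

theorem isMonicJack_monicJack {k : ℝ} (hk : 0 ≤ k) (α : Fin N → ℕ) :
    IsMonicJack k α (monicJack k α) := by
  have hex : ∃ f, IsMonicJack k α f := by
    obtain ⟨f, hf, hE⟩ := exists_eigen hk α
    obtain ⟨γ, hγ, hne, hsupp⟩ := hE.monoBasis_leading hk hf
    obtain rfl := kappa_injective hk hγ
    refine ⟨((monoBasis N).repr f α)⁻¹ • f, (isMonicJack_iff hk α _).2 ⟨⟨_, hE.smul _⟩, ?_⟩⟩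
    unfold monoBelow
    simp only [← monoBasis_apply]
    refine mem_span_of_repr (P := fun β => JackLT β α) (monoBasis N) fun m hm => ?_
    rw [map_sub, map_smul, Finsupp.sub_apply, Finsupp.smul_apply, Module.Basis.repr_self] at hm
    rcases eq_or_ne m α with rfl | hmα
    · rw [smul_eq_mul, inv_mul_cancel₀ hne, Finsupp.single_eq_same, sub_self] at hm
      exact absurd rfl hm
    · rw [Finsupp.single_eq_of_ne hmα, sub_zero] at hm
      exact (hsupp m (right_ne_zero_of_smul hm)).resolve_left hmα
  exact Classical.epsilon_spec hex

/-- The definition leaves the eigenvalues open. A leading index other than `α` would be above `α` by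
leadership and below `α` by the triangular form. -/
theorem IsMonicJack.isEigen_and_ne_zero {k : ℝ} (hk : 0 ≤ k) {α : Fin N → ℕ} {f : Poly N}
    (h : IsMonicJack k α f) : IsEigen k (kappa k α) f ∧ f ≠ 0 := by
  obtain ⟨⟨c, hE⟩, hspan⟩ := (isMonicJack_iff hk α f).1 h
  unfold monoBelow at hspan
  simp only [← monoBasis_apply] at hspan
  have h1 : (monoBasis N).repr f α = 1 := by
    have h2 := repr_eq_zero_of_mem_span (P := fun β => JackLT β α) (monoBasis N) hspan
      (JackLT.irrefl α)
    rwa [map_sub, Finsupp.sub_apply, Module.Basis.repr_self, Finsupp.single_eq_same,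
      sub_eq_zero] at h2
  have hf : f ≠ 0 := by
    rintro rfl
    simp at h1
  obtain ⟨γ, hγ, hne, hsupp⟩ := hE.monoBasis_leading hk hf
  have hαγ : α = γ := by
    by_contra hcon
    have h3 := (hsupp α (by rw [h1]; exact one_ne_zero)).resolve_left hcon
    have h4 : JackLT γ α := by
      by_contra h5
      have h6 := repr_eq_zero_of_mem_span (P := fun β => JackLT β α) (monoBasis N) hspan h5
      rw [map_sub, Finsupp.sub_apply, Module.Basis.repr_self,
        Finsupp.single_eq_of_ne (Ne.symm hcon), sub_zero] at h6
      exact hne h6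
    exact JackLT.irrefl _ (h3.trans h4)
  rw [hαγ, ← hγ]
  exact ⟨hE, hf⟩

theorem omegaPart_spec {k : ℝ} (hk : 0 ≤ k) {lam : Fin N → ℕ} (hlam : plus lam = lam) :
    (∃ c : ℝ, omegaPart k lam = c • monicJack k lam) ∧
    omegaPart k lam - pPoly k lam ∈ Submodule.span ℝ
      {q : Poly N | ∃ β : Fin N → ℕ, size β = size lam ∧ StrictDom (plus β) lam ∧ q = pPoly k β} := by
  have hex : ∃ f : Poly N, (∃ c : ℝ, f = c • monicJack k lam) ∧
      f - pPoly k lam ∈ Submodule.span ℝ {q : Poly N | ∃ β : Fin N → ℕ,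
        size β = size lam ∧ StrictDom (plus β) lam ∧ q = pPoly k β} := by
    obtain ⟨hE, hf⟩ := (isMonicJack_monicJack hk lam).isEigen_and_ne_zero hk
    obtain ⟨γ, hγ, hne, hsupp⟩ := hE.pBasis_leading hk hf
    obtain rfl := kappa_injective hk hγ
    refine ⟨((pBasis hk).repr (monicJack k lam) lam)⁻¹ • monicJack k lam, ⟨_, rfl⟩, ?_⟩
    simp only [← and_assoc, ← pBasis_apply hk]
    refine mem_span_of_repr (P := fun β => size β = size lam ∧ StrictDom (plus β) lam)
      (pBasis hk) fun m hm => ?_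
    rw [map_sub, map_smul, Finsupp.sub_apply, Finsupp.smul_apply, Module.Basis.repr_self] at hm
    rcases eq_or_ne m lam with rfl | hmα
    · rw [smul_eq_mul, inv_mul_cancel₀ hne, Finsupp.single_eq_same, sub_self] at hm
      exact absurd rfl hm
    · rw [Finsupp.single_eq_of_ne hmα, sub_zero] at hm
      obtain ⟨hs, hd | ⟨he, hd⟩⟩ := (hsupp m (right_ne_zero_of_smul hm)).resolve_left hmα
      · rw [hlam] at hd
        exact ⟨hs.symm, hd⟩
      -- A partition dominates all its rearrangements, so none of them lies strictly above it.
      · exfalso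
        apply hd.2
        refine sum_Iic_of_forall_eq fun j => le_antisymm ?_ (hd.1 j)
        have h1 := sum_le_sum_Iic_plus m j (S := Finset.Iic j) rfl
        rwa [← he, hlam] at h1
  exact Classical.epsilon_spec hex

theorem repr_omegaPart {k : ℝ} (hk : 0 ≤ k) {lam : Fin N → ℕ} (hlam : plus lam = lam)
    {β : Fin N → ℕ} (hβ : plus β = lam) :
    (pBasis hk).repr (omegaPart k lam) β = if β = lam then 1 else 0 := by
  have h := (omegaPart_spec hk hlam).2
  simp only [← and_assoc, ← pBasis_apply hk] at h
  have h2 := repr_eq_zero_of_mem_span (P := fun β => size β = size lam ∧ StrictDom (plus β) lam)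
    (pBasis hk) h (m := β) (by rw [hβ]; exact fun h => h.2.2 rfl)
  rw [map_sub, Finsupp.sub_apply, Module.Basis.repr_self, sub_eq_zero] at h2
  rw [h2]
  split_ifs with h3
  · rw [h3, Finsupp.single_eq_same]
  · exact Finsupp.single_eq_of_ne h3

theorem isEigen_omegaPart {k : ℝ} (hk : 0 ≤ k) {lam : Fin N → ℕ} (hlam : plus lam = lam) :
    IsEigen k (kappa k lam) (omegaPart k lam) := by
  obtain ⟨c, hc⟩ := (omegaPart_spec hk hlam).1
  rw [hc]
  exact ((isMonicJack_monicJack hk lam).isEigen_and_ne_zero hk).1.smul c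

theorem permComp_injective (w : Equiv.Perm (Fin N)) :
    Function.Injective (permComp w : (Fin N → ℕ) → Fin N → ℕ) := by
  intro α β h
  funext i
  rw [← permComp_apply w α, h, permComp_apply]

theorem repr_permAct {k : ℝ} (hk : 0 ≤ k) (w : Equiv.Perm (Fin N)) (f : Poly N)
    (β : Fin N → ℕ) :
    (pBasis hk).repr (permAct w f) (permComp w β) = (pBasis hk).repr f β := by
  classical
  have h : (pBasis hk).coord (permComp w β) ∘ₗ (permAct w).toLinearMap = (pBasis hk).coord β := by
    refine (pBasis hk).ext fun γ => ?_
    rw [LinearMap.comp_apply, AlgHom.toLinearMap_apply, pBasis_apply, permAct_pPoly,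
      ← pBasis_apply hk, ← pBasis_apply hk, Module.Basis.coord_apply, Module.Basis.coord_apply,
      Module.Basis.repr_self, Module.Basis.repr_self, Finsupp.single_apply, Finsupp.single_apply]
    simp only [(permComp_injective w).eq_iff]
  exact LinearMap.congr_fun h f

/-- With `a = 1` the difference `s f - f` is a joint eigenfunction, and if non-zero its leading
index has to be `α`. But its coefficient at `p_α` vanishes, because `s` fixes `α`. -/
theorem IsEigen.permAct_swap_eq {k : ℝ} (hk : 0 ≤ k) {α : Fin N → ℕ} {f : Poly N}
    (h : IsEigen k (kappa k α) f) {i j : Fin N} (hij : (j : ℕ) = i + 1) (hα : α i = α j) :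
    permAct (Equiv.swap i j) f = f := by
  have h1 := h.swap hij (a := 1) (by rw [kappa_of_adjacent_eq k hij hα]; ring)
  rw [one_smul] at h1
  by_contra hne
  obtain ⟨β, hβ, hr, -⟩ := h1.pBasis_leading hk (sub_ne_zero.2 hne)
  have h2 : β = α := by
    funext l
    rw [eq_of_kappa_eq hk (α := α) (β := β) (w := Equiv.swap i j) (fun m => (congrFun hβ m).symm) l,
      ← permComp_swap i j α l, permComp_swap_of_eq hα]
  apply hr
  have h3 := repr_permAct hk (Equiv.swap i j) f α
  rw [permComp_swap_of_eq hα] at h3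
  rw [h2, map_sub, Finsupp.sub_apply, h3, sub_self]

theorem permAct_omegaPart_of_stabilizes {k : ℝ} (hk : 0 ≤ k) {lam : Fin N → ℕ}
    (hlam : plus lam = lam) (w : Equiv.Perm (Fin N)) (hw : ∀ x, lam (w x) = lam x) :
    permAct w (omegaPart k lam) = omegaPart k lam := by
  refine perm_induction_of_antitone (f := lam) (hlam ▸ plus_antitone lam)
    (P := fun w => permAct w (omegaPart k lam) = omegaPart k lam) (permAct_one _) ?_ w hw
  intro i j v hij he _ hP
  rw [permAct_mul, hP, (isEigen_omegaPart hk hlam).permAct_swap_eq hk hij he]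

/-- Two permutations that send `λ` to the same composition differ by an element of its stabilizer,
which fixes `ω_λ`. This is the well-definedness of `ω_{wλ}`. -/
theorem permAct_omegaPart {k : ℝ} (hk : 0 ≤ k) {lam : Fin N → ℕ} (hlam : plus lam = lam)
    (w : Equiv.Perm (Fin N)) :
    permAct w (omegaPart k lam) = omega k (permComp w lam) := by
  have h1 : plus (permComp w lam) = lam := by rw [plus_permComp, hlam]
  have h2 := permComp_sortPerm_plus (permComp w lam)
  rw [h1] at h2
  rw [omega, h1]
  set v := sortPerm (permComp w lam)
  have h3 : w = v * (v⁻¹ * w) := by group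
  rw [h3, permAct_mul, permAct_omegaPart_of_stabilizes hk hlam]
  intro x
  have h4 : permComp (v⁻¹ * w) lam = lam := by
    rw [permComp_mul, ← h2, ← permComp_mul]
    simp [permComp_one]
  conv_lhs => rw [← h4]
  rw [permComp_apply]

theorem permAct_omega {k : ℝ} (hk : 0 ≤ k) (w : Equiv.Perm (Fin N)) (α : Fin N → ℕ) :
    permAct w (omega k α) = omega k (permComp w α) := by
  rw [omega, ← permAct_mul, permAct_omegaPart hk (plus_plus α), permComp_mul,
    permComp_sortPerm_plus]

theorem repr_omega {k : ℝ} (hk : 0 ≤ k) {α β : Fin N → ℕ} (h : plus β = plus α) :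
    (pBasis hk).repr (omega k α) β = if β = α then 1 else 0 := by
  have h1 : β = permComp (sortPerm α) (permComp (sortPerm α)⁻¹ β) := by
    rw [← permComp_mul, mul_inv_cancel, permComp_one]
  have h2 : β = α ↔ permComp (sortPerm α)⁻¹ β = plus α := by
    constructor
    · intro e
      apply permComp_injective (sortPerm α)
      rw [← h1, permComp_sortPerm_plus, e]
    · intro e
      rw [h1, e, permComp_sortPerm_plus]
  rw [omega, h1, repr_permAct, repr_omegaPart hk (plus_plus α) (by rw [plus_permComp, h]), ← h1]
  simp only [h2]

/-- The span of the orbit of `ω_λ`. -/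
noncomputable def omegaSpan (k : ℝ) (lam : Fin N → ℕ) : Submodule ℝ (Poly N) :=
  Submodule.span ℝ {q | ∃ β : Fin N → ℕ, plus β = lam ∧ q = omega k β}

theorem permAct_mem_omegaSpan {k : ℝ} (hk : 0 ≤ k) (lam : Fin N → ℕ) (w : Equiv.Perm (Fin N))
    (f : Poly N) (hf : f ∈ omegaSpan k lam) : permAct w f ∈ omegaSpan k lam := by
  induction hf using Submodule.span_induction with
  | mem x hx =>
    obtain ⟨β, hβ, rfl⟩ := hx
    exact Submodule.subset_span ⟨permComp w β, by rw [plus_permComp, hβ], permAct_omega hk w β⟩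
  | zero => rw [map_zero]; exact Submodule.zero_mem _
  | add x y _ _ hx hy => rw [map_add]; exact Submodule.add_mem _ hx hy
  | smul a x _ hx => rw [map_smul]; exact Submodule.smul_mem _ a hx

-- By `repr_omega`, the coefficients at the `p_β` in the orbit of `λ` are coordinates dual to the
-- `ω_β`.
open Classical in
theorem eq_sum_of_mem_omegaSpan {k : ℝ} (hk : 0 ≤ k) (α : Fin N → ℕ) {f : Poly N}
    (hf : f ∈ omegaSpan k (plus α)) :
    f = ∑ β ∈ Finset.univ.image fun w => permComp w (plus α),
      (pBasis hk).repr f β • omega k β := by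
  have hplus : ∀ β ∈ Finset.univ.image fun w => permComp w (plus α), plus β = plus α := by
    intro β hβ
    rw [Finset.mem_image] at hβ
    obtain ⟨w, -, rfl⟩ := hβ
    rw [plus_permComp, plus_plus]
  induction hf using Submodule.span_induction with
  | mem x hx =>
    obtain ⟨β, hβ, rfl⟩ := hx
    rw [Finset.sum_eq_single β]
    · rw [repr_omega hk rfl, if_pos rfl, one_smul]
    · intro γ hγ hne
      rw [repr_omega hk ((hplus γ hγ).trans hβ.symm), if_neg hne, zero_smul]
    · intro hn
      exfalso
      apply hn
      rw [Finset.mem_image]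
      exact ⟨sortPerm β, Finset.mem_univ _, by rw [← hβ, permComp_sortPerm_plus]⟩
  | zero => simp
  | add x y _ _ hx hy =>
    simp only [map_add, Finsupp.add_apply, add_smul, Finset.sum_add_distrib]
    rw [← hx, ← hy]
  | smul a x _ hx =>
    simp only [map_smul, Finsupp.smul_apply, smul_assoc, ← Finset.smul_sum]
    rw [← hx]

/-- Intertwiners applied to `ω_λ` reach the index `α` without leaving the span of the orbit.
Triangularity in the `p_β` then becomes triangularity in the `ω_β`, and within one orbit `JackLT`
reduces to dominance. -/
theorem isZeta_zeta {k : ℝ} (hk : 0 ≤ k) (α : Fin N → ℕ) : IsZeta k α (zeta k α) := by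
  classical
  have hex : ∃ f, IsZeta k α f := by
    have h0 : omega k (plus α) = omegaPart k (plus α) := by
      have := permAct_omegaPart hk (plus_plus α) 1
      rwa [permAct_one, permComp_one, eq_comm] at this
    have hne0 : omegaPart k (plus α) ≠ 0 := by
      intro e
      have h1 := repr_omegaPart hk (plus_plus α) (plus_plus α)
      rw [e, if_pos rfl] at h1
      simp at h1
    obtain ⟨f, hfM, hf, hE⟩ := exists_eigen_permComp hk (permAct_mem_omegaSpan hk (plus α))
      ⟨omegaPart k (plus α), Submodule.subset_span ⟨plus α, plus_plus α, h0.symm⟩, hne0,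
        isEigen_omegaPart hk (plus_plus α)⟩ (sortPerm α)
    rw [permComp_sortPerm_plus] at hE
    obtain ⟨γ, hγ, hne, hsupp⟩ := hE.pBasis_leading hk hf
    obtain rfl := kappa_injective hk hγ
    refine ⟨((pBasis hk).repr f α)⁻¹ • f, fun i => ?_, ?_⟩
    · rw [opU_eq hk]
      exact hE.smul _ i
    · have hmem : α ∈ Finset.univ.image fun w => permComp w (plus α) := by
        rw [Finset.mem_image]
        exact ⟨sortPerm α, Finset.mem_univ _, permComp_sortPerm_plus α⟩
      have h1 := eq_sum_of_mem_omegaSpan hk α hfM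
      rw [← Finset.add_sum_erase _ _ hmem] at h1
      have h2 : ((pBasis hk).repr f α)⁻¹ • f - omega k α = ((pBasis hk).repr f α)⁻¹ •
          ∑ β ∈ (Finset.univ.image fun w => permComp w (plus α)).erase α,
            (pBasis hk).repr f β • omega k β := by
        rw [← sub_eq_iff_eq_add'] at h1
        rw [← h1, smul_sub, smul_smul, inv_mul_cancel₀ hne, one_smul]
      rw [h2]
      refine Submodule.smul_mem _ _ (Submodule.sum_mem _ fun β hβ => ?_)
      rw [Finset.mem_erase, Finset.mem_image] at hβ
      obtain ⟨hβα, w, -, rfl⟩ := hβ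
      have hplus : plus (permComp w (plus α)) = plus α := by rw [plus_permComp, plus_plus]
      by_cases hr : (pBasis hk).repr f (permComp w (plus α)) = 0
      · rw [hr, zero_smul]
        exact Submodule.zero_mem _
      · refine Submodule.smul_mem _ _ (Submodule.subset_span ⟨_, hplus, ?_, rfl⟩)
        obtain ⟨-, hd | ⟨-, hd⟩⟩ := (hsupp _ hr).resolve_left hβα
        · rw [hplus] at hd
          exact absurd rfl hd.2
        · exact hd
  exact Classical.epsilon_spec hex

theorem isEigen_zeta {k : ℝ} (hk : 0 ≤ k) (α : Fin N → ℕ) :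
    IsEigen k (kappa k α) (zeta k α) := fun i => by
  rw [← opU_eq hk, (isZeta_zeta hk α).1 i]

theorem repr_zeta_self {k : ℝ} (hk : 0 ≤ k) (α : Fin N → ℕ) :
    (pBasis hk).repr (zeta k α) α = 1 := by
  have h : ∀ f ∈ Submodule.span ℝ {q : Poly N | ∃ β : Fin N → ℕ, plus β = plus α ∧
      StrictDom β α ∧ q = omega k β}, (pBasis hk).repr f α = 0 := by
    intro f hf
    induction hf using Submodule.span_induction with
    | mem x hx =>
      obtain ⟨β, hβ, hd, rfl⟩ := hx
      rw [repr_omega hk hβ.symm, if_neg (Ne.symm hd.2)]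
    | zero => simp
    | add x y _ _ hx hy => rw [map_add, Finsupp.add_apply, hx, hy, add_zero]
    | smul a x _ hx => rw [map_smul, Finsupp.smul_apply, hx, smul_zero]
  have h1 := h _ (isZeta_zeta hk α).2
  rwa [map_sub, Finsupp.sub_apply, repr_omega hk rfl, if_pos rfl, sub_eq_zero] at h1

theorem zeta_ne_zero {k : ℝ} (hk : 0 ≤ k) (α : Fin N → ℕ) : zeta k α ≠ 0 := by
  intro e
  have h := repr_zeta_self hk α
  rw [e] at h
  simp at h

/-- Subtracting the right multiple of `ζ_α` removes the leading coefficient, which no non-zero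
eigenfunction with these eigenvalues can lack. -/
theorem IsEigen.eq_smul_zeta {k : ℝ} (hk : 0 ≤ k) {α : Fin N → ℕ} {f : Poly N}
    (h : IsEigen k (kappa k α) f) : f = (pBasis hk).repr f α • zeta k α := by
  by_contra hne
  obtain ⟨γ, hγ, hr, -⟩ :=
    (h.sub ((isEigen_zeta hk α).smul ((pBasis hk).repr f α))).pBasis_leading hk
      (sub_ne_zero.2 hne)
  obtain rfl := kappa_injective hk hγ
  apply hr
  rw [map_sub, map_smul, Finsupp.sub_apply, Finsupp.smul_apply, repr_zeta_self, smul_eq_mul,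
    mul_one, sub_self]

theorem exists_permAct_swap_zeta {k : ℝ} (hk : 0 ≤ k) (γ : Fin N → ℕ) {i j : Fin N}
    (hij : (j : ℕ) = i + 1) :
    ∃ a b : ℝ, permAct (Equiv.swap i j) (zeta k γ)
      = a • zeta k γ + b • zeta k (permComp (Equiv.swap i j) γ) := by
  by_cases hγ : γ i = γ j
  · refine ⟨1, 0, ?_⟩
    rw [(isEigen_zeta hk γ).permAct_swap_eq hk hij hγ, one_smul, zero_smul, add_zero]
  · obtain ⟨a, -, hE⟩ := (isEigen_zeta hk γ).exists_swap hk (zeta_ne_zero hk γ) hij hγ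
    refine ⟨a, (pBasis hk).repr (permAct (Equiv.swap i j) (zeta k γ) - a • zeta k γ)
      (permComp (Equiv.swap i j) γ), ?_⟩
    rw [← hE.eq_smul_zeta hk, add_sub_cancel]

end DunklJack

namespace DunklJack

open MvPolynomial

variable {N : ℕ}

/-! ### Parity and the type B raising operators -/

/-- `x_A = ∏_{i ∈ A} x_i`. -/
noncomputable def xProd (A : Finset (Fin N)) : Poly N := ∏ i ∈ A, X i

/-- The positions of the odd entries. -/
def oddSet (α : Fin N → ℕ) : Finset (Fin N) := Finset.univ.filter fun i => Odd (α i)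

/-- The composition with half `β` and odd entries at `B`. -/
def interleave (B : Finset (Fin N)) (β : Fin N → ℕ) : Fin N → ℕ :=
  fun i => 2 * β i + if i ∈ B then 1 else 0

theorem oddSet_interleave (B : Finset (Fin N)) (β : Fin N → ℕ) :
    oddSet (interleave B β) = B := by
  ext i
  rw [oddSet, Finset.mem_filter, interleave, Nat.odd_iff]
  by_cases h : i ∈ B
  · simp only [h, Finset.mem_univ, if_true, true_and, iff_true]
    omega
  · simp only [h, Finset.mem_univ, if_false, true_and, iff_false]
    omega

theorem half_interleave (B : Finset (Fin N)) (β : Fin N → ℕ) : half (interleave B β) = β := by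
  funext i
  rw [half, interleave]
  split_ifs <;> omega

theorem pHat_eq (k : ℝ) (α : Fin N → ℕ) :
    pHat k α = xProd (oddSet α) * expand 2 (pPoly k (half α)) := rfl

theorem mono_interleave (B : Finset (Fin N)) (β : Fin N → ℕ) :
    (mono (interleave B β) : Poly N) = xProd B * expand 2 (mono β) := by
  have h : xProd B = ∏ i : Fin N, if i ∈ B then (X i : Poly N) else 1 := by
    rw [Finset.prod_ite_mem, Finset.univ_inter, xProd]
  rw [h, mono, mono, map_prod, ← Finset.prod_mul_distrib]
  refine Finset.prod_congr rfl fun i _ => ?_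
  rw [map_pow, expand_X, ← pow_mul, interleave]
  split_ifs <;> ring

/-- The component `g` in the decomposition `f = ∑_A x_A g_A(x²)`. -/
noncomputable def parityPart (A : Finset (Fin N)) : Poly N →ₗ[ℝ] Poly N :=
  (monoBasis N).constr ℝ fun α => if oddSet α = A then mono (half α) else 0

theorem parityPart_xProd_mul (A B : Finset (Fin N)) (g : Poly N) :
    parityPart A (xProd B * expand 2 g) = if B = A then g else 0 := by
  have h : parityPart A ∘ₗ LinearMap.mulLeft ℝ (xProd B) ∘ₗ (expand 2).toLinearMap
      = if B = A then LinearMap.id else 0 := by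
    refine (monoBasis N).ext fun β => ?_
    rw [monoBasis_apply, LinearMap.comp_apply, LinearMap.comp_apply, LinearMap.mulLeft_apply,
      AlgHom.toLinearMap_apply, ← mono_interleave, ← monoBasis_apply, parityPart,
      Module.Basis.constr_basis, oddSet_interleave, half_interleave]
    split_ifs <;> rfl
  have h2 := LinearMap.congr_fun h g
  rw [LinearMap.comp_apply, LinearMap.comp_apply, LinearMap.mulLeft_apply,
    AlgHom.toLinearMap_apply] at h2
  rw [h2]
  split_ifs <;> rfl

theorem raiseHat_pHat {k : ℝ} (hk : 0 ≤ k) (i : Fin N) (α : Fin N → ℕ) :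
    raiseHat k i (pHat k α) = pHat k (α + Pi.single i 1) := by
  have hex : ∃ R : Module.End ℝ (Poly N),
      ∀ α : Fin N → ℕ, R (pHat k α) = pHat k (α + Pi.single i 1) := by
    -- An explicit operator on parity components: raising an odd part removes `x_i` and raises the
    -- half index, while raising an even part only inserts `x_i`.
    refine ⟨∑ A : Finset (Fin N), if i ∈ A
        then LinearMap.mulLeft ℝ (xProd (A.erase i)) ∘ₗ (expand 2).toLinearMap ∘ₗ raise k i
          ∘ₗ parityPart A
        else LinearMap.mulLeft ℝ (xProd (insert i A)) ∘ₗ (expand 2).toLinearMap ∘ₗ parityPart A,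
      fun α => ?_⟩
    rw [LinearMap.sum_apply, Finset.sum_eq_single (oddSet α)]
    · have hodd : i ∈ oddSet α ↔ Odd (α i) := by simp [oddSet]
      split_ifs with h
      · simp only [LinearMap.comp_apply, LinearMap.mulLeft_apply, AlgHom.toLinearMap_apply]
        rw [pHat_eq, parityPart_xProd_mul, if_pos rfl, raise_pPoly hk, pHat_eq]
        rw [hodd, Nat.odd_iff] at h
        congr 2
        · ext l
          rw [oddSet, oddSet, Finset.mem_erase, Finset.mem_filter, Finset.mem_filter, Pi.add_apply,
            Nat.odd_iff, Nat.odd_iff]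
          rcases eq_or_ne l i with rfl | hl
          · rw [Pi.single_eq_same]
            simp only [ne_eq, not_true_eq_false, false_and, Finset.mem_univ, true_and, false_iff]
            omega
          · rw [Pi.single_eq_of_ne hl]
            simp [hl]
        · congr 1
          funext l
          rw [Pi.add_apply, half, half, Pi.add_apply]
          rcases eq_or_ne l i with rfl | hl
          · rw [Pi.single_eq_same]
            omega
          · rw [Pi.single_eq_of_ne hl, add_zero, add_zero]
      · simp only [LinearMap.comp_apply, LinearMap.mulLeft_apply, AlgHom.toLinearMap_apply]
        rw [pHat_eq, parityPart_xProd_mul, if_pos rfl, pHat_eq]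
        rw [hodd, Nat.odd_iff] at h
        congr 2
        · ext l
          rw [oddSet, oddSet, Finset.mem_insert, Finset.mem_filter, Finset.mem_filter,
            Pi.add_apply, Nat.odd_iff, Nat.odd_iff]
          rcases eq_or_ne l i with rfl | hl
          · rw [Pi.single_eq_same]
            simp only [true_or, Finset.mem_univ, true_and, true_iff]
            omega
          · rw [Pi.single_eq_of_ne hl]
            simp [hl]
        · congr 1
          funext l
          rw [half, half, Pi.add_apply]
          rcases eq_or_ne l i with rfl | hl
          · rw [Pi.single_eq_same]
            omega
          · rw [Pi.single_eq_of_ne hl, add_zero]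
    · intro A _ hA
      have h0 : parityPart A (pHat k α) = 0 := by
        rw [pHat_eq, parityPart_xProd_mul, if_neg (Ne.symm hA)]
      split_ifs <;> simp [h0]
    · simp
  exact Classical.epsilon_spec hex α

theorem raiseHat_of_mem {k : ℝ} (hk : 0 ≤ k) {i : Fin N} {A : Finset (Fin N)} (hi : i ∈ A)
    (g : Poly N) :
    raiseHat k i (xProd A * expand 2 g) = xProd (A.erase i) * expand 2 (raise k i g) := by
  have h : raiseHat k i ∘ₗ LinearMap.mulLeft ℝ (xProd A) ∘ₗ (expand 2).toLinearMap
      = LinearMap.mulLeft ℝ (xProd (A.erase i)) ∘ₗ (expand 2).toLinearMap ∘ₗ raise k i := by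
    refine (pBasis hk).ext fun β => ?_
    simp only [LinearMap.comp_apply, LinearMap.mulLeft_apply, AlgHom.toLinearMap_apply,
      pBasis_apply]
    have h1 : xProd A * expand 2 (pPoly k β) = pHat k (interleave A β) := by
      rw [pHat_eq, oddSet_interleave, half_interleave]
    have h2 : interleave A β + Pi.single i 1
        = interleave (A.erase i) (β + Pi.single i 1) := by
      funext l
      rw [Pi.add_apply, interleave, interleave, Pi.add_apply]
      rcases eq_or_ne l i with rfl | hl
      · simp [hi]
        ring
      · simp [hl]
    rw [h1, raiseHat_pHat hk, h2, pHat_eq, oddSet_interleave, half_interleave, raise_pPoly hk]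
  exact LinearMap.congr_fun h g

theorem raiseHat_of_notMem {k : ℝ} (hk : 0 ≤ k) {i : Fin N} {A : Finset (Fin N)} (hi : i ∉ A)
    (g : Poly N) :
    raiseHat k i (xProd A * expand 2 g) = X i * (xProd A * expand 2 g) := by
  have h : raiseHat k i ∘ₗ LinearMap.mulLeft ℝ (xProd A) ∘ₗ (expand 2).toLinearMap
      = LinearMap.mulLeft ℝ (X i) ∘ₗ LinearMap.mulLeft ℝ (xProd A)
        ∘ₗ (expand 2).toLinearMap := by
    refine (pBasis hk).ext fun β => ?_
    simp only [LinearMap.comp_apply, LinearMap.mulLeft_apply, AlgHom.toLinearMap_apply,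
      pBasis_apply]
    have h1 : xProd A * expand 2 (pPoly k β) = pHat k (interleave A β) := by
      rw [pHat_eq, oddSet_interleave, half_interleave]
    have h2 : interleave A β + Pi.single i 1 = interleave (insert i A) β := by
      funext l
      rw [Pi.add_apply, interleave, interleave]
      rcases eq_or_ne l i with rfl | hl
      · simp [hi]
      · simp [hl]
    rw [← mul_assoc (X i), xProd, ← Finset.prod_insert hi]
    rw [← xProd, ← xProd, h1, raiseHat_pHat hk, h2, pHat_eq, oddSet_interleave, half_interleave]
  exact LinearMap.congr_fun h g

/-! ### The type B Dunkl operators on `x_A g(x²)` -/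

theorem X_add_X_ne_zero (i j : Fin N) : (X i + X j : Poly N) ≠ 0 := by
  intro h
  have := congrArg (eval fun _ => (1 : ℝ)) h
  simp at this

theorem permAct_expand (w : Equiv.Perm (Fin N)) (g : Poly N) :
    permAct w (expand 2 g) = expand 2 (permAct w g) := rename_expand _ _ g

theorem tauAct_expand (i j : Fin N) (g : Poly N) :
    tauAct i j (expand 2 g) = expand 2 (permAct (Equiv.swap i j) g) := by
  have h : (tauAct i j).comp (expand 2) = (expand 2).comp (permAct (Equiv.swap i j)) := by
    apply algHom_ext
    intro m
    rw [AlgHom.comp_apply, AlgHom.comp_apply, expand_X, permAct_X, expand_X, map_pow, tauAct,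
      aeval_X, Equiv.swap_apply_def]
    split_ifs <;> ring
  exact DFunLike.congr_fun h g

theorem signAct_expand (i : Fin N) (g : Poly N) : signAct i (expand 2 g) = expand 2 g := by
  have h : (signAct i).comp (expand 2) = expand 2 := by
    apply algHom_ext
    intro m
    rw [AlgHom.comp_apply, expand_X, map_pow, signAct, aeval_X]
    split_ifs with hm
    · rw [hm]; ring
    · rfl
  exact DFunLike.congr_fun h g

theorem pderiv_expand_two (i : Fin N) (g : Poly N) :
    pderiv i (expand 2 g) = 2 * (X i * expand 2 (pderiv i g)) := by
  induction g using MvPolynomial.induction_on with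
  | C a => simp
  | add p q hp hq => rw [map_add, map_add, hp, hq, map_add, map_add]; ring
  | mul_X p m hp =>
    rw [map_mul, expand_X, Derivation.leibniz, hp, Derivation.leibniz, Derivation.leibniz_pow]
    simp only [smul_eq_mul, nsmul_eq_mul, map_add, map_mul, expand_X]
    rcases eq_or_ne m i with rfl | hm
    · simp only [pderiv_X_self, map_one]
      push_cast
      ring
    · simp only [pderiv_X_of_ne hm, map_zero, mul_zero]
      ring

theorem permAct_swap_xProd {i j : Fin N} {A : Finset (Fin N)} (hi : i ∉ A) (hj : j ∉ A) :
    permAct (Equiv.swap i j) (xProd A) = xProd A := by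
  rw [xProd, map_prod]
  refine Finset.prod_congr rfl fun l hl => ?_
  rw [permAct_X, Equiv.swap_apply_of_ne_of_ne]
  · rintro rfl; exact hi hl
  · rintro rfl; exact hj hl

theorem tauAct_X_left (i j : Fin N) : tauAct i j (X i) = -X j := by
  rw [tauAct, aeval_X, if_pos rfl]

theorem tauAct_X_right {i j : Fin N} (h : j ≠ i) : tauAct i j (X j) = -X i := by
  rw [tauAct, aeval_X, if_neg h, if_pos rfl]

theorem tauAct_xProd {i j : Fin N} {A : Finset (Fin N)} (hi : i ∉ A) (hj : j ∉ A) :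
    tauAct i j (xProd A) = xProd A := by
  rw [xProd, map_prod]
  refine Finset.prod_congr rfl fun l hl => ?_
  rw [tauAct, aeval_X, if_neg, if_neg]
  · rintro rfl; exact hj hl
  · rintro rfl; exact hi hl

theorem signAct_xProd {i : Fin N} {A : Finset (Fin N)} (hi : i ∉ A) :
    signAct i (xProd A) = xProd A := by
  rw [xProd, map_prod]
  refine Finset.prod_congr rfl fun l hl => ?_
  rw [signAct, aeval_X, if_neg]
  rintro rfl; exact hi hl

theorem pderiv_xProd {i : Fin N} {A : Finset (Fin N)} (hi : i ∉ A) :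
    pderiv i (xProd A) = 0 := by
  rw [xProd, derivation_prod]
  refine Finset.sum_eq_zero fun l hl => ?_
  rw [pderiv_X_of_ne, zero_mul]
  rintro rfl; exact hi hl

theorem xProd_eq_mul {i : Fin N} {A : Finset (Fin N)} (hi : i ∈ A) :
    xProd A = X i * xProd (A.erase i) := (Finset.mul_prod_erase A _ hi).symm

/-- Over the common denominator `x_i² - x_j²` both type B quotients are compared with one type A
quotient in the squares. -/
theorem exactQuot_add_exactQuot {i j : Fin N} (hij : i ≠ j) {f Q : Poly N}
    (h : (X i ^ 2 - X j ^ 2) * Q = (X i + X j) * (f - permAct (Equiv.swap i j) f)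
      + (X i - X j) * (f - tauAct i j f)) :
    exactQuot (f - permAct (Equiv.swap i j) f) (X i - X j)
      + exactQuot (f - tauAct i j f) (X i + X j) = Q := by
  have hne : (X i ^ 2 - X j ^ 2 : Poly N) ≠ 0 := by
    rw [sq_sub_sq]
    exact mul_ne_zero (X_add_X_ne_zero i j) (X_sub_X_ne_zero hij)
  apply mul_left_cancel₀ hne
  rw [h]
  have h1 := mul_exactQuot (dvd_swap i j f)
  have h2 := mul_exactQuot (dvd_tau i j f)
  linear_combination (X i + X j) * h1 + (X i - X j) * h2

theorem sq_sub_sq_mul_expand (i j : Fin N) (g : Poly N) :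
    (X i ^ 2 - X j ^ 2) * expand 2 (divDiff i j g)
      = expand 2 g - expand 2 (permAct (Equiv.swap i j) g) := by
  have h := congrArg (expand 2) (sub_mul_divDiff i j g)
  rwa [map_mul, map_sub, map_sub, expand_X, expand_X] at h

theorem dunklB_of_mem (k k₁ : ℝ) {i : Fin N} {A : Finset (Fin N)} (hi : i ∈ A) (g : Poly N) :
    dunklB k k₁ i (xProd (A.erase i) * expand 2 g)
      = 2 * (xProd A * expand 2 (dunklLin k i g)) := by
  have hi' : i ∉ A.erase i := Finset.notMem_erase i A
  -- Without the factor `x_i` the polynomial is even in `x_i`, so `k₁` does not enter.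
  have hsign : exactQuot (xProd (A.erase i) * expand 2 g
      - signAct i (xProd (A.erase i) * expand 2 g)) (X i) = 0 := by
    apply exactQuot_eq (X_ne_zero i)
    rw [map_mul, signAct_xProd hi', signAct_expand]
    ring
  have hpair : ∀ j ∈ Finset.univ.erase i,
      exactQuot (xProd (A.erase i) * expand 2 g
        - permAct (Equiv.swap i j) (xProd (A.erase i) * expand 2 g)) (X i - X j)
      + exactQuot (xProd (A.erase i) * expand 2 g
        - tauAct i j (xProd (A.erase i) * expand 2 g)) (X i + X j)
      = 2 * (xProd A * expand 2 (divDiff i j g)) := by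
    intro j hj
    have hji := Finset.ne_of_mem_erase hj
    have hdd := sq_sub_sq_mul_expand i j g
    apply exactQuot_add_exactQuot hji.symm
    by_cases hjA : j ∈ A
    · have hjB : j ∈ A.erase i := Finset.mem_erase.2 ⟨hji, hjA⟩
      have h1 : i ∉ (A.erase i).erase j := fun h => hi' (Finset.mem_of_mem_erase h)
      have h2 : j ∉ (A.erase i).erase j := Finset.notMem_erase _ _
      rw [xProd_eq_mul hi, xProd_eq_mul hjB, map_mul, map_mul, map_mul, map_mul,
        permAct_swap_xProd h1 h2, tauAct_xProd h1 h2, permAct_expand, tauAct_expand, permAct_X,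
        Equiv.swap_apply_right, tauAct_X_right hji]
      linear_combination 2 * X i * X j * xProd ((A.erase i).erase j) * hdd
    · have hjB : j ∉ A.erase i := fun h => hjA (Finset.mem_of_mem_erase h)
      rw [xProd_eq_mul hi, map_mul, map_mul, permAct_swap_xProd hi' hjB, tauAct_xProd hi' hjB,
        permAct_expand, tauAct_expand]
      linear_combination 2 * X i * xProd (A.erase i) * hdd
  rw [dunklB, hsign, Finset.sum_congr rfl hpair, dunklLin_apply, Derivation.leibniz,
    pderiv_xProd hi', pderiv_expand_two, map_add, map_smul, map_sum, xProd_eq_mul hi,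
    ← Finset.mul_sum, ← Finset.mul_sum, smul_zero, smul_zero, add_zero, add_zero, smul_eq_mul,
    mul_add, mul_add, mul_smul_comm, mul_smul_comm]
  ring

/-- In `2 k₁ - 1`, the part `2 k₁` comes from oddness in `x_i`. The `-1` appears because
differentiating the single factor `x_i` gives one copy of `g`, whereas `2 T_i x_i` counts two. -/
theorem dunklB_of_notMem (k k₁ : ℝ) {i : Fin N} {A : Finset (Fin N)} (hi : i ∉ A) (g : Poly N) :
    dunklB k k₁ i (X i * (xProd A * expand 2 g))
      = xProd A * expand 2 ((2 : ℝ) • dunklLin k i (X i * g) + (2 * k₁ - 1) • g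
        - (2 * k) • ∑ j ∈ A, permAct (Equiv.swap i j) g) := by
  have hsign : exactQuot (X i * (xProd A * expand 2 g)
      - signAct i (X i * (xProd A * expand 2 g))) (X i) = 2 * (xProd A * expand 2 g) := by
    apply exactQuot_eq (X_ne_zero i)
    rw [map_mul, map_mul, signAct_xProd hi, signAct_expand, signAct, aeval_X, if_pos rfl]
    ring
  have hpair : ∀ j ∈ Finset.univ.erase i,
      exactQuot (X i * (xProd A * expand 2 g)
        - permAct (Equiv.swap i j) (X i * (xProd A * expand 2 g))) (X i - X j)
      + exactQuot (X i * (xProd A * expand 2 g)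
        - tauAct i j (X i * (xProd A * expand 2 g))) (X i + X j)
      = 2 * (xProd A * expand 2 (divDiff i j (X i * g)))
        - if j ∈ A then 2 * (xProd A * expand 2 (permAct (Equiv.swap i j) g)) else 0 := by
    intro j hj
    have hji := Finset.ne_of_mem_erase hj
    have hdd := sq_sub_sq_mul_expand i j g
    apply exactQuot_add_exactQuot hji.symm
    rw [divDiff_X_left_mul hji.symm, map_add, map_mul (expand 2), expand_X, map_mul, map_mul,
      map_mul, map_mul, permAct_expand, tauAct_expand, permAct_X, Equiv.swap_apply_left,
      tauAct_X_left]
    by_cases hjA : j ∈ A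
    · have h1 : i ∉ A.erase j := fun h => hi (Finset.mem_of_mem_erase h)
      have h2 : j ∉ A.erase j := Finset.notMem_erase _ _
      rw [if_pos hjA, xProd_eq_mul hjA, map_mul, map_mul, permAct_X, Equiv.swap_apply_right,
        tauAct_X_right hji, permAct_swap_xProd h1 h2, tauAct_xProd h1 h2]
      linear_combination 2 * X i ^ 2 * X j * xProd (A.erase j) * hdd
    · rw [if_neg hjA, permAct_swap_xProd hi hjA, tauAct_xProd hi hjA]
      linear_combination 2 * X i ^ 2 * xProd A * hdd
  have hsum : ∑ j ∈ Finset.univ.erase i,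
        (if j ∈ A then 2 * (xProd A * expand 2 (permAct (Equiv.swap i j) g)) else 0)
      = 2 * (xProd A * expand 2 (∑ j ∈ A, permAct (Equiv.swap i j) g)) := by
    rw [← Finset.sum_filter, map_sum, Finset.mul_sum, Finset.mul_sum]
    refine Finset.sum_congr ?_ fun _ _ => rfl
    ext x
    simp only [Finset.mem_filter, Finset.mem_erase, Finset.mem_univ, and_true]
    exact ⟨fun h => h.2, fun h => ⟨fun e => hi (e ▸ h), h⟩⟩
  have hone : (2 : Poly N) = C 2 := (map_ofNat C 2).symm
  rw [dunklB, hsign, Finset.sum_congr rfl hpair, Finset.sum_sub_distrib, hsum, dunklLin_apply,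
    Derivation.leibniz, Derivation.leibniz, Derivation.leibniz, pderiv_X_self, pderiv_xProd hi,
    pderiv_expand_two, ← Finset.mul_sum, ← Finset.mul_sum, ← map_sum]
  simp only [map_add, map_sub, map_mul, expand_X, expand_C, smul_eq_C_mul, smul_eq_mul,
    map_one, hone]
  linear_combination (xProd A * expand 2 g) * hone

/-- All `j < i` lie in `A`, so `σ_ij` and `τ_ij` both fix `x_A`, and their sum doubles the type A
transposition. -/
theorem opUB_of_mem {k : ℝ} (hk : 0 ≤ k) (k₁ : ℝ) {i : Fin N} {A : Finset (Fin N)} (hi : i ∈ A)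
    (hA : ∀ j, j < i → j ∈ A) (g : Poly N) :
    opUB k k₁ i (xProd A * expand 2 g) = xProd A * expand 2 ((2 : ℝ) • opU k i g) := by
  have hsum : ∑ j ∈ Finset.Iio i, (permAct (Equiv.swap i j) (xProd A * expand 2 g)
        + tauAct i j (xProd A * expand 2 g))
      = 2 * (xProd A * expand 2 (∑ j ∈ Finset.Iio i, permAct (Equiv.swap i j) g)) := by
    rw [map_sum, Finset.mul_sum, Finset.mul_sum]
    refine Finset.sum_congr rfl fun j hj => ?_
    have hlt := Finset.mem_Iio.1 hj
    have hjB : j ∈ A.erase i := Finset.mem_erase.2 ⟨hlt.ne, hA j hlt⟩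
    have h1 : i ∉ (A.erase i).erase j := fun h =>
      Finset.notMem_erase i A (Finset.mem_of_mem_erase h)
    have h2 : j ∉ (A.erase i).erase j := Finset.notMem_erase _ _
    rw [xProd_eq_mul hi, xProd_eq_mul hjB]
    simp only [map_mul]
    rw [permAct_swap_xProd h1 h2, tauAct_xProd h1 h2, permAct_expand, tauAct_expand, permAct_X,
      permAct_X, Equiv.swap_apply_right, Equiv.swap_apply_left, tauAct_X_right hlt.ne,
      tauAct_X_left]
    ring
  have hone : (2 : Poly N) = C 2 := (map_ofNat C 2).symm
  rw [opUB, raiseHat_of_mem hk hi, dunklB_of_mem k k₁ hi, hsum, opU, dunklA_eq]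
  simp only [map_sub, map_mul, expand_C, smul_eq_C_mul, hone]
  ring

/-- For `j ∈ A` the actions of `σ_ij` and `τ_ij` cancel, since they produce opposite signs on `x_j`.
The missing transpositions are those that `dunklB_of_notMem` already subtracts. The shift `-k`
removes the `k` in `T_i ρ_i = T_i x_i + k`, as here `ρ̂_i` is plain multiplication by `x_i`. -/
theorem opUB_of_notMem {k : ℝ} (hk : 0 ≤ k) (k₁ : ℝ) {i : Fin N} {A : Finset (Fin N)}
    (hi : i ∉ A) (hA : ∀ j ∈ A, j < i) (g : Poly N) :
    opUB k k₁ i (xProd A * expand 2 g)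
      = xProd A * expand 2 ((2 : ℝ) • (opU k i g + (k₁ - k - 1 / 2) • g)) := by
  have hterm : ∀ j ∈ Finset.Iio i, permAct (Equiv.swap i j) (xProd A * expand 2 g)
        + tauAct i j (xProd A * expand 2 g)
      = 2 * (xProd A * expand 2 (permAct (Equiv.swap i j) g))
        - if j ∈ A then 2 * (xProd A * expand 2 (permAct (Equiv.swap i j) g)) else 0 := by
    intro j hj
    have hlt := Finset.mem_Iio.1 hj
    by_cases hjA : j ∈ A
    · have h1 : i ∉ A.erase j := fun h => hi (Finset.mem_of_mem_erase h)
      have h2 : j ∉ A.erase j := Finset.notMem_erase _ _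
      rw [if_pos hjA, xProd_eq_mul hjA]
      simp only [map_mul]
      rw [permAct_X, Equiv.swap_apply_right, tauAct_X_right hlt.ne, permAct_swap_xProd h1 h2,
        tauAct_xProd h1 h2, permAct_expand, tauAct_expand]
      ring
    · rw [if_neg hjA, map_mul, map_mul, permAct_swap_xProd hi hjA, tauAct_xProd hi hjA,
        permAct_expand, tauAct_expand]
      ring
  have hsum : ∑ j ∈ Finset.Iio i,
        (if j ∈ A then 2 * (xProd A * expand 2 (permAct (Equiv.swap i j) g)) else 0)
      = 2 * (xProd A * expand 2 (∑ j ∈ A, permAct (Equiv.swap i j) g)) := by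
    rw [← Finset.sum_filter, map_sum, Finset.mul_sum, Finset.mul_sum]
    refine Finset.sum_congr ?_ fun _ _ => rfl
    ext x
    simp only [Finset.mem_filter, Finset.mem_Iio]
    exact ⟨fun h => h.2, fun h => ⟨hA x h, h⟩⟩
  have hone : (2 : Poly N) = C 2 := (map_ofNat C 2).symm
  have hhalf : (C (2⁻¹ : ℝ) : Poly N) * C 2 = 1 := by
    rw [← map_mul, inv_mul_cancel₀ two_ne_zero, map_one]
  rw [opUB, raiseHat_of_notMem hk hi, dunklB_of_notMem k k₁ hi, Finset.sum_congr rfl hterm,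
    Finset.sum_sub_distrib, hsum, opU_eq hk, cherednik_apply, ← Finset.mul_sum, ← Finset.mul_sum,
    ← map_sum]
  simp only [map_add, map_sub, smul_eq_C_mul, hone, map_mul, expand_C, one_div,
    map_one]
  linear_combination (xProd A * expand 2 g) * hhalf

/-! ### The spaces `E^B_α` -/

/-- The interval `[1, ℓ]`. -/
def initialSet (N ℓ : ℕ) : Finset (Fin N) := Finset.univ.filter fun i : Fin N => (i : ℕ) < ℓ

theorem zetaB_eq (k : ℝ) (ℓ : ℕ) (γ : Fin N → ℕ) :
    zetaB k ℓ γ = xProd (initialSet N ℓ) * expand 2 (zeta k γ) := rfl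

theorem zetaB_ne_zero {k : ℝ} (hk : 0 ≤ k) (ℓ : ℕ) (γ : Fin N → ℕ) : zetaB k ℓ γ ≠ 0 := by
  rw [zetaB_eq]
  exact mul_ne_zero (Finset.prod_ne_zero_iff.2 fun i _ => X_ne_zero i)
    ((expand_ne_zero two_pos).2 (zeta_ne_zero hk γ))

theorem opUB_zetaB {k : ℝ} (hk : 0 ≤ k) (k₁ : ℝ) (ℓ : ℕ) (γ : Fin N → ℕ) (i : Fin N) :
    opUB k k₁ i (zetaB k ℓ γ) = (if (i : ℕ) < ℓ then 2 * kappa k γ i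
      else 2 * (kappa k γ i + k₁ - k - 1 / 2)) • zetaB k ℓ γ := by
  have hmem : ∀ j : Fin N, j ∈ initialSet N ℓ ↔ (j : ℕ) < ℓ := by simp [initialSet]
  rw [zetaB_eq]
  split_ifs with h
  · rw [opUB_of_mem hk k₁ ((hmem i).2 h) (fun j hj => (hmem j).2 (lt_trans hj h)),
      (isZeta_zeta hk γ).1, smul_smul, map_smul, mul_smul_comm]
  · rw [opUB_of_notMem hk k₁ (fun hi => h ((hmem i).1 hi)) (fun j hj => ?_),
      (isZeta_zeta hk γ).1, ← add_smul, smul_smul, map_smul, mul_smul_comm]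
    · congr 1
      ring
    · exact Fin.lt_def.2 (lt_of_lt_of_le ((hmem j).1 hj) (not_lt.1 h))

theorem permAct_mem_spaceEB {k : ℝ} (hk : 0 ≤ k) (ℓ : ℕ) (α : Fin N → ℕ)
    {w : Equiv.Perm (Fin N)} (hw : w ∈ youngSubgroup N ℓ) {f : Poly N}
    (hf : f ∈ spaceEB k ℓ α) : permAct w f ∈ spaceEB k ℓ α := by
  have hblock : ∀ i j : Fin N, ((if (i : ℕ) < ℓ then 1 else 0) = if (j : ℕ) < ℓ then 1 else 0)
      ↔ ((i : ℕ) < ℓ ↔ (j : ℕ) < ℓ) := by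
    intro i j
    by_cases h1 : (i : ℕ) < ℓ <;> by_cases h2 : (j : ℕ) < ℓ <;> simp [h1, h2]
  -- The indicator of the first block is antitone and its fibres are the two blocks, so only
  -- adjacent transpositions inside a block remain.
  refine perm_induction_of_antitone (f := fun i : Fin N => if (i : ℕ) < ℓ then 1 else 0)
    (P := fun w => ∀ f ∈ spaceEB k ℓ α, permAct w f ∈ spaceEB k ℓ α) ?_ ?_ ?_ w ?_ f hf
  · intro i j hij
    dsimp only
    have : (i : ℕ) ≤ j := hij
    split_ifs <;> omega
  · intro f hf
    rwa [permAct_one]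
  · intro i j v hij hb _ hP f hf
    rw [permAct_mul]
    have hf' := hP f hf
    have hsY : Equiv.swap i j ∈ youngSubgroup N ℓ := by
      intro x
      rw [Equiv.swap_apply_def]
      split_ifs with h1 h2
      · rw [h1]
        exact ((hblock i j).1 hb).symm
      · rw [h2]
        exact (hblock i j).1 hb
      · exact Iff.rfl
    have hA : permAct (Equiv.swap i j) (xProd (initialSet N ℓ)) = xProd (initialSet N ℓ) := by
      rw [xProd, map_prod]
      simp only [permAct_X]
      refine Finset.prod_nbij' (Equiv.swap i j) (Equiv.swap i j) ?_ ?_ (by simp) (by simp)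
        (fun _ _ => rfl)
      · intro x hx
        simp only [initialSet, Finset.mem_filter, Finset.mem_univ, true_and] at hx ⊢
        exact (hsY x).2 hx
      · intro x hx
        simp only [initialSet, Finset.mem_filter, Finset.mem_univ, true_and] at hx ⊢
        exact (hsY x).2 hx
    generalize permAct v f = q at hf' ⊢
    induction hf' using Submodule.span_induction with
    | mem x hx =>
      obtain ⟨u, hu, rfl⟩ := hx
      obtain ⟨a, b, hab⟩ := exists_permAct_swap_zeta hk (permComp u (half α)) hij
      rw [zetaB_eq, map_mul, hA, permAct_expand, hab, map_add, map_smul, map_smul, mul_add,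
        mul_smul_comm, mul_smul_comm, ← zetaB_eq, ← zetaB_eq, ← permComp_mul]
      refine Submodule.add_mem _ (Submodule.smul_mem _ _ (Submodule.subset_span ⟨u, hu, rfl⟩))
        (Submodule.smul_mem _ _ (Submodule.subset_span ⟨_, ?_, rfl⟩))
      exact (youngSubgroup N ℓ).mul_mem hsY hu
    | zero => rw [map_zero]; exact Submodule.zero_mem _
    | add x y _ _ hx hy => rw [map_add]; exact Submodule.add_mem _ hx hy
    | smul a x _ hx => rw [map_smul]; exact Submodule.smul_mem _ a hx
  · intro x
    exact (hblock _ _).2 (hw x)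

end DunklJack

theorem proposition5p6 (N : ℕ) (k k₁ : ℝ) (hk : 0 ≤ k) (ℓ : ℕ) (α : Fin N → ℕ)
    (hα : DunklJack.IsStandardBPartition ℓ α) :
    (∀ w ∈ DunklJack.youngSubgroup N ℓ, ∀ f ∈ DunklJack.spaceEB k ℓ α,
      DunklJack.permAct w f ∈ DunklJack.spaceEB k ℓ α) ∧
    (∀ w ∈ DunklJack.youngSubgroup N ℓ, ∀ γ : Fin N → ℕ,
      γ = DunklJack.permComp w (DunklJack.half α) →
        DunklJack.zetaB k ℓ γ ≠ 0 ∧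
        ∀ i : Fin N,
          DunklJack.opUB k k₁ i (DunklJack.zetaB k ℓ γ) =
            (if (i : ℕ) < ℓ then 2 * DunklJack.kappa k γ i
              else 2 * (DunklJack.kappa k γ i + k₁ - k - 1 / 2)) • DunklJack.zetaB k ℓ γ) :=
  ⟨fun _ hw _ hf => DunklJack.permAct_mem_spaceEB hk ℓ α hw hf,
    fun _ _ γ _ => ⟨DunklJack.zetaB_ne_zero hk ℓ γ, fun i => DunklJack.opUB_zetaB hk k₁ ℓ γ i⟩⟩
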